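/- **Setting.** Let $n\ge 0$ be an integer. On the unit circle $\mathbb T$ with normalised Lebesgue measure, $(L^q)^n$ and $(H^q)^n$ denote the spaces of column vectors of length $n$ with entries in $L^q$ and in the Hardy space $H^q$; $\overline{(H^q_0)^n}$ is the space of complex conjugates of those $f\in (H^q)^n$ with $f(0)=0$; $L^{(p,n\times n)}$ is the space of $n\times n$ matrices with entries in $L^p$. On $(L^2)^n$ we use the norm $\|f\|^2=\sum_i\|f_i\|_{L^2}^2$. The backward shift is $S^*f=(f-f(0))/z$. For $1<q<\infty$, $P_{q+}:(L^q)^n\to(H^q)^n$ is the Riesz projection along $\overline{(H^q_0)^n}$. Let $\Theta$ be an $n\times n$ matrix inner function (entries in $H^\infty$, unitary values a.e. on $\mathbb T$), let $K_\Theta=\Theta\overline{(H^2_0)^n}\cap (H^2)^n$, and let $P_\Theta$ be the orthogonal projection of $(L^2)^n$ onto $K_\Theta$. Let $p\in(2,\infty]$, $\frac1q=\frac12+\frac1p$, and let $G\in L^{(p,n\times n)}$ be such that the map $f\mapsto P_\Theta(Gf)$, defined on the dense subspace $K_\Theta\cap(H^\infty)^n$ of $K_\Theta$, is bounded in the $L^2$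 norm; let $A=A_G^\Theta:K_\Theta\to K_\Theta$ be its bounded extension and let $M=\ker A_G^\Theta$. Let $\mathcal N$ be the kernel of the Toeplitz operator $(f_1,f_2)\mapsto\big(P_{2+}(\Theta^*f_1),\,P_{q+}(Gf_1+\Theta f_2)\big)$ on $(H^2)^n\times(H^q)^n$. Let $W_1,\dots,W_s\in\mathcal N$ be such that $W_1(0),\dots,W_s(0)$ is a basis of $\{F(0):F\in\mathcal N\}\subseteq\mathbb C^{2n}$. Write $P_n(f_1,f_2)=f_1$ and put $$D=\frac{\operatorname{span}\{P_nW_1,\dots,P_nW_s\}}{z}\cap (H^2)^n ,\qquad D'=(M+D)\ominus M .$$ So $D'$ is the orthogonal projection of $D$ to $M^\perp$, and $D'=D$ if $D\perp M$. **Theorem.** We have $\dim D\le n$, $m:=\dim D'\le n$, and $M$ is nearly $S^*$-invariant with defect space $D'$: if $f\in M$ and $f(0)=0$, then $S^*f\in M\oplus D'$. The number $r:=\dim\big(M\ominus(M\cap z(H^2)^n)\big)$ is finite. Let $e_1,\dots,e_m$ be any orthonormal basis of $D'$, and let $F_0$ be the matrix whose columns are the elements of any orthonormal basis of $M\ominus(M\cap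 z(H^2)^n)$. 1. If some function in $M$ does not vanish at $0$, there is a closed $S^*$-invariant subspace $K\subseteq(H^2)^{r+m}$ such that $$\ker A_G^\Theta=\Big\{F:\ F(z)=F_0(z)k_0(z)+z\sum_{j=1}^m k_j(z)e_j(z),\ (k_0,\dots,k_m)\in K\Big\},$$ where $k_0\in(H^2)^r$, $k_1,\dots,k_m\in H^2$, and $\|F\|^2=\sum_{j=0}^m\|k_j\|^2$ for every $(k_0,\dots,k_m)\in K$ and the corresponding $F$. 2. If all functions in $M$ vanish at $0$, there is a closed $S^*$-invariant subspace $K\subseteq(H^2)^m$ such that $$\ker A_G^\Theta=\Big\{F:\ F(z)=z\sum_{j=1}^m k_j(z)e_j(z),\ (k_1,\dots,k_m)\in K\Big\},$$ and $\|F\|^2=\sum_{j=1}^m\|k_j\|^2$ for every $(k_1,\dots,k_m)\in K$ and the corresponding $F$. -/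

import Mathlib

open MeasureTheory AddCircle
open scoped ENNReal

noncomputable section

namespace MTTO

/-- The unit circle, parametrised by `t ↦ z = e^{2 π i t}`; its normalised Lebesgue measure is
`haarAddCircle`, and `fourier k t = z ^ k`. -/
abbrev Circ : Type := AddCircle (1 : ℝ)

/-- The space `(L^q)^ι` of column vectors, indexed by the finite type `ι`, of `L^q` functions on
the unit circle. For `q = 2` it is a Hilbert space with `‖f‖² = ∑ i, ‖f i‖²`. -/
abbrev LV (ι : Type) [Fintype ι] (q : ℝ≥0∞) : Type :=
  Lp (EuclideanSpace ℂ ι) q (haarAddCircle (T := (1 : ℝ)))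

section Basic

variable {E : Type*} [NormedAddCommGroup E] [NormedSpace ℂ E]

/-- All Fourier coefficients of negative index vanish: an `L^q` function, `1 ≤ q ≤ ∞`, with this
property is (the boundary function of) an element of `H^q`. -/
def IsAnalytic (f : Circ → E) : Prop := ∀ k : ℤ, k < 0 → fourierCoeff f k = 0

/-- All Fourier coefficients of nonnegative index vanish: an `L^q` function, `1 ≤ q ≤ ∞`, with this
property is an element of the conjugate `\overline{H^q_0}` of the space of those `H^q` functions
that vanish at the origin. -/
def IsCoanalyticZero (f : Circ → E) : Prop := ∀ k : ℤ, 0 ≤ k → fourierCoeff f k = 0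

/-- The value at the origin of (the analytic extension to the disc of) a Hardy space function. -/
def atZero (f : Circ → E) : E := fourierCoeff f 0

theorem fourierCoeff_congr {f g : Circ → E} (h : f =ᵐ[haarAddCircle] g) (k : ℤ) :
    fourierCoeff f k = fourierCoeff g k := by
  unfold fourierCoeff
  apply integral_congr_ae
  filter_upwards [h] with t ht
  rw [ht]

theorem integrable_fourier_smul {f : Circ → E} (hf : Integrable f haarAddCircle) (k : ℤ) :
    Integrable (fun t => fourier k t • f t) haarAddCircle := by
  refine hf.bdd_smul (C := 1) ?_ ?_
  · exact (map_continuous (fourier k)).aestronglyMeasurable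
  · exact Filter.Eventually.of_forall fun t => by
      rw [fourier_apply, Circle.norm_coe]

theorem fourierCoeff_add' {f g : Circ → E} (hf : Integrable f haarAddCircle)
    (hg : Integrable g haarAddCircle) (k : ℤ) :
    fourierCoeff (f + g) k = fourierCoeff f k + fourierCoeff g k := by
  unfold fourierCoeff
  rw [← integral_add (integrable_fourier_smul hf _) (integrable_fourier_smul hg _)]
  simp [smul_add]

end Basic

variable {ι : Type} [Fintype ι]

theorem integrable_two (f : LV ι 2) : Integrable f haarAddCircle :=
  (Lp.memLp f).integrable (by norm_num)

theorem fourierCoeff_lp_add (f g : LV ι 2) (k : ℤ) :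
    fourierCoeff (f + g : LV ι 2) k = fourierCoeff f k + fourierCoeff g k := by
  rw [fourierCoeff_congr (Lp.coeFn_add f g), fourierCoeff_add' (integrable_two f) (integrable_two g)]

theorem fourierCoeff_lp_smul (c : ℂ) (f : LV ι 2) (k : ℤ) :
    fourierCoeff (c • f : LV ι 2) k = c • fourierCoeff f k := by
  rw [fourierCoeff_congr (Lp.coeFn_smul c f), fourierCoeff.const_smul]

theorem fourierCoeff_lp_zero (k : ℤ) : fourierCoeff (0 : LV ι 2) k = 0 := by
  have h := fourierCoeff_lp_smul (0 : ℂ) (0 : LV ι 2) k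
  simpa using h

theorem memLp_fourier_smul {f : Circ → EuclideanSpace ℂ ι} (hf : MemLp f 2 haarAddCircle) (k : ℤ) :
    MemLp (fun t => fourier k t • f t) 2 haarAddCircle := by
  refine hf.of_le ?_ (Filter.Eventually.of_forall fun t => ?_)
  · exact (map_continuous (fourier k)).aestronglyMeasurable.smul hf.1
  · rw [norm_smul, fourier_apply, Circle.norm_coe, one_mul]

/-- The space `(H²)^ι` as a subspace of `(L²)^ι`. -/
def hardy (ι : Type) [Fintype ι] : Submodule ℂ (LV ι 2) where
  carrier := {f | IsAnalytic f}
  add_mem' {f g} hf hg k hk := by rw [fourierCoeff_lp_add, hf k hk, hg k hk, add_zero]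
  zero_mem' k _ := fourierCoeff_lp_zero k
  smul_mem' c f hf k hk := by rw [fourierCoeff_lp_smul, hf k hk, smul_zero]

/-- Multiplication by the independent variable `z` on `(L²)^ι`. -/
def mulZ (ι : Type) [Fintype ι] : LV ι 2 →ₗ[ℂ] LV ι 2 where
  toFun f := (memLp_fourier_smul (Lp.memLp f) 1).toLp _
  map_add' f g := by
    rw [← MemLp.toLp_add]
    apply MemLp.toLp_congr
    filter_upwards [Lp.coeFn_add f g] with t ht
    simp only [Pi.add_apply]
    rw [← smul_add, ht, Pi.add_apply]
  map_smul' c f := by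
    rw [RingHom.id_apply, ← MemLp.toLp_const_smul]
    apply MemLp.toLp_congr
    filter_upwards [Lp.coeFn_smul c f] with t ht
    simp only [ht, Pi.smul_apply]
    rw [smul_comm]

/-- The backward shift `S^* f = (f - f(0)) / z`. -/
def backwardShift (f : LV ι 2) : LV ι 2 :=
  (memLp_fourier_smul ((Lp.memLp f).sub (memLp_const (atZero f))) (-1)).toLp _

/-- The `i`-th coordinate of a vector of `L²` functions. -/
def coord (i : ι) (f : LV ι 2) : Lp ℂ 2 (haarAddCircle (T := (1 : ℝ))) :=
  (EuclideanSpace.proj i : EuclideanSpace ℂ ι →L[ℂ] ℂ).compLp f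

variable {n : ℕ}

/-- The product of an `n × n` matrix function with a vector function. -/
def act (M : Circ → Matrix (Fin n) (Fin n) ℂ) (f : Circ → EuclideanSpace ℂ (Fin n)) :
    Circ → EuclideanSpace ℂ (Fin n) :=
  fun t => WithLp.toLp 2 ((M t).mulVec (f t).ofLp)

theorem act_add (M : Circ → Matrix (Fin n) (Fin n) ℂ) (f g : Circ → EuclideanSpace ℂ (Fin n))
    (t : Circ) : act M (f + g) t = act M f t + act M g t := by
  simp [act, Matrix.mulVec_add]

theorem act_smul (M : Circ → Matrix (Fin n) (Fin n) ℂ) (c : ℂ)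
    (f : Circ → EuclideanSpace ℂ (Fin n)) (t : Circ) : act M (c • f) t = c • act M f t := by
  simp [act, Matrix.mulVec_smul]

/-- `n × n` matrix inner functions: bounded analytic entries, unitary values almost everywhere. -/
structure IsInner (Θ : Circ → Matrix (Fin n) (Fin n) ℂ) : Prop where
  bounded : ∀ i j, MemLp (fun t => Θ t i j) ∞ haarAddCircle
  analytic : ∀ i j, IsAnalytic (fun t => Θ t i j)
  unitary : ∀ᵐ t ∂haarAddCircle, Θ t ∈ Matrix.unitaryGroup (Fin n) ℂ

/-- The model space `K_Θ = Θ \overline{(H²_0)^n} ∩ (H²)^n`. -/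
def modelSpace (Θ : Circ → Matrix (Fin n) (Fin n) ℂ) : Submodule ℂ (LV (Fin n) 2) where
  carrier := {f | f ∈ hardy (Fin n) ∧
    ∃ g : LV (Fin n) 2, IsCoanalyticZero g ∧ f =ᵐ[haarAddCircle] act Θ g}
  add_mem' := by
    rintro f f' ⟨hf, g, hg, hfg⟩ ⟨hf', g', hg', hfg'⟩
    refine ⟨add_mem hf hf', g + g', fun k hk => ?_, ?_⟩
    · rw [fourierCoeff_lp_add, hg k hk, hg' k hk, add_zero]
    · filter_upwards [hfg, hfg', Lp.coeFn_add f f', Lp.coeFn_add g g'] with t h1 h2 h3 h4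
      rw [h3, Pi.add_apply, h1, h2, ← act_add]
      simp only [act, h4]
  zero_mem' := by
    refine ⟨zero_mem _, 0, fun k _ => fourierCoeff_lp_zero k, ?_⟩
    exact Filter.Eventually.of_forall fun t => by simp [act]
  smul_mem' := by
    rintro c f ⟨hf, g, hg, hfg⟩
    refine ⟨Submodule.smul_mem _ c hf, c • g, fun k hk => ?_, ?_⟩
    · rw [fourierCoeff_lp_smul, hg k hk, smul_zero]
    · filter_upwards [hfg, Lp.coeFn_smul c f, Lp.coeFn_smul c g] with t h1 h3 h4
      rw [h3, Pi.smul_apply, h1, ← act_smul]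
      simp only [act, h4]

/-- `u = P_Θ v`, the orthogonal projection of `v ∈ (L²)^n` to `K_Θ`. -/
def IsModelProj (Θ : Circ → Matrix (Fin n) (Fin n) ℂ) (v u : LV (Fin n) 2) : Prop :=
  u ∈ modelSpace Θ ∧ v - u ∈ (modelSpace Θ)ᗮ

/-- `A` is the (bounded) matrix-valued truncated Toeplitz operator `A_G^Θ`: the bounded operator on
`K_Θ` that agrees with `f ↦ P_Θ (G f)` on the dense subspace `K_Θ ∩ (H^∞)^n`. -/
def IsMTTO (Θ G : Circ → Matrix (Fin n) (Fin n) ℂ) (A : modelSpace Θ →L[ℂ] modelSpace Θ) : Prop :=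
  ∀ f : modelSpace Θ, MemLp (f : LV (Fin n) 2) ∞ haarAddCircle →
    ∃ v : LV (Fin n) 2, v =ᵐ[haarAddCircle] act G (f : LV (Fin n) 2) ∧
      IsModelProj Θ v (A f : LV (Fin n) 2)

/-- The kernel of an operator on `K_Θ`, as a subspace of `(L²)^n`. -/
def kerIn {Θ : Circ → Matrix (Fin n) (Fin n) ℂ} (A : modelSpace Θ →L[ℂ] modelSpace Θ) :
    Submodule ℂ (LV (Fin n) 2) :=
  (LinearMap.ker (A : modelSpace Θ →ₗ[ℂ] modelSpace Θ)).map (modelSpace Θ).subtype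

/-- `g = P_{q+} h`, the Riesz projection of `h ∈ (L^q)^n` to `(H^q)^n` along
`\overline{(H^q_0)^n}`. -/
def IsRieszProj {q : ℝ≥0∞} (h g : LV (Fin n) q) : Prop :=
  IsAnalytic g ∧ IsCoanalyticZero (h - g : LV (Fin n) q)

/-- The kernel of the Toeplitz operator
`(f₁, f₂) ↦ (P_{2+} (Θ^* f₁), P_{q+} (G f₁ + Θ f₂))` on `(H²)^n × (H^q)^n`. -/
def kerT (Θ G : Circ → Matrix (Fin n) (Fin n) ℂ) (q : ℝ≥0∞) :
    Set (LV (Fin n) 2 × LV (Fin n) q) :=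
  {f | IsAnalytic f.1 ∧ IsAnalytic f.2 ∧
    (∃ h : LV (Fin n) 2, h =ᵐ[haarAddCircle] act (fun t => (Θ t).conjTranspose) f.1 ∧
      IsRieszProj h 0) ∧
    (∃ h : LV (Fin n) q, h =ᵐ[haarAddCircle] act G f.1 + act Θ f.2 ∧ IsRieszProj h 0)}

/-- The value at the origin, in `ℂ^n × ℂ^n`, of a pair of vector functions. -/
def pairAtZero {q : ℝ≥0∞} (f : LV (Fin n) 2 × LV (Fin n) q) :
    EuclideanSpace ℂ (Fin n) × EuclideanSpace ℂ (Fin n) :=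
  (atZero f.1, atZero f.2)

/-- `W 0, …, W (s - 1)` are elements of `kerT Θ G q` whose values at the origin form a basis of the
space of all values at the origin of elements of `kerT Θ G q`. -/
structure IsValueBasis (Θ G : Circ → Matrix (Fin n) (Fin n) ℂ) (q : ℝ≥0∞) {s : ℕ}
    (W : Fin s → LV (Fin n) 2 × LV (Fin n) q) : Prop where
  mem : ∀ i, W i ∈ kerT Θ G q
  linearIndependent : LinearIndependent ℂ (fun i => pairAtZero (W i))
  spans : ∀ f ∈ kerT Θ G q, pairAtZero f ∈ Submodule.span ℂ (Set.range fun i => pairAtZero (W i))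

/-- The space `(span {P_n W_1, …, P_n W_s} / z) ∩ (H²)^n`, where `P_n` keeps the first component
of a pair. -/
def defectSpace {q : ℝ≥0∞} {s : ℕ} (W : Fin s → LV (Fin n) 2 × LV (Fin n) q) :
    Submodule ℂ (LV (Fin n) 2) :=
  (Submodule.span ℂ (Set.range fun i => (W i).1)).comap (mulZ (Fin n)) ⊓ hardy (Fin n)

/-- The subspace `(M + D) ⊖ M`, that is, the orthogonal projection of `D` to the orthogonal
complement of the closed subspace `M`; it is `D` itself if `D` is orthogonal to `M`. -/
def orthDefect (M D : Submodule ℂ (LV (Fin n) 2)) : Submodule ℂ (LV (Fin n) 2) :=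
  (M ⊔ D) ⊓ Mᗮ

/-- The subspace `M ⊖ (M ∩ z (H²)^n)`. -/
def wandering (M : Submodule ℂ (LV (Fin n) 2)) : Submodule ℂ (LV (Fin n) 2) :=
  M ⊓ (M ⊓ (hardy (Fin n)).map (mulZ (Fin n)))ᗮ

/-- Closed `S^*`-invariant subspaces of `(H²)^ι`. -/
structure IsClosedInvariant (K : Submodule ℂ (LV ι 2)) : Prop where
  le_hardy : K ≤ hardy ι
  isClosed : IsClosed (K : Set (LV ι 2))
  invariant : ∀ k ∈ K, backwardShift k ∈ K

/-- `M = {Φ k : k ∈ K}`, and `‖Φ k‖² = ∑ i, ‖k i‖²` for every `k ∈ K`; here `Φ k` is a function on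
the circle, and it is part of the claim that it is in `(L²)^n` for every `k ∈ K`. -/
structure IsIsometricImage (M : Submodule ℂ (LV (Fin n) 2)) (K : Submodule ℂ (LV ι 2))
    (Φ : LV ι 2 → Circ → EuclideanSpace ℂ (Fin n)) : Prop where
  maps_to : ∀ k ∈ K, ∃ F ∈ M, F =ᵐ[haarAddCircle] Φ k ∧ ‖F‖ ^ 2 = ∑ i, ‖coord i k‖ ^ 2
  onto : ∀ F ∈ M, ∃ k ∈ K, F =ᵐ[haarAddCircle] Φ k

end MTTO

end

noncomputable section

namespace MTTO

open Filter Topology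

local notation "μT" => (haarAddCircle : Measure Circ)

section

/-! Write M for the kernel of A, N for the kernel of the Toeplitz operator, P_+ for the Riesz
projection.

M is the set of first components of N. A x = 0 says that G x annihilates K_Θ, which happens exactly
when G x + Θ y is coanalytic for some analytic y, namely y = -P_+(Θ^* G x); this is
`mem_kerIn_iff_exists`. Since G x lies only in L^q with 1 < q ≤ 2, the existence of y rests on
Marcel Riesz's theorem, proved here through `exists_eLpNorm_analyticProj_le`. Since A is prescribed
only on bounded functions, A x is tested against the projections of z^k c to K_Θ, which are bounded
and span a dense subspace (`inner_trial_apply`, `integral_inner_trialFun`).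

Near invariance. If F is in N and F(0) = 0, then F / z is in N (`shift_mem_kerT`). Given f in M with
f(0) = 0, lift it to (f, y) in N, subtract the combination w of the W_i with the same value at 0 and
divide by z: the first component lands in M, and the correction w_1 / z lies in D. The bound dim D ≤
n holds because a combination of the W_i whose first component vanishes at 0 is determined by the
value of its second component, a vector of ℂ^n.

Representation. Let P be the projection to the elements of M divisible by z, let T f = P_M(z⁻¹ P f),
and let C f collect the coordinates of f - P f in the basis F_0 and those of P_{D'}(z⁻¹ P f) in the
basis e. With the row ψ = (F_0, z e) one has f = ψ C f + z T f and ‖f‖² = ‖C f‖² + ‖T f‖². Iteration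
suggests J f = ∑ z^j C T^j f; then f = ψ · J f, S^* J = J T, and K is the range of J. What remains
is that J is isometric, that is, T^N f → 0. As ψ is only square integrable, this takes two steps.
For f in the range of I - T T^*, the partial sums s_N of J f are bounded in quadratic mean over N,
uniformly over the points of the circle (`sum_norm_sq_orbit_le`); this controls the remainder z^N
T^N f = f - ψ s_N on average (`norm_symbol_eq_of_defect`). An algebraic argument on I - J^* J then
passes from that range to all of M (`norm_map_of_norm_map_defect`). -/

theorem integrable_Lp_two {E : Type*} [NormedAddCommGroup E] (f : Lp E 2 μT) : Integrable f μT :=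
  (Lp.memLp f).integrable (by norm_num)

/-! ### Fourier coefficients of vector-valued functions. -/

section Coefficients

variable {E : Type*} [NormedAddCommGroup E] [NormedSpace ℂ E]

theorem norm_fourier_eq_one (k : ℤ) (t : Circ) : ‖(fourier k t : ℂ)‖ = 1 := by
  rw [fourier_apply, Circle.norm_coe]

/-- An integrable function all of whose Fourier coefficients vanish is zero almost everywhere. -/
theorem ae_eq_zero_of_fourierCoeff [CompleteSpace E] {f : Circ → E} (hf : Integrable f μT)
    (h : ∀ k, fourierCoeff f k = 0) : f =ᵐ[μT] 0 := by
  have hint : ∀ φ : C(Circ, ℂ), Integrable (fun t => φ t • f t) μT := fun φ =>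
    hf.bdd_smul (C := ‖φ‖) (map_continuous φ).aestronglyMeasurable
      (Eventually.of_forall fun t => φ.norm_coe_le_norm t)
  let L : C(Circ, ℂ) →L[ℂ] E := LinearMap.mkContinuous
    { toFun := fun φ => ∫ t, φ t • f t ∂μT
      map_add' := fun φ ψ => by
        rw [← integral_add (hint φ) (hint ψ)]
        simp [add_smul]
      map_smul' := fun c φ => by
        rw [RingHom.id_apply, ← integral_smul]
        simp [mul_smul] } (∫ t, ‖f t‖ ∂μT) (fun φ => by
          refine (norm_integral_le_integral_norm _).trans ?_
          rw [mul_comm, ← integral_const_mul]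
          refine integral_mono (hint φ).norm (hf.norm.const_mul _) fun t => ?_
          simp only [norm_smul]
          gcongr
          exact φ.norm_coe_le_norm t)
  -- Trigonometric polynomials are dense in the continuous functions, so integration against f
  -- vanishes on all of them.
  have hL : L = 0 := by
    refine ContinuousLinearMap.ext_on (s := Set.range (fourier (T := (1 : ℝ)))) ?_ ?_
    · have := span_fourier_closure_eq_top (T := (1 : ℝ))
      rw [Submodule.dense_iff_topologicalClosure_eq_top]
      exact this
    · rintro _ ⟨k, rfl⟩
      have := h (-k)
      simpa [fourierCoeff, L] using this
  have hφ : ∀ φ : C(Circ, ℂ), ∫ t, φ t • f t ∂μT = 0 := fun φ => by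
    have := congrArg (fun A : C(Circ, ℂ) →L[ℂ] E => A φ) hL
    simpa [L] using this
  -- It suffices that f integrates to zero over closed sets, whose indicators are limits of
  -- continuous functions bounded by 1.
  refine ae_eq_zero_of_forall_setIntegral_isClosed_eq_zero hf fun s hs => ?_
  have hδ : ∀ n : ℕ, (0 : ℝ) < 1 / ((n : ℝ) + 1) := fun n => Nat.one_div_pos_of_nat
  have hlim := thickenedIndicator_tendsto_indicator_closure hδ
    tendsto_one_div_add_atTop_nhds_zero_nat s
  rw [tendsto_pi_nhds, hs.closure_eq] at hlim
  have key : Tendsto (fun n : ℕ => ∫ t, ((thickenedIndicator (hδ n) s t : ℝ) : ℂ) • f t ∂μT) atTop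
      (𝓝 (∫ t, s.indicator f t ∂μT)) := by
    refine tendsto_integral_of_dominated_convergence (fun t => ‖f t‖) (fun n => ?_) hf.norm
      (fun n => Eventually.of_forall fun t => ?_) (Eventually.of_forall fun t => ?_)
    · refine AEStronglyMeasurable.smul (Continuous.aestronglyMeasurable ?_) hf.1
      exact Complex.continuous_ofReal.comp
        (NNReal.continuous_coe.comp (thickenedIndicator (hδ n) s).continuous)
    · rw [norm_smul]
      refine mul_le_of_le_one_left (norm_nonneg _) ?_
      simpa using thickenedIndicator_le_one (hδ n) s t
    · have h1 : Tendsto (fun n : ℕ => ((thickenedIndicator (hδ n) s t : ℝ) : ℂ)) atTop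
          (𝓝 (((s.indicator (fun _ => (1 : NNReal)) t : NNReal) : ℝ) : ℂ)) :=
        (Complex.continuous_ofReal.comp NNReal.continuous_coe).continuousAt.tendsto.comp (hlim t)
      have h2 := h1.smul_const (f t)
      convert h2 using 2
      by_cases ht : t ∈ s <;> simp [ht]
  have h0 : ∀ n : ℕ, ∫ t, ((thickenedIndicator (hδ n) s t : ℝ) : ℂ) • f t ∂μT = 0 := fun n =>
    hφ ⟨fun t => ((thickenedIndicator (hδ n) s t : ℝ) : ℂ), Complex.continuous_ofReal.comp
        (NNReal.continuous_coe.comp (thickenedIndicator (hδ n) s).continuous)⟩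
  simp only [h0] at key
  rw [← integral_indicator hs.measurableSet]
  exact (tendsto_nhds_unique key tendsto_const_nhds)

theorem fourierCoeff_sub' {f g : Circ → E} (hf : Integrable f μT) (hg : Integrable g μT) (k : ℤ) :
    fourierCoeff (f - g) k = fourierCoeff f k - fourierCoeff g k := by
  unfold fourierCoeff
  rw [← integral_sub (integrable_fourier_smul hf _) (integrable_fourier_smul hg _)]
  simp [smul_sub]

theorem ae_eq_of_fourierCoeff_eq [CompleteSpace E] {f g : Circ → E} (hf : Integrable f μT)
    (hg : Integrable g μT) (h : ∀ k, fourierCoeff f k = fourierCoeff g k) : f =ᵐ[μT] g := by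
  have := ae_eq_zero_of_fourierCoeff (hf.sub hg) fun k => by
    rw [fourierCoeff_sub' hf hg, h, sub_self]
  filter_upwards [this] with t ht
  exact sub_eq_zero.1 ht

theorem fourierCoeff_fourier_smul (f : Circ → E) (j k : ℤ) :
    fourierCoeff (fun t => fourier j t • f t) k = fourierCoeff f (k - j) := by
  unfold fourierCoeff
  congr 1
  ext t
  rw [smul_smul, ← fourier_add]
  congr 3
  ring

theorem fourierCoeff_const_smul_fourier (c : E) [CompleteSpace E] (j k : ℤ) :
    fourierCoeff (fun t : Circ => (fourier j t : ℂ) • c) k = if k = j then c else 0 := by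
  have := fourierCoeff_fourier (T := (1 : ℝ)) j
  have h2 := congrFun this k
  unfold fourierCoeff at *
  simp_rw [smul_smul]
  rw [integral_smul_const]
  simp only [smul_eq_mul] at h2
  rw [h2]
  by_cases h : k = j <;> simp [h]

theorem tendsto_fourierCoeff {q : ℝ≥0∞} (hq : 1 ≤ q) {F : ℕ → Circ → E} {f : Circ → E}
    (hF : ∀ n, MemLp (F n) q μT) (hf : MemLp f q μT)
    (h : Tendsto (fun n => eLpNorm (F n - f) q μT) atTop (𝓝 0)) (k : ℤ) :
    Tendsto (fun n => fourierCoeff (F n) k) atTop (𝓝 (fourierCoeff f k)) := by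
  refine tendsto_integral_of_L1' _ (integrable_fourier_smul (hf.integrable hq) _).1
    (Eventually.of_forall fun n => integrable_fourier_smul ((hF n).integrable hq) _) ?_
  refine tendsto_of_tendsto_of_tendsto_of_le_of_le tendsto_const_nhds h (fun _ => bot_le)
    fun n => ?_
  refine le_trans (le_of_eq ?_)
    (eLpNorm_le_eLpNorm_of_exponent_le hq ((hF n).sub hf).aestronglyMeasurable)
  refine eLpNorm_congr_norm_ae (Eventually.of_forall fun t => ?_)
  simp only [Pi.sub_apply]
  rw [← smul_sub, norm_smul, norm_fourier_eq_one, one_mul]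

end Coefficients

/-! ### Analytic and coanalytic parts of L². -/

section Hilbert

variable {E : Type*} [NormedAddCommGroup E] [InnerProductSpace ℂ E]

/-- The function `t ↦ z ^ k c`. -/
def mono (k : ℤ) (c : E) : Lp E 2 μT :=
  MemLp.toLp (fun t => (fourier k t : ℂ) • c)
    ((memLp_const c).of_le ((map_continuous (fourier k)).aestronglyMeasurable.smul
      aestronglyMeasurable_const) (Eventually.of_forall fun t => by
        rw [norm_smul, norm_fourier_eq_one, one_mul]))

theorem coeFn_mono (k : ℤ) (c : E) : mono k c =ᵐ[μT] fun t => (fourier k t : ℂ) • c :=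
  MemLp.coeFn_toLp _

theorem inner_mono [CompleteSpace E] (k : ℤ) (c : E) (f : Lp E 2 μT) :
    inner ℂ (mono k c) f = inner ℂ c (fourierCoeff f k) := by
  rw [L2.inner_def, fourierCoeff, ← integral_inner (integrable_fourier_smul (integrable_Lp_two f) _)]
  apply integral_congr_ae
  filter_upwards [coeFn_mono k c] with t ht
  rw [ht, inner_smul_left, inner_smul_right, fourier_neg]

/-- The analytic elements of `L²`. -/
def analyticL2 (E : Type*) [NormedAddCommGroup E] [InnerProductSpace ℂ E] :
    Submodule ℂ (Lp E 2 μT) where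
  carrier := {f | IsAnalytic f}
  add_mem' {f g} hf hg k hk := by
    rw [fourierCoeff_congr (Lp.coeFn_add f g),
      fourierCoeff_add' (integrable_Lp_two f) (integrable_Lp_two g), hf k hk, hg k hk, add_zero]
  zero_mem' k _ := by
    rw [fourierCoeff_congr (Lp.coeFn_zero E 2 μT)]
    simp [fourierCoeff]
  smul_mem' c f hf k hk := by
    rw [fourierCoeff_congr (Lp.coeFn_smul c f), fourierCoeff.const_smul, hf k hk, smul_zero]

theorem fourierCoeff_Lp_sub (f g : Lp E 2 μT) (k : ℤ) :
    fourierCoeff (f - g : Lp E 2 μT) k = fourierCoeff f k - fourierCoeff g k := by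
  rw [fourierCoeff_congr (Lp.coeFn_sub f g),
    fourierCoeff_sub' (integrable_Lp_two f) (integrable_Lp_two g)]

variable [CompleteSpace E]

theorem fourierCoeff_mono (k : ℤ) (c : E) (j : ℤ) :
    fourierCoeff (mono k c : Lp E 2 μT) j = if j = k then c else 0 := by
  rw [fourierCoeff_congr (coeFn_mono k c), fourierCoeff_const_smul_fourier]

/-- Vanishing of a set of coefficients becomes an orthogonality condition; closedness of the
analytic subspace then comes for free. -/
theorem mem_orthogonal_span_mono {S : Set ℤ} {f : Lp E 2 μT} :
    f ∈ (Submodule.span ℂ {g | ∃ k ∈ S, ∃ c : E, g = mono k c})ᗮ ↔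
      ∀ k ∈ S, fourierCoeff f k = 0 := by
  rw [Submodule.mem_orthogonal]
  constructor
  · intro h k hk
    have := h _ (Submodule.subset_span ⟨k, hk, fourierCoeff f k, rfl⟩)
    rwa [inner_mono, inner_self_eq_zero] at this
  · intro h u hu
    induction hu using Submodule.span_induction with
    | mem x hx =>
      obtain ⟨k, hk, c, rfl⟩ := hx
      rw [inner_mono, h k hk, inner_zero_right]
    | zero => simp
    | add x y _ _ hx hy => rw [inner_add_left, hx, hy, add_zero]
    | smul a x _ hx => rw [inner_smul_left, hx, mul_zero]

theorem analyticL2_eq_orthogonal :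
    analyticL2 E = (Submodule.span ℂ {g | ∃ k ∈ Set.Iio (0 : ℤ), ∃ c : E, g = mono k c})ᗮ := by
  ext f
  rw [mem_orthogonal_span_mono]
  rfl

theorem isClosed_analyticL2 : IsClosed (analyticL2 E : Set (Lp E 2 μT)) := by
  rw [analyticL2_eq_orthogonal]
  exact Submodule.isClosed_orthogonal _

instance : CompleteSpace (analyticL2 E) := isClosed_analyticL2.completeSpace_coe

theorem Lp_eq_zero_of_fourierCoeff {f : Lp E 2 μT} (h : ∀ k, fourierCoeff f k = 0) : f = 0 :=
  (Lp.eq_zero_iff_ae_eq_zero).2 (ae_eq_zero_of_fourierCoeff (integrable_Lp_two f) h)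

/-- An analytic f lies in the closed span of the monomials of nonnegative degree, since the error of
its projection to that span has no nonzero coefficient; g is orthogonal to these monomials. -/
theorem inner_eq_zero_of_analytic {f g : Lp E 2 μT} (hf : IsAnalytic f) (hg : IsCoanalyticZero g) :
    inner ℂ f g = 0 := by
  set P := Submodule.span ℂ {g : Lp E 2 μT | ∃ k ∈ Set.Ici (0 : ℤ), ∃ c : E, g = mono k c}
  have hgP : g ∈ Pᗮ := mem_orthogonal_span_mono.2 hg
  have hPA : P ≤ analyticL2 E := by
    refine Submodule.span_le.2 ?_
    rintro _ ⟨k, hk, c, rfl⟩ j hj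
    rw [fourierCoeff_mono, if_neg]
    rintro rfl
    exact absurd hk (not_le.2 hj)
  have hcl : P.topologicalClosure ≤ analyticL2 E :=
    P.topologicalClosure_minimal hPA isClosed_analyticL2
  have : CompleteSpace P.topologicalClosure := P.isClosed_topologicalClosure.completeSpace_coe
  have h1 := P.topologicalClosure.starProjection_apply_mem f
  have h2 := P.topologicalClosure.sub_starProjection_mem_orthogonal f
  have h3 : f - P.topologicalClosure.starProjection f = 0 := by
    refine Lp_eq_zero_of_fourierCoeff fun k => ?_
    rcases lt_or_ge k 0 with hk | hk
    · exact (analyticL2 E).sub_mem hf (hcl h1) k hk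
    · rw [Submodule.orthogonal_closure] at h2
      exact mem_orthogonal_span_mono.1 h2 k hk
  rw [sub_eq_zero] at h3
  rw [← Submodule.orthogonal_closure] at hgP
  exact Submodule.inner_right_of_mem_orthogonal (h3 ▸ h1) hgP

/-- The orthogonal projection of `L²` to its analytic part. -/
def analyticProj : Lp E 2 μT →L[ℂ] Lp E 2 μT := (analyticL2 E).starProjection

theorem analyticProj_analytic (f : Lp E 2 μT) : IsAnalytic (analyticProj f) :=
  (analyticL2 E).starProjection_apply_mem f

theorem fourierCoeff_analyticProj (f : Lp E 2 μT) {k : ℤ} (hk : 0 ≤ k) :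
    fourierCoeff (analyticProj f) k = fourierCoeff f k := by
  have h2 := (analyticL2 E).sub_starProjection_mem_orthogonal f
  have h3 : fourierCoeff (f - analyticProj f : Lp E 2 μT) k = 0 := by
    have : ∀ c : E, inner ℂ c (fourierCoeff (f - analyticProj f : Lp E 2 μT) k) = 0 := fun c => by
      rw [← inner_mono]
      refine Submodule.inner_right_of_mem_orthogonal (K := analyticL2 E) (fun j hj => ?_) h2
      rw [fourierCoeff_mono, if_neg (by omega)]
    exact inner_self_eq_zero.1 (this _)
  rw [fourierCoeff_Lp_sub, sub_eq_zero] at h3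
  exact h3.symm

theorem analyticProj_eq_of {f g : Lp E 2 μT} (hg : IsAnalytic g)
    (h : ∀ k : ℤ, 0 ≤ k → fourierCoeff g k = fourierCoeff f k) : analyticProj f = g := by
  rw [← sub_eq_zero]
  refine Lp_eq_zero_of_fourierCoeff fun k => ?_
  rw [fourierCoeff_Lp_sub]
  rcases lt_or_ge k 0 with hk | hk
  · rw [analyticProj_analytic f k hk, hg k hk, sub_zero]
  · rw [fourierCoeff_analyticProj f hk, h k hk, sub_self]

end Hilbert

end

/-! ### The Riesz inequality for polynomials with positive real part. -/

section RieszInequality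

/-- Let θ = arg w, so |θ| < π/2. When |θ| is close to π/2, cos(rθ) is at most some -κ < 0 because r
> 1 and rπ/2 ≤ π, and B = 1/κ makes the last term pay for ‖w‖^r. Elsewhere cos θ is bounded below,
and A is large enough to pay for ‖w‖^r and to absorb B. -/
theorem exists_norm_rpow_le_re_rpow {r : ℝ} (h1 : 1 < r) (h2 : r ≤ 2) :
    ∃ A B : ℝ, 0 ≤ A ∧ 0 ≤ B ∧ ∀ w : ℂ, 0 < w.re →
      ‖w‖ ^ r ≤ A * w.re ^ r - B * (w ^ (r : ℂ)).re := by
  have hπ := Real.pi_pos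
  have hr0 : 0 < r := by linarith
  -- Chosen so that r θ₀ is the midpoint of π/2 and r π/2: then θ₀ < π/2, while cos(r θ₀) is already
  -- negative.
  set θ₀ := Real.pi / 2 * ((1 + r) / 2) / r with hθ₀
  have hrθ : r * θ₀ = Real.pi / 2 * ((1 + r) / 2) := by rw [hθ₀]; field_simp
  have hθpos : 0 < θ₀ := by positivity
  have hθlt : θ₀ < Real.pi / 2 := by
    rw [hθ₀, div_lt_iff₀ hr0]
    nlinarith
  have hc : 0 < Real.cos θ₀ := Real.cos_pos_of_mem_Ioo ⟨by linarith, hθlt⟩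
  have hκ : 0 < -Real.cos (r * θ₀) := by
    rw [hrθ, neg_pos]
    exact Real.cos_neg_of_pi_div_two_lt_of_lt (by nlinarith) (by nlinarith)
  set κ := -Real.cos (r * θ₀) with hκdef
  have hAc : 0 < Real.cos θ₀ ^ r := Real.rpow_pos_of_pos hc r
  refine ⟨(1 + κ⁻¹) / Real.cos θ₀ ^ r, κ⁻¹, by positivity, by positivity, fun w hw => ?_⟩
  set θ := w.arg with hθ
  have habs : |θ| < Real.pi / 2 := Complex.abs_arg_lt_pi_div_two_iff.2 (Or.inl hw)
  have hcos : 0 < Real.cos θ := Real.cos_pos_of_mem_Ioo (abs_lt.1 habs)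
  have hre : w.re = ‖w‖ * Real.cos θ := (Complex.norm_mul_cos_arg w).symm
  rw [Complex.cpow_ofReal_re, hre, Real.mul_rpow (norm_nonneg _) hcos.le]
  have key : 1 ≤ (1 + κ⁻¹) / Real.cos θ₀ ^ r * Real.cos θ ^ r - κ⁻¹ * Real.cos (θ * r) := by
    rcases le_or_gt θ₀ |θ| with h | h
    · have h3 : Real.cos (θ * r) ≤ -κ := by
        rw [hκdef, neg_neg, ← Real.cos_abs (θ * r), abs_mul, abs_of_pos hr0, mul_comm]
        refine Real.cos_le_cos_of_nonneg_of_le_pi (by positivity) ?_ (by gcongr)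
        nlinarith
      have h4 : κ⁻¹ * Real.cos (θ * r) ≤ -1 := by
        calc κ⁻¹ * Real.cos (θ * r) ≤ κ⁻¹ * -κ := by gcongr
          _ = -1 := by field_simp
      have h5 : 0 ≤ (1 + κ⁻¹) / Real.cos θ₀ ^ r * Real.cos θ ^ r := by positivity
      linarith
    · have h3 : Real.cos θ₀ ≤ Real.cos θ := by
        rw [← Real.cos_abs θ]
        exact Real.cos_le_cos_of_nonneg_of_le_pi (abs_nonneg _) (by linarith) h.le
      have h4 : 1 + κ⁻¹ ≤ (1 + κ⁻¹) / Real.cos θ₀ ^ r * Real.cos θ ^ r := by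
        rw [div_mul_eq_mul_div, le_div_iff₀ hAc]
        gcongr
      have h5 : κ⁻¹ * Real.cos (θ * r) ≤ κ⁻¹ * 1 := by
        gcongr
        exact Real.cos_le_one _
      linarith
  calc ‖w‖ ^ r = ‖w‖ ^ r * 1 := (mul_one _).symm
    _ ≤ ‖w‖ ^ r * _ := mul_le_mul_of_nonneg_left key (by positivity)
    _ = _ := by ring

/-- The substitution θ = 2πx gives access to the mean value property of analytic functions. -/
theorem integral_comp_fourier_one {F : Type*} [NormedAddCommGroup F] [NormedSpace ℝ F]
    (g : ℂ → F) : ∫ t : Circ, g (fourier 1 t) ∂μT = Real.circleAverage g 0 1 := by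
  rw [integral_haarAddCircle, inv_one, one_smul,
    ← AddCircle.intervalIntegral_preimage (1 : ℝ) 0 (fun t : Circ => g (fourier 1 t)),
    Real.circleAverage_def]
  have hg : ∀ x : ℝ, g (fourier 1 ((x : ℝ) : Circ)) = (fun θ => g (circleMap 0 1 θ))
      (2 * Real.pi * x) := fun x => by
    rw [fourier_coe_apply]
    simp only [circleMap]
    congr 1
    push_cast
    rw [zero_add, one_mul]
    congr 1
    ring
  simp_rw [hg]
  rw [intervalIntegral.integral_comp_mul_left (fun θ => g (circleMap 0 1 θ))
    (by positivity : (2 * Real.pi) ≠ 0)]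
  simp

/-- The maximum principle for exp(-P), with the minimum of Re P on the compact circle as bound. -/
theorem re_eval_pos_of_circle {P : Polynomial ℂ}
    (hP : ∀ t : Circ, 0 < (P.eval (fourier 1 t : ℂ)).re) {z : ℂ} (hz : ‖z‖ ≤ 1) :
    0 < (P.eval z).re := by
  have hcirc : ∀ z : ℂ, ‖z‖ = 1 → ∃ t : Circ, (fourier 1 t : ℂ) = z := fun z hz => by
    obtain ⟨t, ht⟩ := (AddCircle.homeomorphCircle (T := (1 : ℝ)) one_ne_zero).surjective
      (⟨z, mem_sphere_zero_iff_norm.2 hz⟩ : Circle)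
    refine ⟨t, ?_⟩
    rw [fourier_one, ← AddCircle.homeomorphCircle_apply one_ne_zero, ht]
  have hcont : Continuous fun t : Circ => (P.eval (fourier 1 t : ℂ)).re :=
    Complex.continuous_re.comp (P.continuous.comp (map_continuous (fourier 1)))
  obtain ⟨t₀, -, ht₀⟩ := isCompact_univ.exists_isMinOn Set.univ_nonempty hcont.continuousOn
  set m := (P.eval (fourier 1 t₀ : ℂ)).re with hm
  have key := Complex.norm_le_of_forall_mem_frontier_norm_le (f := fun z => Complex.exp (-P.eval z))
    (U := Metric.ball 0 1) (C := Real.exp (-m)) Metric.isBounded_ball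
    (Differentiable.diffContOnCl (P.differentiable.neg.cexp)) ?_ (z := z) ?_
  · rw [Complex.norm_exp, Real.exp_le_exp, Complex.neg_re, neg_le_neg_iff] at key
    exact (hP t₀).trans_le key
  · intro w hw
    rw [frontier_ball _ one_ne_zero, mem_sphere_zero_iff_norm] at hw
    obtain ⟨t, rfl⟩ := hcirc w hw
    rw [Complex.norm_exp, Real.exp_le_exp, Complex.neg_re, neg_le_neg_iff]
    exact isMinOn_iff.1 ht₀ t (Set.mem_univ _)
  · rw [closure_ball _ one_ne_zero]
    simpa using hz

/-- The Riesz inequality for polynomials with positive real part on the circle. -/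
theorem integral_norm_eval_rpow_le {r A B : ℝ} (hr : 0 < r) (hB : 0 ≤ B)
    (hAB : ∀ w : ℂ, 0 < w.re → ‖w‖ ^ r ≤ A * w.re ^ r - B * (w ^ (r : ℂ)).re)
    {P : Polynomial ℂ} (h0 : (P.eval 0).im = 0)
    (hP : ∀ t : Circ, 0 < (P.eval (fourier 1 t : ℂ)).re) :
    ∫ t : Circ, ‖P.eval (fourier 1 t : ℂ)‖ ^ r ∂μT ≤
      A * ∫ t : Circ, (P.eval (fourier 1 t : ℂ)).re ^ r ∂μT := by
  have hcP : Continuous fun t : Circ => P.eval (fourier 1 t : ℂ) :=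
    P.continuous.comp (map_continuous (fourier 1))
  have hc1 : Continuous fun t : Circ => ‖P.eval (fourier 1 t : ℂ)‖ ^ r :=
    hcP.norm.rpow_const fun _ => Or.inr hr.le
  have hc2 : Continuous fun t : Circ => (P.eval (fourier 1 t : ℂ)).re ^ r :=
    (Complex.continuous_re.comp hcP).rpow_const fun _ => Or.inr hr.le
  have hc3 : Continuous fun t : Circ => (P.eval (fourier 1 t : ℂ)) ^ (r : ℂ) :=
    hcP.cpow continuous_const fun t => Or.inl (hP t)
  have hint : ∀ {F : Type} [NormedAddCommGroup F] {f : Circ → F}, Continuous f →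
      Integrable f μT := fun hf => hf.integrable_of_hasCompactSupport
        (HasCompactSupport.of_compactSpace _)
  have hc4 : Integrable (fun t : Circ => ((P.eval (fourier 1 t : ℂ)) ^ (r : ℂ)).re) μT :=
    hint (Complex.continuous_re.comp hc3)
  -- Re P > 0 on the closed disc, so the principal power P^r is analytic there and has the mean
  -- value property.
  have hmean : ∫ t : Circ, (P.eval (fourier 1 t : ℂ)) ^ (r : ℂ) ∂μT = (P.eval 0) ^ (r : ℂ) := by
    rw [integral_comp_fourier_one (fun z => (P.eval z) ^ (r : ℂ))]
    refine DiffContOnCl.circleAverage (f := fun z => (P.eval z) ^ (r : ℂ)) ?_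
    rw [abs_one]
    refine DifferentiableOn.diffContOnCl ?_
    rw [closure_ball _ one_ne_zero]
    intro z hz
    refine DifferentiableAt.differentiableWithinAt ?_
    refine DifferentiableAt.cpow P.differentiableAt (differentiableAt_const _) (Or.inl ?_)
    exact re_eval_pos_of_circle hP (by simpa using hz)
  -- P(0) is real and positive, so the term subtracted with the factor B can be dropped.
  have hpos : 0 ≤ ((P.eval 0) ^ (r : ℂ)).re := by
    have h1 : 0 < (P.eval 0).re := re_eval_pos_of_circle hP (by simp)
    rw [Complex.cpow_ofReal_re, Complex.arg_eq_zero_iff.2 ⟨h1.le, h0⟩]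
    simp only [zero_mul, Real.cos_zero, mul_one]
    positivity
  have hre : ∫ t : Circ, ((P.eval (fourier 1 t : ℂ)) ^ (r : ℂ)).re ∂μT =
      ((P.eval 0) ^ (r : ℂ)).re := by
    rw [← hmean]
    exact integral_re (hint hc3)
  calc ∫ t : Circ, ‖P.eval (fourier 1 t : ℂ)‖ ^ r ∂μT
      ≤ ∫ t : Circ, (A * (P.eval (fourier 1 t : ℂ)).re ^ r -
        B * ((P.eval (fourier 1 t : ℂ)) ^ (r : ℂ)).re) ∂μT :=
        integral_mono (hint hc1) (((hint hc2).const_mul A).sub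
          (hc4.const_mul B)) fun t => hAB _ (hP t)
    _ = A * ∫ t : Circ, (P.eval (fourier 1 t : ℂ)).re ^ r ∂μT - B * ((P.eval 0) ^ (r : ℂ)).re := by
        rw [integral_sub ((hint hc2).const_mul A)
          (hc4.const_mul B), integral_const_mul,
          integral_const_mul, hre]
    _ ≤ _ := by
        have := mul_nonneg hB hpos
        linarith

end RieszInequality

/-! ### Boundedness of the Riesz projection in the L^q norm, 1 < q ≤ 2. -/

section

theorem memLp_of_continuous {F : Type*} [NormedAddCommGroup F] {f : Circ → F}
    (hf : Continuous f) (p : ℝ≥0∞) : MemLp f p μT :=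
  hf.memLp_of_hasCompactSupport (HasCompactSupport.of_compactSpace _)

section LowerNorm

variable {E : Type*} [NormedAddCommGroup E] {q : ℝ≥0∞}

theorem eLpNorm_Lp_add_le (hq : 1 ≤ q) (u v : Lp E 2 μT) :
    eLpNorm (u + v : Lp E 2 μT) q μT ≤ eLpNorm u q μT + eLpNorm v q μT := by
  rw [eLpNorm_congr_ae (Lp.coeFn_add u v)]
  exact eLpNorm_add_le (Lp.aestronglyMeasurable _) (Lp.aestronglyMeasurable _) hq

theorem eLpNorm_Lp_sub_le (hq : 1 ≤ q) (u v : Lp E 2 μT) :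
    eLpNorm (u - v : Lp E 2 μT) q μT ≤ eLpNorm u q μT + eLpNorm v q μT := by
  rw [eLpNorm_congr_ae (Lp.coeFn_sub u v)]
  exact eLpNorm_sub_le (Lp.aestronglyMeasurable _) (Lp.aestronglyMeasurable _) hq

theorem eLpNorm_Lp_le_enorm (hq : q ≤ 2) (u : Lp E 2 μT) : eLpNorm u q μT ≤ ‖u‖ₑ := by
  rw [Lp.enorm_def]
  exact eLpNorm_le_eLpNorm_of_exponent_le hq (Lp.aestronglyMeasurable _)

theorem eLpNorm_Lp_smul [NormedSpace ℂ E] (c : ℂ) (u : Lp E 2 μT) :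
    eLpNorm (c • u : Lp E 2 μT) q μT = ‖c‖ₑ * eLpNorm u q μT := by
  rw [eLpNorm_congr_ae (Lp.coeFn_smul c u), eLpNorm_const_smul]

end LowerNorm

section Polynomials

theorem fourier_natCast (k : ℕ) (t : Circ) : (fourier (k : ℤ) t : ℂ) = fourier 1 t ^ k := by
  induction k with
  | zero => simp
  | succ k ih => rw [Nat.cast_succ, fourier_add, ih, pow_succ]

theorem continuous_eval_fourier (P : Polynomial ℂ) :
    Continuous fun t : Circ => P.eval (fourier 1 t : ℂ) :=
  P.continuous.comp (map_continuous (fourier 1))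

theorem fourierCoeff_eval (P : Polynomial ℂ) (k : ℤ) :
    fourierCoeff (fun t : Circ => P.eval (fourier 1 t : ℂ)) k =
      if 0 ≤ k then P.coeff k.toNat else 0 := by
  have h1 : (fun t : Circ => P.eval (fourier 1 t : ℂ)) =
      ∑ i ∈ Finset.range (P.natDegree + 1), fun t : Circ => (fourier (i : ℤ) t : ℂ) • P.coeff i := by
    ext t
    rw [Polynomial.eval_eq_sum_range, Finset.sum_apply]
    refine Finset.sum_congr rfl fun i _ => ?_
    rw [fourier_natCast, smul_eq_mul, mul_comm]
  rw [h1, fourierCoeff.sum _ _ fun i _ => memLp_one_iff_integrable.1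
    (memLp_of_continuous (by fun_prop) 1), Finset.sum_apply]
  simp_rw [fourierCoeff_const_smul_fourier]
  split_ifs with hk
  · lift k to ℕ using hk
    simp only [Nat.cast_inj, Int.toNat_natCast, Finset.sum_ite_eq, Finset.mem_range]
    split_ifs with h
    · rfl
    · exact (Polynomial.coeff_eq_zero_of_natDegree_lt (by omega)).symm
  · refine Finset.sum_eq_zero fun i _ => if_neg ?_
    omega

theorem fourierCoeff_conj (f : Circ → ℂ) (k : ℤ) :
    fourierCoeff (fun t => (starRingEnd ℂ) (f t)) k = (starRingEnd ℂ) (fourierCoeff f (-k)) := by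
  unfold fourierCoeff
  rw [← integral_conj]
  congr 1
  ext t
  rw [smul_eq_mul, smul_eq_mul, map_mul, fourier_neg (n := k), neg_neg]

/-- The real part of a polynomial on the circle, as an element of `L²`. -/
def rePoly (P : Polynomial ℂ) : Lp ℂ 2 μT :=
  MemLp.toLp (fun t : Circ => (((P.eval (fourier 1 t : ℂ)).re : ℝ) : ℂ))
    (memLp_of_continuous (Complex.continuous_ofReal.comp
      (Complex.continuous_re.comp (continuous_eval_fourier P))) 2)

theorem coeFn_rePoly (P : Polynomial ℂ) :
    rePoly P =ᵐ[μT] fun t : Circ => (((P.eval (fourier 1 t : ℂ)).re : ℝ) : ℂ) :=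
  MemLp.coeFn_toLp _

theorem fourierCoeff_rePoly (P : Polynomial ℂ) (k : ℤ) :
    fourierCoeff (rePoly P) k = ((if 0 ≤ k then P.coeff k.toNat else 0) +
      (starRingEnd ℂ) (if 0 ≤ -k then P.coeff (-k).toNat else 0)) / 2 := by
  have hint := memLp_one_iff_integrable.1 (memLp_of_continuous (continuous_eval_fourier P) 1)
  have hint' : Integrable (fun t : Circ => (starRingEnd ℂ) (P.eval (fourier 1 t : ℂ))) μT :=
    memLp_one_iff_integrable.1 (memLp_of_continuous
      (Complex.continuous_conj.comp (continuous_eval_fourier P)) 1)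
  rw [fourierCoeff_congr (coeFn_rePoly P), ← fourierCoeff_eval, ← fourierCoeff_eval,
    ← fourierCoeff_conj, ← fourierCoeff_add' hint hint', div_eq_inv_mul,
    ← fourierCoeff.const_mul]
  congr 1
  ext t
  rw [Complex.re_eq_add_conj, div_eq_inv_mul]
  rfl

/-- In Re P = (P + conj P) / 2 the conjugate contributes only its constant term to the analytic
part, and that term is the real number P(0). -/
theorem analyticProj_rePoly {P : Polynomial ℂ} (h0 : (P.eval 0).im = 0) :
    analyticProj (rePoly P) = MemLp.toLp
      (fun t : Circ => (2⁻¹ : ℂ) * ((P + Polynomial.C (P.eval 0)).eval (fourier 1 t : ℂ)))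
      (memLp_of_continuous (continuous_const.mul (continuous_eval_fourier _)) 2) := by
  refine analyticProj_eq_of (fun k hk => ?_) fun k hk => ?_
  · rw [fourierCoeff_congr (MemLp.coeFn_toLp _), fourierCoeff.const_mul, fourierCoeff_eval,
      if_neg (not_le.2 hk), mul_zero]
  · rw [fourierCoeff_congr (MemLp.coeFn_toLp _), fourierCoeff.const_mul, fourierCoeff_eval,
      if_pos hk, fourierCoeff_rePoly, if_pos hk, Polynomial.coeff_add, Polynomial.coeff_C]
    rw [← Polynomial.coeff_zero_eq_eval_zero] at h0 ⊢
    rcases hk.eq_or_lt with rfl | hk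
    · simp only [neg_zero, le_refl, Int.toNat_zero, if_true, Complex.conj_eq_iff_im.2 h0]
      ring
    · rw [if_neg (by omega), if_neg (by omega), map_zero]
      ring

theorem exists_rePoly_of_mem_span {p : C(Circ, ℂ)}
    (hp : p ∈ Submodule.span ℂ (Set.range (fourier (T := (1 : ℝ))))) :
    ∃ P : Polynomial ℂ, (P.eval 0).im = 0 ∧
      ∀ t : Circ, (P.eval (fourier 1 t : ℂ)).re = (p t).re := by
  -- Taking the real part is not complex linear; quantifying over all multiples c makes the
  -- induction pass through complex scalars. Negative powers are handled by Re(c z^{-m}) =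
  -- Re(conj(c) z^m).
  have key : ∀ c : ℂ, ∃ P : Polynomial ℂ,
      ∀ t : Circ, (P.eval (fourier 1 t : ℂ)).re = (c * p t).re := by
    induction hp using Submodule.span_induction with
    | mem x hx =>
      obtain ⟨k, rfl⟩ := hx
      intro c
      rcases le_total 0 k with hk | hk
      · lift k to ℕ using hk
        refine ⟨Polynomial.C c * Polynomial.X ^ k, fun t => ?_⟩
        rw [fourier_natCast]
        simp
      · obtain ⟨m, rfl⟩ : ∃ m : ℕ, k = -(m : ℤ) := ⟨(-k).toNat, by omega⟩
        refine ⟨Polynomial.C ((starRingEnd ℂ) c) * Polynomial.X ^ m, fun t => ?_⟩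
        rw [fourier_neg, fourier_natCast, ← Complex.conj_re]
        simp
    | zero => exact fun c => ⟨0, fun t => by simp⟩
    | add x y _ _ hx hy =>
      intro c
      obtain ⟨P, hP⟩ := hx c
      obtain ⟨Q, hQ⟩ := hy c
      refine ⟨P + Q, fun t => ?_⟩
      rw [Polynomial.eval_add, Complex.add_re, hP, hQ, ContinuousMap.add_apply, mul_add,
        Complex.add_re]
    | smul a x _ hx =>
      intro c
      obtain ⟨P, hP⟩ := hx (c * a)
      refine ⟨P, fun t => ?_⟩
      rw [hP, ContinuousMap.smul_apply, smul_eq_mul, mul_assoc]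
  obtain ⟨P, hP⟩ := key 1
  -- Subtracting the imaginary part of P(0) leaves Re P unchanged.
  refine ⟨P - Polynomial.C (((P.eval 0).im : ℂ) * Complex.I), by simp, fun t => ?_⟩
  rw [← one_mul (p t), ← hP t, Polynomial.eval_sub, Polynomial.eval_C, Complex.sub_re,
    Complex.re_ofReal_mul, Complex.I_re, mul_zero, sub_zero]

end Polynomials

section RieszProjection

variable {q : ℝ≥0∞}

/-- The projection of Re P is (P + P(0)) / 2. The Riesz inequality bounds P by Re P, and P(0) is the
mean of Re P; hence the constant A^(1/r) + 1. -/
theorem exists_eLpNorm_analyticProj_rePoly_le (h1 : 1 < q) (h2 : q ≤ 2) :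
    ∃ C : ℝ≥0∞, C ≠ ∞ ∧ ∀ P : Polynomial ℂ, (P.eval 0).im = 0 →
      (∀ t : Circ, 0 < (P.eval (fourier 1 t : ℂ)).re) →
      eLpNorm (analyticProj (rePoly P)) q μT ≤ C * eLpNorm (rePoly P) q μT := by
  have hqt : q ≠ ∞ := ne_top_of_le_ne_top (by norm_num) h2
  have hq0 : q ≠ 0 := (zero_lt_one.trans h1).ne'
  set r := q.toReal with hr
  have hr1 : 1 < r := by
    have := (ENNReal.toReal_lt_toReal ENNReal.one_ne_top hqt).2 h1
    simpa using this
  have hr2 : r ≤ 2 := by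
    have := (ENNReal.toReal_le_toReal hqt (by norm_num)).2 h2
    simpa using this
  obtain ⟨A, B, hA, hB, hAB⟩ := exists_norm_rpow_le_re_rpow hr1 hr2
  refine ⟨ENNReal.ofReal (A ^ r⁻¹) + 1, by finiteness, fun P h0 hP => ?_⟩
  have hR := integral_norm_eval_rpow_le (by linarith) hB hAB h0 hP
  set f : Circ → ℂ := fun t => P.eval (fourier 1 t : ℂ) with hf
  set g : Circ → ℂ := fun t => (((P.eval (fourier 1 t : ℂ)).re : ℝ) : ℂ) with hg
  have hfm : MemLp f q μT := memLp_of_continuous (continuous_eval_fourier P) q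
  have hgm : MemLp g q μT := memLp_of_continuous (Complex.continuous_ofReal.comp
      (Complex.continuous_re.comp (continuous_eval_fourier P))) q
  have hfg : eLpNorm f q μT ≤ ENNReal.ofReal (A ^ r⁻¹) * eLpNorm g q μT := by
    rw [hfm.eLpNorm_eq_integral_rpow_norm hq0 hqt, hgm.eLpNorm_eq_integral_rpow_norm hq0 hqt,
      ← ENNReal.ofReal_mul (by positivity), ← Real.mul_rpow hA (by positivity)]
    refine ENNReal.ofReal_le_ofReal (Real.rpow_le_rpow (by positivity) (hR.trans (le_of_eq ?_))
      (by positivity))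
    congr 1
    refine integral_congr_ae (Eventually.of_forall fun t => ?_)
    simp only [hg, Complex.norm_real, Real.norm_eq_abs, abs_of_pos (hP t), hr]
  have hc : ‖P.eval 0‖ₑ ≤ eLpNorm g q μT := by
    have h3 : fourierCoeff (rePoly P) 0 = P.eval 0 := by
      rw [fourierCoeff_rePoly]
      rw [← Polynomial.coeff_zero_eq_eval_zero] at h0 ⊢
      simp [Complex.conj_eq_iff_im.2 h0]
    rw [← h3, fourierCoeff_congr (coeFn_rePoly P), fourierCoeff]
    refine (enorm_integral_le_lintegral_enorm _).trans ?_
    refine le_trans ?_ (eLpNorm_le_eLpNorm_of_exponent_le h1.le hgm.1)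
    rw [eLpNorm_one_eq_lintegral_enorm]
    simp [hg]
  rw [analyticProj_rePoly h0, eLpNorm_congr_ae (MemLp.coeFn_toLp _),
    eLpNorm_congr_ae (coeFn_rePoly P)]
  have h4 : (fun t : Circ => (2⁻¹ : ℂ) * ((P + Polynomial.C (P.eval 0)).eval (fourier 1 t : ℂ))) =
      (2⁻¹ : ℂ) • (f + fun _ => P.eval 0) := by
    ext t
    simp [hf]
  rw [h4, eLpNorm_const_smul]
  calc ‖(2⁻¹ : ℂ)‖ₑ * eLpNorm (f + fun _ => P.eval 0) q μT
      ≤ 1 * (eLpNorm f q μT + eLpNorm (fun _ : Circ => P.eval 0) q μT) := by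
        gcongr
        · rw [← ofReal_norm]
          simp only [norm_inv, RCLike.norm_ofNat, ENNReal.ofReal_le_one]
          norm_num
        · exact eLpNorm_add_le hfm.1 aestronglyMeasurable_const h1.le
    _ ≤ ENNReal.ofReal (A ^ r⁻¹) * eLpNorm g q μT + eLpNorm g q μT := by
        rw [one_mul, eLpNorm_const _ hq0 (NeZero.ne _)]
        gcongr
        simpa using hc
    _ = _ := by rw [add_mul, one_mul]

/-- The projection contracts L² and the L² norm dominates the L^q norm, so an L² error in
approximating u costs at most C + 1 times itself. -/
theorem eLpNorm_analyticProj_le_of_approx (h1 : 1 ≤ q) (h2 : q ≤ 2) {C : ℝ≥0∞} (hC : C ≠ ∞)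
    {u : Lp ℂ 2 μT} (h : ∀ ε : ℝ≥0∞, ε ≠ 0 → ∃ v : Lp ℂ 2 μT, ‖u - v‖ₑ ≤ ε ∧
      eLpNorm (analyticProj v) q μT ≤ C * eLpNorm v q μT) :
    eLpNorm (analyticProj u) q μT ≤ C * eLpNorm u q μT := by
  refine ENNReal.le_of_forall_pos_le_add fun ε hε _ => ?_
  have hC1 : C + 1 ≠ 0 := by simp
  have hCt : C + 1 ≠ ∞ := by finiteness
  obtain ⟨v, hv, hgood⟩ := h (ε / (C + 1)) (ENNReal.div_pos (by simpa using hε.ne') hCt).ne'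
  have e1 : analyticProj u = analyticProj v + analyticProj (u - v) := by
    rw [map_sub]; abel
  have e2 : eLpNorm v q μT ≤ eLpNorm u q μT + ‖u - v‖ₑ := by
    calc eLpNorm v q μT = eLpNorm (u - (u - v) : Lp ℂ 2 μT) q μT := by rw [sub_sub_cancel]
      _ ≤ eLpNorm u q μT + eLpNorm (u - v : Lp ℂ 2 μT) q μT := eLpNorm_Lp_sub_le h1 _ _
      _ ≤ _ := by gcongr; exact eLpNorm_Lp_le_enorm h2 _
  have e3 : eLpNorm (analyticProj (u - v)) q μT ≤ ‖u - v‖ₑ := by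
    refine (eLpNorm_Lp_le_enorm h2 _).trans ?_
    rw [enorm_le_iff_norm_le]
    exact Submodule.norm_starProjection_apply_le _ _
  calc eLpNorm (analyticProj u) q μT
      ≤ eLpNorm (analyticProj v) q μT + eLpNorm (analyticProj (u - v)) q μT := by
        rw [e1]; exact eLpNorm_Lp_add_le h1 _ _
    _ ≤ C * (eLpNorm u q μT + ‖u - v‖ₑ) + ‖u - v‖ₑ := by
        gcongr
        exact hgood.trans (by gcongr)
    _ = C * eLpNorm u q μT + (C + 1) * ‖u - v‖ₑ := by ring
    _ ≤ C * eLpNorm u q μT + (C + 1) * (ε / (C + 1)) := by gcongr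
    _ = _ := by rw [ENNReal.mul_div_cancel hC1 hCt]

/-- Nonnegative `L²` functions are approximated by positive trigonometric polynomials. -/
theorem exists_rePoly_approx {v : Circ → ℝ} (hv : MemLp v 2 μT) (h0 : ∀ t, 0 ≤ v t)
    {ε : ℝ} (hε : 0 < ε) :
    ∃ P : Polynomial ℂ, (P.eval 0).im = 0 ∧ (∀ t : Circ, 0 < (P.eval (fourier 1 t : ℂ)).re) ∧
      eLpNorm (fun t => v t - (P.eval (fourier 1 t : ℂ)).re) 2 μT ≤ ENNReal.ofReal ε := by
  have hδ : 0 < ε / 4 := by positivity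
  set δ := ε / 4 with hδdef
  obtain ⟨φ, hφ, -⟩ := hv.exists_boundedContinuous_eLpNorm_sub_le (by norm_num)
    (ε := ENNReal.ofReal δ) (by simpa using hδ)
  -- The shift by 2δ keeps a trigonometric polynomial within δ of this function positive. The errors
  -- are δ from φ and at most 3δ from shift and polynomial, in all 4δ = ε.
  let ψ : C(Circ, ℂ) := ⟨fun t => ((max (φ t) 0 + 2 * δ : ℝ) : ℂ), by fun_prop⟩
  have hdense : Dense ((Submodule.span ℂ (Set.range (fourier (T := (1 : ℝ))))) :
      Set C(Circ, ℂ)) := by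
    rw [Submodule.dense_iff_topologicalClosure_eq_top]
    exact span_fourier_closure_eq_top
  obtain ⟨p, hp, hpψ⟩ := hdense.exists_dist_lt ψ hδ
  obtain ⟨P, hP0, hP⟩ := exists_rePoly_of_mem_span hp
  have hclose : ∀ t : Circ, |max (φ t) 0 + 2 * δ - (P.eval (fourier 1 t : ℂ)).re| < δ := fun t => by
    have h3 : ‖ψ t - p t‖ < δ := by
      rw [← dist_eq_norm]
      exact (ContinuousMap.dist_apply_le_dist t).trans_lt hpψ
    have h4 := (Complex.abs_re_le_norm (ψ t - p t)).trans_lt h3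
    rwa [Complex.sub_re, ← hP t] at h4
  refine ⟨P, hP0, fun t => ?_, ?_⟩
  · have h3 := (abs_lt.1 (hclose t)).2
    have h4 := le_max_right (φ t) 0
    linarith
  · have hmeas : AEStronglyMeasurable (fun t => ‖v t - φ t‖) μT :=
      (hv.1.sub φ.continuous.aestronglyMeasurable).norm
    calc eLpNorm (fun t => v t - (P.eval (fourier 1 t : ℂ)).re) 2 μT
        ≤ eLpNorm ((fun t => ‖v t - φ t‖) + fun _ => 3 * δ) 2 μT := by
          refine eLpNorm_mono_real fun t => ?_
          have h3 := hclose t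
          have h4 : |v t - max (φ t) 0| ≤ |v t - φ t| := by
            have := abs_max_sub_max_le_abs (v t) (φ t) 0
            rwa [max_eq_left (h0 t)] at this
          rw [Real.norm_eq_abs, Pi.add_apply, Real.norm_eq_abs]
          rw [abs_lt] at h3
          rw [abs_le] at h4 ⊢
          constructor <;> linarith [h3.1, h3.2, h4.1, h4.2]
      _ ≤ eLpNorm (fun t => ‖v t - φ t‖) 2 μT + eLpNorm (fun _ : Circ => 3 * δ) 2 μT :=
          eLpNorm_add_le hmeas aestronglyMeasurable_const (by norm_num)
      _ ≤ ENNReal.ofReal δ + ENNReal.ofReal (3 * δ) := by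
          gcongr
          · rw [eLpNorm_norm]
            exact hφ
          · rw [eLpNorm_const _ (by norm_num) (NeZero.ne _)]
            rw [← ofReal_norm, Real.norm_of_nonneg (by positivity)]
            simp
      _ = ENNReal.ofReal ε := by
          rw [← ENNReal.ofReal_add hδ.le (by positivity), hδdef]
          congr 1
          ring

/-- The Riesz projection is bounded on `L²` in the `L^q` norm, `1 < q ≤ 2`. -/
theorem exists_eLpNorm_analyticProj_le (h1 : 1 < q) (h2 : q ≤ 2) :
    ∃ C : ℝ≥0∞, C ≠ ∞ ∧ ∀ u : Lp ℂ 2 μT,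
      eLpNorm (analyticProj u) q μT ≤ C * eLpNorm u q μT := by
  obtain ⟨C, hC, hpoly⟩ := exists_eLpNorm_analyticProj_rePoly_le h1 h2
  have hpos : ∀ {v : Circ → ℝ} (hv : MemLp (fun t => (v t : ℂ)) 2 μT), (∀ t, 0 ≤ v t) →
      eLpNorm (analyticProj (hv.toLp _)) q μT ≤ C * eLpNorm (fun t => (v t : ℂ)) q μT := by
    intro v hv hv0
    rw [← eLpNorm_congr_ae (MemLp.coeFn_toLp hv)]
    refine eLpNorm_analyticProj_le_of_approx h1.le h2 hC fun ε hε => ?_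
    obtain ⟨δ, hδ0, hδ⟩ : ∃ δ : ℝ, 0 < δ ∧ ENNReal.ofReal δ ≤ ε := by
      obtain ⟨δ, h3, h4⟩ := ENNReal.lt_iff_exists_nnreal_btwn.1 (pos_iff_ne_zero.2 hε)
      refine ⟨δ, by simpa using h3, ?_⟩
      rw [ENNReal.ofReal_coe_nnreal]
      exact h4.le
    obtain ⟨P, hP0, hP, hPv⟩ := exists_rePoly_approx (v := v) hv.re hv0 hδ0
    refine ⟨rePoly P, ?_, hpoly P hP0 hP⟩
    rw [rePoly, ← MemLp.toLp_sub, Lp.enorm_toLp]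
    refine le_trans (le_of_eq ?_) (hPv.trans hδ)
    refine eLpNorm_congr_norm_ae (Eventually.of_forall fun t => ?_)
    rw [Pi.sub_apply, ← Complex.ofReal_sub, Complex.norm_real]
  -- The factor 4 counts the positive and negative parts of Re u and Im u.
  refine ⟨4 * C, by finiteness, fun u => ?_⟩
  have hu := Lp.memLp u
  have hpart : ∀ σ : ℂ →L[ℝ] ℝ, ‖σ‖ ≤ 1 →
      ∃ hσ : MemLp (fun t => ((max (σ (u t)) 0 : ℝ) : ℂ)) 2 μT,
        eLpNorm (analyticProj (hσ.toLp _)) q μT ≤ C * eLpNorm u q μT := by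
    intro σ hσn
    have hle : ∀ t, ‖((max (σ (u t)) 0 : ℝ) : ℂ)‖ ≤ ‖u t‖ := fun t => by
      rw [Complex.norm_real, Real.norm_of_nonneg (le_max_right _ _)]
      refine max_le ((le_abs_self _).trans ((σ.le_opNorm _).trans ?_)) (norm_nonneg _)
      exact mul_le_of_le_one_left (norm_nonneg _) hσn
    have hσ : MemLp (fun t => ((max (σ (u t)) 0 : ℝ) : ℂ)) 2 μT := by
      refine hu.of_le ?_ (Eventually.of_forall hle)
      have : Continuous fun z : ℂ => ((max (σ z) 0 : ℝ) : ℂ) := by fun_prop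
      exact this.comp_aestronglyMeasurable hu.1
    refine ⟨hσ, (hpos hσ fun t => le_max_right _ _).trans ?_⟩
    gcongr
    exact eLpNorm_mono hle
  have hre : ‖Complex.reCLM‖ ≤ 1 := by simp
  have him : ‖Complex.imCLM‖ ≤ 1 := by simp
  obtain ⟨m1, b1⟩ := hpart Complex.reCLM hre
  obtain ⟨m2, b2⟩ := hpart (-Complex.reCLM) (by rwa [norm_neg])
  obtain ⟨m3, b3⟩ := hpart Complex.imCLM him
  obtain ⟨m4, b4⟩ := hpart (-Complex.imCLM) (by rwa [norm_neg])
  have hdec : u = (m1.toLp _ - m2.toLp _) + Complex.I • (m3.toLp _ - m4.toLp _) := by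
    rw [← MemLp.toLp_sub, ← MemLp.toLp_sub, ← MemLp.toLp_const_smul, ← MemLp.toLp_add]
    refine Lp.ext ?_
    filter_upwards [MemLp.coeFn_toLp ((m1.sub m2).add ((m3.sub m4).const_smul Complex.I))]
      with t ht
    rw [ht]
    have hmax : ∀ x : ℝ, max x 0 - max (-x) 0 = x := fun x => by
      rcases le_total 0 x with h | h
      · rw [max_eq_left h, max_eq_right (by linarith), sub_zero]
      · rw [max_eq_right h, max_eq_left (by linarith), zero_sub, neg_neg]
    simp only [Pi.add_apply, Pi.sub_apply, Pi.smul_apply, neg_apply,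
      Complex.reCLM_apply, Complex.imCLM_apply, ← Complex.ofReal_sub, hmax, smul_eq_mul]
    rw [mul_comm, Complex.re_add_im]
  have hsplit : eLpNorm (analyticProj u) q μT ≤
      (C * eLpNorm u q μT + C * eLpNorm u q μT) + (C * eLpNorm u q μT + C * eLpNorm u q μT) := by
    conv_lhs => rw [hdec]
    rw [map_add, map_smul, map_sub, map_sub]
    refine (eLpNorm_Lp_add_le h1.le _ _).trans (add_le_add ?_ ?_)
    · exact (eLpNorm_Lp_sub_le h1.le _ _).trans (add_le_add b1 b2)
    · rw [eLpNorm_Lp_smul]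
      rw [← ofReal_norm, Complex.norm_I, ENNReal.ofReal_one, one_mul]
      exact (eLpNorm_Lp_sub_le h1.le _ _).trans (add_le_add b3 b4)
  refine hsplit.trans (le_of_eq ?_)
  ring

/-- Every scalar `L^q` function, `1 < q ≤ 2`, has a Riesz projection, and both are `L^q` limits of
`L²` functions and their projections. -/
theorem exists_riesz_scalar (h1 : 1 < q) (h2 : q ≤ 2) {h : Circ → ℂ} (hh : MemLp h q μT) :
    ∃ (g : Circ → ℂ) (H : ℕ → Lp ℂ 2 μT), MemLp g q μT ∧
      Tendsto (fun n => eLpNorm (⇑(H n) - h) q μT) atTop (𝓝 0) ∧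
      Tendsto (fun n => eLpNorm (⇑(analyticProj (H n)) - g) q μT) atTop (𝓝 0) := by
  have hqt : q ≠ ∞ := ne_top_of_le_ne_top (by norm_num) h2
  obtain ⟨C, hC, hbd⟩ := exists_eLpNorm_analyticProj_le h1 h2
  have hε : ∀ n : ℕ, ((2 : ℝ≥0∞)⁻¹ ^ n) ≠ 0 := fun n => by simp
  choose φ hφ _ using fun n : ℕ => hh.exists_boundedContinuous_eLpNorm_sub_le hqt (hε n)
  let H : ℕ → Lp ℂ 2 μT := fun n => (memLp_of_continuous (φ n).continuous 2).toLp _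
  have hHm : ∀ n, MemLp (H n) q μT := fun n => (Lp.memLp (H n)).mono_exponent h2
  have hH : ∀ n, eLpNorm (⇑(H n) - h) q μT ≤ (2 : ℝ≥0∞)⁻¹ ^ n := fun n => by
    rw [eLpNorm_sub_comm]
    refine le_trans (le_of_eq (eLpNorm_congr_ae ?_)) (hφ n)
    exact (EventuallyEq.refl _ _).sub (MemLp.coeFn_toLp _)
  have hpow : Tendsto (fun n : ℕ => (2 : ℝ≥0∞)⁻¹ ^ n) atTop (𝓝 0) :=
    ENNReal.tendsto_pow_atTop_nhds_zero_of_lt_one (by simp)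
  have hGm : ∀ n, MemLp (analyticProj (H n)) q μT := fun n => (Lp.memLp _).mono_exponent h2
  obtain ⟨g, hg, hlim⟩ := Lp.cauchy_complete_eLpNorm (μ := μT) h1.le hGm
    -- Two approximations of h within 2^{-N} have projections within 2C · 2^{-N}; the extra 1 makes
    -- the inequality strict.
    (B := fun n => (2 * C + 1) * (2 : ℝ≥0∞)⁻¹ ^ n) (by
      rw [ENNReal.tsum_mul_left, ENNReal.tsum_geometric]
      have : (1 - 2⁻¹ : ℝ≥0∞)⁻¹ ≠ ∞ := by simp
      finiteness) (by
      intro N n m hn hm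
      have e1 : eLpNorm (⇑(analyticProj (H n)) - ⇑(analyticProj (H m))) q μT =
          eLpNorm (analyticProj (H n - H m)) q μT := by
        rw [map_sub]
        exact (eLpNorm_congr_ae (Lp.coeFn_sub _ _)).symm
      have e2 : eLpNorm (H n - H m : Lp ℂ 2 μT) q μT ≤
          (2 : ℝ≥0∞)⁻¹ ^ N + (2 : ℝ≥0∞)⁻¹ ^ N := by
        rw [eLpNorm_congr_ae (Lp.coeFn_sub _ _)]
        have e3 : (⇑(H n) - ⇑(H m)) = (⇑(H n) - h) - (⇑(H m) - h) := by abel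
        rw [e3]
        refine (eLpNorm_sub_le ((hHm n).sub hh).1 ((hHm m).sub hh).1 h1.le).trans ?_
        refine add_le_add ((hH n).trans ?_) ((hH m).trans ?_)
        · exact pow_le_pow_right_of_le_one' (by simp) hn
        · exact pow_le_pow_right_of_le_one' (by simp) hm
      have hpN : (2 : ℝ≥0∞)⁻¹ ^ N ≠ ∞ := by finiteness
      calc _ = eLpNorm (analyticProj (H n - H m)) q μT := e1
        _ ≤ C * ((2 : ℝ≥0∞)⁻¹ ^ N + (2 : ℝ≥0∞)⁻¹ ^ N) := (hbd _).trans (by gcongr)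
        _ = 2 * C * (2 : ℝ≥0∞)⁻¹ ^ N := by ring
        _ < 2 * C * (2 : ℝ≥0∞)⁻¹ ^ N + (2 : ℝ≥0∞)⁻¹ ^ N :=
          ENNReal.lt_add_right (by finiteness) (hε N)
        _ = _ := by ring)
  exact ⟨g, H, hg, tendsto_of_tendsto_of_tendsto_of_le_of_le tendsto_const_nhds hpow
    (fun _ => bot_le) hH, hlim⟩

end RieszProjection

end

/-! ### The Riesz projection of vector functions, and density of L² functions in analytic and
coanalytic L^q. -/

section

theorem fourierCoeff_clm {E F : Type*} [NormedAddCommGroup E] [NormedSpace ℂ E] [CompleteSpace E]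
    [NormedAddCommGroup F] [NormedSpace ℂ F] [CompleteSpace F] (L : E →L[ℂ] F) {f : Circ → E}
    (hf : Integrable f μT) (k : ℤ) :
    fourierCoeff (fun t => L (f t)) k = L (fourierCoeff f k) := by
  unfold fourierCoeff
  rw [← L.integral_comp_comm (integrable_fourier_smul hf _)]
  simp

section VectorRiesz

variable {ι : Type} [Fintype ι] {q : ℝ≥0∞}

theorem tendsto_eLpNorm_of_coords (hq : 1 ≤ q) {F : ℕ → Circ → EuclideanSpace ℂ ι}
    {f : Circ → EuclideanSpace ℂ ι} (hF : ∀ n, MemLp (F n) q μT) (hf : MemLp f q μT)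
    (h : ∀ i, Tendsto (fun n => eLpNorm (fun t => F n t i - f t i) q μT) atTop (𝓝 0)) :
    Tendsto (fun n => eLpNorm (F n - f) q μT) atTop (𝓝 0) := by
  classical
  have hsum : Tendsto (fun n => ∑ i, eLpNorm (fun t => F n t i - f t i) q μT) atTop (𝓝 0) := by
    simpa using tendsto_finsetSum Finset.univ fun i _ => h i
  refine tendsto_of_tendsto_of_tendsto_of_le_of_le tendsto_const_nhds hsum (fun _ => bot_le)
    fun n => ?_
  have h1 : F n - f = ∑ i, fun t => (F n t i - f t i) • EuclideanSpace.single i (1 : ℂ) := by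
    ext t j
    simp [Finset.sum_apply, Pi.single_apply]
  have hm : ∀ i, AEStronglyMeasurable (fun t => F n t i - f t i) μT := fun i =>
    (((hF n).eval_piLp i).sub (hf.eval_piLp i)).1
  simp only
  rw [h1]
  refine (eLpNorm_sum_le (fun i _ => (hm i).smul aestronglyMeasurable_const) hq).trans
    (Finset.sum_le_sum fun i _ => le_of_eq ?_)
  refine eLpNorm_congr_norm_ae (Eventually.of_forall fun t => ?_)
  change ‖(F n t i - f t i) • (EuclideanSpace.single i 1 : EuclideanSpace ℂ ι)‖ = _
  rw [norm_smul, PiLp.norm_single, norm_one, mul_one]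

theorem coeFn_coord (u : LV ι 2) (i : ι) : coord i u =ᵐ[μT] fun t => u t i :=
  ContinuousLinearMap.coeFn_compLp _ u

theorem analyticProj_coord (u : LV ι 2) (i : ι) :
    coord i (analyticProj u) = analyticProj (coord i u) := by
  symm
  have hc : ∀ (w : LV ι 2) (k : ℤ), fourierCoeff (coord i w) k = fourierCoeff w k i := fun w k => by
    rw [fourierCoeff_congr (coeFn_coord w i)]
    exact fourierCoeff_clm (EuclideanSpace.proj i) (integrable_Lp_two w) k
  refine analyticProj_eq_of (fun k hk => ?_) fun k hk => ?_
  · rw [hc, analyticProj_analytic u k hk]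
    rfl
  · rw [hc, hc, fourierCoeff_analyticProj u hk]

/-- Every vector `L^q` function, `1 < q ≤ 2`, has a Riesz projection, and both are `L^q` limits of
`L²` functions and their projections. -/
theorem exists_riesz (h1 : 1 < q) (h2 : q ≤ 2) {h : Circ → EuclideanSpace ℂ ι}
    (hh : MemLp h q μT) :
    ∃ (g : Circ → EuclideanSpace ℂ ι) (H : ℕ → LV ι 2), MemLp g q μT ∧
      Tendsto (fun n => eLpNorm (⇑(H n) - h) q μT) atTop (𝓝 0) ∧
      Tendsto (fun n => eLpNorm (⇑(analyticProj (H n)) - g) q μT) atTop (𝓝 0) := by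
  choose g H hg hH hG using fun i => exists_riesz_scalar h1 h2 (hh.eval_piLp i)
  have hHm : ∀ n, MemLp (fun t => (WithLp.toLp 2 fun i => H i n t : EuclideanSpace ℂ ι)) 2 μT :=
    fun n => MemLp.of_eval_piLp fun i => Lp.memLp (H i n)
  have hgm : MemLp (fun t => (WithLp.toLp 2 fun i => g i t : EuclideanSpace ℂ ι)) q μT :=
    MemLp.of_eval_piLp fun i => hg i
  have hcoord : ∀ n i, coord i ((hHm n).toLp _) = H i n := fun n i => by
    refine Lp.ext ?_
    filter_upwards [coeFn_coord ((hHm n).toLp _) i, MemLp.coeFn_toLp (hHm n)] with t ht1 ht2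
    rw [ht1, ht2]
  refine ⟨_, fun n => (hHm n).toLp _, hgm, ?_, ?_⟩
  · refine tendsto_eLpNorm_of_coords h1.le (fun n => (Lp.memLp _).mono_exponent h2) hh fun i => ?_
    refine (hH i).congr fun n => eLpNorm_congr_ae ?_
    filter_upwards [MemLp.coeFn_toLp (hHm n)] with t ht
    rw [ht, Pi.sub_apply]
  · refine tendsto_eLpNorm_of_coords h1.le (fun n => (Lp.memLp _).mono_exponent h2) hgm fun i => ?_
    refine (hG i).congr fun n => eLpNorm_congr_ae ?_
    filter_upwards [coeFn_coord (analyticProj ((hHm n).toLp _)) i] with t ht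
    rw [← ht, analyticProj_coord, hcoord, Pi.sub_apply]

theorem isAnalytic_of_tendsto (hq : 1 ≤ q) {F : ℕ → Circ → EuclideanSpace ℂ ι}
    {f : Circ → EuclideanSpace ℂ ι} (hF : ∀ n, MemLp (F n) q μT) (hf : MemLp f q μT)
    (h : Tendsto (fun n => eLpNorm (F n - f) q μT) atTop (𝓝 0)) (hA : ∀ n, IsAnalytic (F n)) :
    IsAnalytic f := fun k hk => by
  have := tendsto_fourierCoeff hq hF hf h k
  simp only [fun n => hA n k hk] at this
  exact tendsto_nhds_unique this tendsto_const_nhds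

theorem isCoanalyticZero_of_tendsto (hq : 1 ≤ q) {F : ℕ → Circ → EuclideanSpace ℂ ι}
    {f : Circ → EuclideanSpace ℂ ι} (hF : ∀ n, MemLp (F n) q μT) (hf : MemLp f q μT)
    (h : Tendsto (fun n => eLpNorm (F n - f) q μT) atTop (𝓝 0))
    (hA : ∀ n, IsCoanalyticZero (F n)) : IsCoanalyticZero f := fun k hk => by
  have := tendsto_fourierCoeff hq hF hf h k
  simp only [fun n => hA n k hk] at this
  exact tendsto_nhds_unique this tendsto_const_nhds

theorem fourierCoeff_riesz (hq : 1 ≤ q) (h2 : q ≤ 2) {h g : Circ → EuclideanSpace ℂ ι}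
    {H : ℕ → LV ι 2} (hh : MemLp h q μT) (hg : MemLp g q μT)
    (hH : Tendsto (fun n => eLpNorm (⇑(H n) - h) q μT) atTop (𝓝 0))
    (hG : Tendsto (fun n => eLpNorm (⇑(analyticProj (H n)) - g) q μT) atTop (𝓝 0)) (k : ℤ) :
    fourierCoeff g k = if 0 ≤ k then fourierCoeff h k else 0 := by
  have l1 := tendsto_fourierCoeff hq (fun n => (Lp.memLp (H n)).mono_exponent h2) hh hH k
  have l2 := tendsto_fourierCoeff hq
    (fun n => (Lp.memLp (analyticProj (H n))).mono_exponent h2) hg hG k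
  split_ifs with hk
  · simp only [fourierCoeff_analyticProj _ hk] at l2
    exact tendsto_nhds_unique l2 l1
  · simp only [fun n => analyticProj_analytic (H n) k (not_le.1 hk)] at l2
    exact tendsto_nhds_unique l2 tendsto_const_nhds

/-- By its Fourier coefficients, the Riesz projection of f is f itself, and it is a limit of
projections of L² functions. -/
theorem exists_analytic_approx (h1 : 1 < q) (h2 : q ≤ 2) {f : Circ → EuclideanSpace ℂ ι}
    (hf : MemLp f q μT) (hA : IsAnalytic f) :
    ∃ F : ℕ → LV ι 2, (∀ n, IsAnalytic (F n)) ∧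
      Tendsto (fun n => eLpNorm (⇑(F n) - f) q μT) atTop (𝓝 0) := by
  obtain ⟨g, H, hg, hH, hG⟩ := exists_riesz h1 h2 hf
  refine ⟨fun n => analyticProj (H n), fun n => analyticProj_analytic _, ?_⟩
  have hgf : g =ᵐ[μT] f := ae_eq_of_fourierCoeff_eq (hg.integrable h1.le) (hf.integrable h1.le)
    fun k => by
      rw [fourierCoeff_riesz h1.le h2 hf hg hH hG]
      split_ifs with hk
      · rfl
      · exact (hA k (not_le.1 hk)).symm
  exact hG.congr fun n => eLpNorm_congr_ae ((EventuallyEq.refl _ _).sub hgf)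

/-- Here the Riesz projection of f is zero, so the differences `H n - analyticProj (H n)` still
converge to f. -/
theorem exists_coanalytic_approx (h1 : 1 < q) (h2 : q ≤ 2) {f : Circ → EuclideanSpace ℂ ι}
    (hf : MemLp f q μT) (hA : IsCoanalyticZero f) :
    ∃ F : ℕ → LV ι 2, (∀ n, IsCoanalyticZero (F n)) ∧
      Tendsto (fun n => eLpNorm (⇑(F n) - f) q μT) atTop (𝓝 0) := by
  obtain ⟨g, H, hg, hH, hG⟩ := exists_riesz h1 h2 hf
  refine ⟨fun n => H n - analyticProj (H n), fun n k hk => ?_, ?_⟩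
  · rw [fourierCoeff_Lp_sub, fourierCoeff_analyticProj _ hk, sub_self]
  have hg0 : g =ᵐ[μT] 0 := ae_eq_zero_of_fourierCoeff (hg.integrable h1.le)
    fun k => by
      rw [fourierCoeff_riesz h1.le h2 hf hg hH hG]
      split_ifs with hk
      · exact hA k hk
      · rfl
  have hsum := hH.add hG
  rw [add_zero] at hsum
  refine tendsto_of_tendsto_of_tendsto_of_le_of_le tendsto_const_nhds hsum (fun _ => bot_le)
    fun n => ?_
  have h3 : (⇑(H n - analyticProj (H n)) - f) =ᵐ[μT]
      (⇑(H n) - f) - (⇑(analyticProj (H n)) - g) := by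
    filter_upwards [Lp.coeFn_sub (H n) (analyticProj (H n)), hg0] with t ht1 ht2
    simp only [Pi.sub_apply, ht1, ht2, Pi.zero_apply]
    abel
  simp only
  rw [eLpNorm_congr_ae h3]
  exact eLpNorm_sub_le (((Lp.memLp _).mono_exponent h2).sub hf).1
    (((Lp.memLp _).mono_exponent h2).sub hg).1 h1.le

theorem exists_norm_le_of_memLp_top {b : Circ → EuclideanSpace ℂ ι} (hb : MemLp b ∞ μT) :
    ∃ K : ℝ, ∀ᵐ t ∂μT, ‖b t‖ ≤ K := by
  refine ⟨(eLpNormEssSup b μT).toReal, ?_⟩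
  have hlt : eLpNormEssSup b μT ≠ ∞ := by
    have := hb.2.ne
    rwa [eLpNorm_exponent_top] at this
  filter_upwards [ae_le_eLpNormEssSup (f := b) (μ := μT)] with t ht
  rw [← toReal_enorm]
  exact ENNReal.toReal_mono hlt ht

theorem integrable_inner_of_top {b w : Circ → EuclideanSpace ℂ ι} (hb : MemLp b ∞ μT)
    (hw : Integrable w μT) : Integrable (fun t => inner ℂ (b t) (w t)) μT := by
  obtain ⟨K, hK⟩ := exists_norm_le_of_memLp_top hb
  refine Integrable.mono' (hw.norm.const_mul K) (hb.1.inner hw.1) ?_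
  filter_upwards [hK] with t ht
  exact (norm_inner_le_norm _ _).trans (by gcongr)

/-- A bounded conjugate analytic function vanishing at infinity is orthogonal to `H^q`. -/
theorem integral_inner_eq_zero (h1 : 1 < q) (h2 : q ≤ 2) {b w : Circ → EuclideanSpace ℂ ι}
    (hb : MemLp b ∞ μT) (hbc : IsCoanalyticZero b) (hw : MemLp w q μT) (hwa : IsAnalytic w) :
    ∫ t, inner ℂ (b t) (w t) ∂μT = 0 := by
  -- For square integrable F in place of w this is orthogonality in L²; since b is bounded, the
  -- pairing passes to the limit.
  obtain ⟨F, hFa, hF⟩ := exists_analytic_approx h1 h2 hw hwa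
  obtain ⟨K, hK⟩ := exists_norm_le_of_memLp_top hb
  have hb2 : MemLp b 2 μT := hb.mono_exponent le_top
  have hzero : ∀ n, ∫ t, inner ℂ (b t) (F n t) ∂μT = 0 := fun n => by
    have h3 : inner ℂ (hb2.toLp b) (F n) = 0 := by
      rw [← inner_conj_symm, inner_eq_zero_of_analytic (hFa n), map_zero]
      intro k hk
      rw [fourierCoeff_congr (MemLp.coeFn_toLp hb2), hbc k hk]
    rw [L2.inner_def] at h3
    rw [← h3]
    refine integral_congr_ae ?_
    filter_upwards [MemLp.coeFn_toLp hb2] with t ht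
    rw [ht]
  have hlim : Tendsto (fun n => ∫ t, inner ℂ (b t) (F n t) ∂μT) atTop
      (𝓝 (∫ t, inner ℂ (b t) (w t) ∂μT)) := by
    refine tendsto_integral_of_L1' _ (integrable_inner_of_top hb (hw.integrable h1.le)).1
      (Eventually.of_forall fun n => integrable_inner_of_top hb (integrable_Lp_two _)) ?_
    have hK' := ENNReal.Tendsto.const_mul (a := ENNReal.ofReal K) hF (Or.inr ENNReal.ofReal_ne_top)
    rw [mul_zero] at hK'
    refine tendsto_of_tendsto_of_tendsto_of_le_of_le tendsto_const_nhds hK' (fun _ => bot_le)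
      fun n => ?_
    refine (eLpNorm_le_mul_eLpNorm_of_ae_le_mul (g := ⇑(F n) - w) (c := K) ?_ 1).trans ?_
    · filter_upwards [hK] with t ht
      rw [Pi.sub_apply, ← inner_sub_right]
      exact (norm_inner_le_norm _ _).trans (by rw [Pi.sub_apply]; gcongr)
    · gcongr
      exact eLpNorm_le_eLpNorm_of_exponent_le h1.le (((Lp.memLp _).mono_exponent h2).sub hw).1
  simp only [hzero] at hlim
  exact tendsto_nhds_unique hlim tendsto_const_nhds

end VectorRiesz

end

/-! ### Multiplication by matrix functions and by inner functions. -/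

section

variable {n : ℕ}

section Action

/-- The pointwise adjoint of a matrix function. -/
def adj (M : Circ → Matrix (Fin n) (Fin n) ℂ) : Circ → Matrix (Fin n) (Fin n) ℂ :=
  fun t => (M t).conjTranspose

theorem act_apply (M : Circ → Matrix (Fin n) (Fin n) ℂ) (f : Circ → EuclideanSpace ℂ (Fin n))
    (t : Circ) (i : Fin n) : act M f t i = ∑ j, M t i j * f t j := rfl

theorem inner_act (M : Circ → Matrix (Fin n) (Fin n) ℂ) (f g : Circ → EuclideanSpace ℂ (Fin n))
    (t : Circ) : inner ℂ (act M f t) (g t) = inner ℂ (f t) (act (adj M) g t) := by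
  simp only [EuclideanSpace.inner_eq_star_dotProduct, act, adj]
  rw [Matrix.star_mulVec, dotProduct_comm, ← Matrix.dotProduct_mulVec, dotProduct_comm]

theorem adj_adj (M : Circ → Matrix (Fin n) (Fin n) ℂ) : adj (adj M) = M := by
  ext t : 1
  exact Matrix.conjTranspose_conjTranspose _

theorem act_neg (M : Circ → Matrix (Fin n) (Fin n) ℂ) (f : Circ → EuclideanSpace ℂ (Fin n)) :
    act M (-f) = -act M f := by
  ext t : 1
  simp [act, Matrix.mulVec_neg]

theorem act_sub (M : Circ → Matrix (Fin n) (Fin n) ℂ) (f g : Circ → EuclideanSpace ℂ (Fin n)) :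
    act M (f - g) = act M f - act M g := by
  rw [sub_eq_add_neg, sub_eq_add_neg, ← act_neg]
  ext t : 1
  exact act_add _ _ _ _

theorem act_congr (M : Circ → Matrix (Fin n) (Fin n) ℂ) {f g : Circ → EuclideanSpace ℂ (Fin n)}
    (h : f =ᵐ[μT] g) : act M f =ᵐ[μT] act M g := by
  filter_upwards [h] with t ht
  simp only [act, ht]

theorem act_fourier_smul (M : Circ → Matrix (Fin n) (Fin n) ℂ) (k : ℤ)
    (f : Circ → EuclideanSpace ℂ (Fin n)) :
    act M (fun t => (fourier k t : ℂ) • f t) = fun t => (fourier k t : ℂ) • act M f t := by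
  ext t : 1
  simp [act, Matrix.mulVec_smul]

theorem memLp_act {M : Circ → Matrix (Fin n) (Fin n) ℂ} {f : Circ → EuclideanSpace ℂ (Fin n)}
    {p r q : ℝ≥0∞} [ENNReal.HolderTriple p r q] (hM : ∀ i j, MemLp (fun t => M t i j) p μT)
    (hf : MemLp f r μT) : MemLp (act M f) q μT := by
  refine MemLp.of_eval_piLp fun i => ?_
  simp only [act_apply]
  refine memLp_finsetSum _ fun j _ => ?_
  have h := (hf.eval_piLp j).mul (r := q) (hM i j)
  exact h

theorem memLp_adj {M : Circ → Matrix (Fin n) (Fin n) ℂ} {p : ℝ≥0∞}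
    (hM : ∀ i j, MemLp (fun t => M t i j) p μT) (i j : Fin n) :
    MemLp (fun t => adj M t i j) p μT :=
  (hM j i).star

end Action

variable {Θ : Circ → Matrix (Fin n) (Fin n) ℂ}

theorem IsInner.norm_act (hΘ : IsInner Θ) (f : Circ → EuclideanSpace ℂ (Fin n)) :
    ∀ᵐ t ∂μT, ‖act Θ f t‖ = ‖f t‖ := by
  filter_upwards [hΘ.unitary] with t ht
  have h1 : inner ℂ (act Θ f t) (act Θ f t) = inner ℂ (f t) (f t) := by
    rw [inner_act]
    have h2 : act (adj Θ) (act Θ f) t = f t := by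
      simp only [act, adj, Matrix.mulVec_mulVec]
      rw [← Matrix.star_eq_conjTranspose, (Matrix.mem_unitaryGroup_iff').1 ht, Matrix.one_mulVec]
    rw [h2]
  rw [inner_self_eq_norm_sq_to_K, inner_self_eq_norm_sq_to_K] at h1
  have h3 : ‖act Θ f t‖ ^ 2 = ‖f t‖ ^ 2 := by exact_mod_cast h1
  exact (sq_eq_sq₀ (norm_nonneg _) (norm_nonneg _)).1 h3

theorem IsInner.adj_act (hΘ : IsInner Θ) (f : Circ → EuclideanSpace ℂ (Fin n)) :
    act (adj Θ) (act Θ f) =ᵐ[μT] f := by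
  filter_upwards [hΘ.unitary] with t ht
  simp only [act, adj, Matrix.mulVec_mulVec]
  rw [← Matrix.star_eq_conjTranspose, (Matrix.mem_unitaryGroup_iff').1 ht, Matrix.one_mulVec]

theorem IsInner.act_adj (hΘ : IsInner Θ) (f : Circ → EuclideanSpace ℂ (Fin n)) :
    act Θ (act (adj Θ) f) =ᵐ[μT] f := by
  filter_upwards [hΘ.unitary] with t ht
  simp only [act, adj, Matrix.mulVec_mulVec]
  rw [← Matrix.star_eq_conjTranspose, (Matrix.mem_unitaryGroup_iff).1 ht, Matrix.one_mulVec]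

theorem IsInner.norm_act_adj (hΘ : IsInner Θ) (f : Circ → EuclideanSpace ℂ (Fin n)) :
    ∀ᵐ t ∂μT, ‖act (adj Θ) f t‖ = ‖f t‖ := by
  filter_upwards [hΘ.norm_act (act (adj Θ) f), hΘ.act_adj f] with t h1 h2
  rw [← h1, h2]

theorem IsInner.memLp_act (hΘ : IsInner Θ) {f : Circ → EuclideanSpace ℂ (Fin n)} {q : ℝ≥0∞}
    (hf : MemLp f q μT) : MemLp (act Θ f) q μT :=
  MTTO.memLp_act hΘ.bounded hf

theorem IsInner.memLp_act_adj (hΘ : IsInner Θ) {f : Circ → EuclideanSpace ℂ (Fin n)} {q : ℝ≥0∞}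
    (hf : MemLp f q μT) : MemLp (act (adj Θ) f) q μT :=
  MTTO.memLp_act (memLp_adj hΘ.bounded) hf

/-- `Θ^* z^k c` has no Fourier coefficients of index larger than `k`. -/
theorem IsInner.fourierCoeff_adj_mono (hΘ : IsInner Θ) (k : ℤ) (c : EuclideanSpace ℂ (Fin n))
    {j : ℤ} (hj : k < j) :
    fourierCoeff (act (adj Θ) fun t => (fourier k t : ℂ) • c) j = 0 := by
  rw [act_fourier_smul, fourierCoeff_fourier_smul]
  have hm : MemLp (act (adj Θ) fun _ => c) 1 μT := hΘ.memLp_act_adj (memLp_const c)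
  ext i
  have h1 := fourierCoeff_clm (EuclideanSpace.proj i : EuclideanSpace ℂ (Fin n) →L[ℂ] ℂ)
    (memLp_one_iff_integrable.1 hm) (j - k)
  refine h1.symm.trans ?_
  have h2 : (fun t => (EuclideanSpace.proj i : EuclideanSpace ℂ (Fin n) →L[ℂ] ℂ)
      (act (adj Θ) (fun _ => c) t)) = ∑ l, fun t => c l * (starRingEnd ℂ) (Θ t l i) := by
    ext t
    rw [Finset.sum_apply]
    change act (adj Θ) (fun _ => c) t i = _
    rw [act_apply]
    refine Finset.sum_congr rfl fun l _ => ?_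
    rw [mul_comm]
    rfl
  rw [h2, fourierCoeff.sum _ _ fun l _ => ?_, Finset.sum_apply]
  · refine Finset.sum_eq_zero fun l _ => ?_
    rw [fourierCoeff.const_mul, fourierCoeff_conj, hΘ.analytic l i _ (by omega), map_zero, mul_zero]
  · exact ((hΘ.bounded l i).star.integrable le_top).const_mul _

theorem isAnalytic_congr {E : Type*} [NormedAddCommGroup E] [NormedSpace ℂ E] {f g : Circ → E}
    (h : f =ᵐ[μT] g) : IsAnalytic f ↔ IsAnalytic g := by
  simp only [IsAnalytic, fourierCoeff_congr h]

theorem isCoanalyticZero_congr {E : Type*} [NormedAddCommGroup E] [NormedSpace ℂ E] {f g : Circ → E}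
    (h : f =ᵐ[μT] g) : IsCoanalyticZero f ↔ IsCoanalyticZero g := by
  simp only [IsCoanalyticZero, fourierCoeff_congr h]

theorem inner_toLp {f g : Circ → EuclideanSpace ℂ (Fin n)} (hf : MemLp f 2 μT)
    (hg : MemLp g 2 μT) : inner ℂ (hf.toLp f) (hg.toLp g) = ∫ t, inner ℂ (f t) (g t) ∂μT := by
  rw [L2.inner_def]
  refine integral_congr_ae ?_
  filter_upwards [hf.coeFn_toLp, hg.coeFn_toLp] with t h1 h2
  rw [h1, h2]

theorem inner_const_fourierCoeff {f : Circ → EuclideanSpace ℂ (Fin n)} (hf : Integrable f μT)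
    (k : ℤ) (c : EuclideanSpace ℂ (Fin n)) :
    inner ℂ c (fourierCoeff f k) = ∫ t, inner ℂ ((fourier k t : ℂ) • c) (f t) ∂μT := by
  rw [fourierCoeff, ← integral_inner (integrable_fourier_smul hf _)]
  refine integral_congr_ae (Eventually.of_forall fun t => ?_)
  simp only
  rw [inner_smul_left, inner_smul_right, fourier_neg]

theorem memLp_mono (k : ℤ) (c : EuclideanSpace ℂ (Fin n)) (p : ℝ≥0∞) :
    MemLp (fun t : Circ => (fourier k t : ℂ) • c) p μT :=
  memLp_of_continuous ((map_continuous (fourier k)).smul continuous_const) p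

/-- By duality: the coefficient of Θ f at k < 0, paired with c, is the pairing of f with Θ^* z^k c,
which is coanalytic. -/
theorem IsInner.isAnalytic_act_two (hΘ : IsInner Θ) {f : Circ → EuclideanSpace ℂ (Fin n)}
    (hf : MemLp f 2 μT) (hA : IsAnalytic f) : IsAnalytic (act Θ f) := fun k hk => by
  have hΘf := (hΘ.memLp_act hf).integrable (by norm_num)
  refine inner_self_eq_zero.1 ((inner_const_fourierCoeff hΘf k _).trans ?_)
  set c := fourierCoeff (act Θ f) k
  have h1 := hΘ.memLp_act_adj (memLp_mono k c 2)
  have h2 : inner ℂ (hf.toLp f) (h1.toLp _) = 0 := by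
    refine inner_eq_zero_of_analytic ((isAnalytic_congr hf.coeFn_toLp).2 hA)
      ((isCoanalyticZero_congr h1.coeFn_toLp).2 fun j hj => ?_)
    exact hΘ.fourierCoeff_adj_mono k c (by omega)
  have h3 : inner ℂ (h1.toLp _) (hf.toLp f) = 0 := by rw [← inner_conj_symm, h2, map_zero]
  rw [inner_toLp] at h3
  rw [← h3]
  refine integral_congr_ae (Eventually.of_forall fun t => ?_)
  simp only
  rw [inner_act, adj_adj]

theorem isAnalytic_mono {k : ℤ} (hk : 0 ≤ k) (c : EuclideanSpace ℂ (Fin n)) :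
    IsAnalytic fun t : Circ => (fourier k t : ℂ) • c := fun j hj => by
  rw [fourierCoeff_const_smul_fourier, if_neg (by omega)]

/-- The dual statement: for k ≥ 0 the function Θ z^k c is analytic, hence orthogonal to f. -/
theorem IsInner.isCoanalyticZero_act_adj_two (hΘ : IsInner Θ)
    {f : Circ → EuclideanSpace ℂ (Fin n)} (hf : MemLp f 2 μT) (hA : IsCoanalyticZero f) :
    IsCoanalyticZero (act (adj Θ) f) := fun k hk => by
  have hΘf := (hΘ.memLp_act_adj hf).integrable (by norm_num)
  refine inner_self_eq_zero.1 ((inner_const_fourierCoeff hΘf k _).trans ?_)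
  set c := fourierCoeff (act (adj Θ) f) k
  have h1 := hΘ.memLp_act (memLp_mono k c 2)
  have h2 : inner ℂ (h1.toLp _) (hf.toLp f) = 0 := by
    refine inner_eq_zero_of_analytic ((isAnalytic_congr h1.coeFn_toLp).2 ?_)
      ((isCoanalyticZero_congr hf.coeFn_toLp).2 hA)
    exact hΘ.isAnalytic_act_two (memLp_mono k c 2) (isAnalytic_mono hk c)
  rw [inner_toLp] at h2
  rw [← h2]
  refine integral_congr_ae (Eventually.of_forall fun t => ?_)
  simp only
  rw [inner_act]

variable {q : ℝ≥0∞}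

/-- Unitary values make multiplication by Θ^* isometric in L^q, so the L² case extends by density.
-/
theorem IsInner.isCoanalyticZero_act_adj (hΘ : IsInner Θ) (h1 : 1 < q) (h2 : q ≤ 2)
    {f : Circ → EuclideanSpace ℂ (Fin n)} (hf : MemLp f q μT) (hA : IsCoanalyticZero f) :
    IsCoanalyticZero (act (adj Θ) f) := by
  obtain ⟨F, hFa, hF⟩ := exists_coanalytic_approx h1 h2 hf hA
  refine isCoanalyticZero_of_tendsto h1.le (F := fun k => act (adj Θ) (F k))
    (fun k => hΘ.memLp_act_adj ((Lp.memLp _).mono_exponent h2)) (hΘ.memLp_act_adj hf) ?_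
    fun k => hΘ.isCoanalyticZero_act_adj_two (Lp.memLp _) (hFa k)
  refine hF.congr fun k => eLpNorm_congr_norm_ae ?_
  filter_upwards [hΘ.norm_act_adj (⇑(F k) - f)] with t ht
  rw [← act_sub, ht]

end

/-! ### The model space and its bounded test functions. -/

section

variable {n : ℕ} {Θ : Circ → Matrix (Fin n) (Fin n) ℂ} {q : ℝ≥0∞}

/-- The function g in the definition can only be Θ^* f, which removes the existential quantifier. -/
theorem mem_modelSpace_iff (hΘ : IsInner Θ) {f : LV (Fin n) 2} :
    f ∈ modelSpace Θ ↔ IsAnalytic f ∧ IsCoanalyticZero (act (adj Θ) f) := by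
  constructor
  · rintro ⟨hf, g, hg, hfg⟩
    refine ⟨hf, (isCoanalyticZero_congr ?_).2 hg⟩
    exact (act_congr _ hfg).trans (hΘ.adj_act _)
  · rintro ⟨hf, hg⟩
    have hm := hΘ.memLp_act_adj (Lp.memLp f)
    refine ⟨hf, hm.toLp _, (isCoanalyticZero_congr hm.coeFn_toLp).2 hg, ?_⟩
    exact ((act_congr _ hm.coeFn_toLp).trans (hΘ.act_adj _)).symm

theorem isClosed_modelSpace (hΘ : IsInner Θ) : IsClosed (modelSpace Θ : Set (LV (Fin n) 2)) := by
  refine IsSeqClosed.isClosed fun F f hF hlim => ?_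
  have hlim' := (Lp.tendsto_Lp_iff_tendsto_eLpNorm' F f).1 hlim
  have hF' := fun k => (mem_modelSpace_iff hΘ).1 (hF k)
  refine (mem_modelSpace_iff hΘ).2 ⟨?_, ?_⟩
  · exact isAnalytic_of_tendsto (by norm_num) (fun k => Lp.memLp (F k)) (Lp.memLp f) hlim'
      fun k => (hF' k).1
  · refine isCoanalyticZero_of_tendsto (q := 2) (by norm_num)
      (fun k => hΘ.memLp_act_adj (Lp.memLp (F k))) (hΘ.memLp_act_adj (Lp.memLp f)) ?_
      fun k => (hF' k).2
    refine hlim'.congr fun k => eLpNorm_congr_norm_ae ?_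
    filter_upwards [hΘ.norm_act_adj (⇑(F k) - f)] with t ht
    rw [← act_sub, ht]

section Trial

/-- The analytic part of `Θ^* z^k c`, a polynomial. -/
def trialPoly (Θ : Circ → Matrix (Fin n) (Fin n) ℂ) (k : ℕ) (c : EuclideanSpace ℂ (Fin n)) :
    Circ → EuclideanSpace ℂ (Fin n) :=
  ∑ j ∈ Finset.range (k + 1), fun t => (fourier (j : ℤ) t : ℂ) •
    fourierCoeff (act (adj Θ) fun t => (fourier (k : ℤ) t : ℂ) • c) j

/-- The projection `z^k c - Θ P_+ (Θ^* z^k c)` of `z^k c` to the model space. -/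
def trialFun (Θ : Circ → Matrix (Fin n) (Fin n) ℂ) (k : ℕ) (c : EuclideanSpace ℂ (Fin n)) :
    Circ → EuclideanSpace ℂ (Fin n) :=
  (fun t => (fourier (k : ℤ) t : ℂ) • c) - act Θ (trialPoly Θ k c)

variable (k : ℕ) (c : EuclideanSpace ℂ (Fin n))

theorem memLp_trialPoly (p : ℝ≥0∞) : MemLp (trialPoly Θ k c) p μT :=
  memLp_finsetSum' _ fun j _ => memLp_mono j _ p

theorem fourierCoeff_trialPoly (j : ℤ) :
    fourierCoeff (trialPoly Θ k c) j = if 0 ≤ j ∧ j ≤ k then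
      fourierCoeff (act (adj Θ) fun t => (fourier (k : ℤ) t : ℂ) • c) j else 0 := by
  rw [trialPoly, fourierCoeff.sum _ _ fun (i : ℕ) _ => memLp_one_iff_integrable.1 (memLp_mono (i : ℤ) _ 1),
    Finset.sum_apply]
  simp_rw [fourierCoeff_const_smul_fourier]
  split_ifs with hj
  · obtain ⟨hj0, hjk⟩ := hj
    lift j to ℕ using hj0
    simp only [Nat.cast_inj, Finset.sum_ite_eq, Finset.mem_range]
    rw [if_pos (by omega)]
  · refine Finset.sum_eq_zero fun i hi => if_neg ?_
    have := Finset.mem_range.1 hi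
    omega

theorem isAnalytic_trialPoly : IsAnalytic (trialPoly Θ k c) := fun j hj => by
  rw [fourierCoeff_trialPoly, if_neg (by omega)]

/-- `trialPoly` is an analytic polynomial, so the pairing involves only finitely many coefficients
of nonnegative index and makes sense for integrable functions. -/
theorem integral_inner_trialPoly_congr {x y : Circ → EuclideanSpace ℂ (Fin n)}
    (hx : Integrable x μT) (hy : Integrable y μT)
    (h : ∀ j : ℤ, 0 ≤ j → fourierCoeff x j = fourierCoeff y j) :
    ∫ t, inner ℂ (trialPoly Θ k c t) (x t) ∂μT = ∫ t, inner ℂ (trialPoly Θ k c t) (y t) ∂μT := by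
  have key : ∀ {x : Circ → EuclideanSpace ℂ (Fin n)}, Integrable x μT →
      ∫ t, inner ℂ (trialPoly Θ k c t) (x t) ∂μT = ∑ j ∈ Finset.range (k + 1),
        inner ℂ (fourierCoeff (act (adj Θ) fun t => (fourier (k : ℤ) t : ℂ) • c) j)
          (fourierCoeff x j) := by
    intro x hx
    simp only [trialPoly, Finset.sum_apply, sum_inner]
    rw [integral_finsetSum _ fun (j : ℕ) _ => integrable_inner_of_top (memLp_mono (j : ℤ) _ ∞) hx]
    exact Finset.sum_congr rfl fun j _ => (inner_const_fourierCoeff hx _ _).symm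
  rw [key hx, key hy]
  exact Finset.sum_congr rfl fun j _ => by rw [h j (by omega)]

variable (hΘ : IsInner Θ)
include hΘ

theorem isCoanalyticZero_sub_trialPoly :
    IsCoanalyticZero ((act (adj Θ) fun t => (fourier (k : ℤ) t : ℂ) • c) - trialPoly Θ k c) := by
  intro j hj
  rw [fourierCoeff_sub' ((hΘ.memLp_act_adj (memLp_mono k c 1)).integrable le_rfl)
    ((memLp_trialPoly k c 1).integrable le_rfl), fourierCoeff_trialPoly]
  split_ifs with h
  · rw [sub_self]
  · rw [hΘ.fourierCoeff_adj_mono k c (by omega), sub_zero]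

theorem memLp_trialFun (p : ℝ≥0∞) : MemLp (trialFun Θ k c) p μT :=
  (memLp_mono k c p).sub (hΘ.memLp_act (memLp_trialPoly k c p))

/-- The projection of `z^k c` to the model space, as an element of the latter. -/
def trial : modelSpace Θ := ⟨(memLp_trialFun k c hΘ 2).toLp _, by
  rw [mem_modelSpace_iff hΘ, isAnalytic_congr (MemLp.coeFn_toLp _)]
  constructor
  · have h1 := hΘ.isAnalytic_act_two (memLp_trialPoly k c 2) (isAnalytic_trialPoly (Θ := Θ) k c)
    intro j hj
    rw [trialFun, fourierCoeff_sub' ((memLp_mono k c 1).integrable le_rfl)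
      ((hΘ.memLp_act (memLp_trialPoly k c 1)).integrable le_rfl), h1 j hj,
      isAnalytic_mono (by omega) c j hj, sub_zero]
  · refine (isCoanalyticZero_congr ?_).2 (isCoanalyticZero_sub_trialPoly k c hΘ)
    refine (act_congr _ (MemLp.coeFn_toLp _)).trans ?_
    rw [trialFun, act_sub]
    exact (EventuallyEq.refl _ _).sub (hΘ.adj_act _)⟩

theorem coeFn_trial : (trial k c hΘ : LV (Fin n) 2) =ᵐ[μT] trialFun Θ k c :=
  (memLp_trialFun k c hΘ 2).coeFn_toLp

/-- Here w has the coefficients of the analytic part of Θ^* h. With p = `trialPoly Θ k c`, pairing Θ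
p with h is pairing p with Θ^* h, hence with w. The difference Θ^* z^k c - p is bounded and
coanalytic, so p may be replaced by Θ^* z^k c, and what comes out is a coefficient of Θ w. Thus
testing h against the model space reads off the coefficients of h - Θ w of nonnegative index. -/
theorem integral_inner_trialFun (h1 : 1 < q) (h2 : q ≤ 2) {h w : Circ → EuclideanSpace ℂ (Fin n)}
    (hh : MemLp h q μT) (hw : MemLp w q μT) (hwa : IsAnalytic w)
    (hhw : ∀ j : ℤ, 0 ≤ j → fourierCoeff (act (adj Θ) h) j = fourierCoeff w j) :
    ∫ t, inner ℂ (trialFun Θ k c t) (h t) ∂μT =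
      inner ℂ c (fourierCoeff (h - act Θ w) k) := by
  have ih := hh.integrable h1.le
  have iw := hw.integrable h1.le
  have iΘw := (hΘ.memLp_act hw).integrable h1.le
  have iΘh := (hΘ.memLp_act_adj hh).integrable h1.le
  have hv := hΘ.memLp_act_adj (memLp_mono k c ∞)
  have e1 : ∫ t, inner ℂ (trialFun Θ k c t) (h t) ∂μT =
      inner ℂ c (fourierCoeff h k) - ∫ t, inner ℂ (trialPoly Θ k c t) (w t) ∂μT := by
    rw [← integral_inner_trialPoly_congr k c iΘh iw hhw, inner_const_fourierCoeff ih,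
      ← integral_sub (integrable_inner_of_top (memLp_mono k c ∞) ih)
        (integrable_inner_of_top (memLp_trialPoly k c ∞) iΘh)]
    refine integral_congr_ae (Eventually.of_forall fun t => ?_)
    simp only [trialFun, Pi.sub_apply, inner_sub_left]
    rw [inner_act]
  have e2 : inner ℂ c (fourierCoeff (act Θ w) k) = ∫ t, inner ℂ (trialPoly Θ k c t) (w t) ∂μT := by
    have e3 := integral_inner_eq_zero h1 h2 (hv.sub (memLp_trialPoly k c ∞))
      (isCoanalyticZero_sub_trialPoly k c hΘ) hw hwa
    simp only [Pi.sub_apply, inner_sub_left] at e3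
    rw [integral_sub (integrable_inner_of_top hv iw)
      (integrable_inner_of_top (memLp_trialPoly k c ∞) iw), sub_eq_zero] at e3
    rw [← e3, inner_const_fourierCoeff iΘw]
    refine integral_congr_ae (Eventually.of_forall fun t => ?_)
    simp only
    rw [inner_act, adj_adj]
  rw [e1, ← e2, fourierCoeff_sub' ih iΘw, inner_sub_right]

theorem inner_trial (f : LV (Fin n) 2) :
    inner ℂ (trial k c hΘ : LV (Fin n) 2) f = ∫ t, inner ℂ (trialFun Θ k c t) (f t) ∂μT := by
  rw [L2.inner_def]
  refine integral_congr_ae ?_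
  filter_upwards [coeFn_trial k c hΘ] with t ht
  rw [ht]

omit k c in
-- For f in the model space Θ^* f is coanalytic, so w = 0 is admissible in `integral_inner_trialFun`
-- and the pairings are the coefficients of f. Hence the test functions span a dense subspace.
theorem eq_zero_of_inner_trial (f : modelSpace Θ)
    (h : ∀ (k : ℕ) (c : EuclideanSpace ℂ (Fin n)), inner ℂ (trial k c hΘ) f = 0) : f = 0 := by
  obtain ⟨hf1, hf2⟩ := (mem_modelSpace_iff hΘ).1 f.2
  refine Subtype.ext (Lp_eq_zero_of_fourierCoeff fun k => ?_)
  rcases lt_or_ge k 0 with hk | hk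
  · exact hf1 k hk
  · lift k to ℕ using hk
    have h1 := h k (fourierCoeff (f : LV (Fin n) 2) k)
    rw [Submodule.coe_inner, inner_trial, integral_inner_trialFun k _ hΘ (q := 2) (by norm_num)
      le_rfl (Lp.memLp _) (w := 0) MemLp.zero (fun j _ => by simp [fourierCoeff])
      (fun j hj => by rw [hf2 j hj]; simp [fourierCoeff])] at h1
    have h3 : act Θ (0 : Circ → EuclideanSpace ℂ (Fin n)) = 0 := by
      ext t : 1
      simp [act]
    rw [h3, sub_zero] at h1
    exact inner_self_eq_zero.1 h1

end Trial

/-! ### The kernel of the truncated Toeplitz operator as a projection of a Toeplitz kernel. -/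

section Kernel

variable {G : Circ → Matrix (Fin n) (Fin n) ℂ} {p : ℝ≥0∞}
  {A : modelSpace Θ →L[ℂ] modelSpace Θ}

/-- For bounded f this is the defining property of A, as the test function lies in the model space.
Both sides are L²-continuous in f, the right one because G^* times a bounded function is square
integrable; the test functions themselves are bounded and span a dense subspace. -/
theorem inner_trial_apply (hΘ : IsInner Θ) (hp : 2 < p)
    (hG : ∀ i j, MemLp (fun t => G t i j) p μT) (hA : IsMTTO Θ G A) (f : modelSpace Θ)
    (k : ℕ) (c : EuclideanSpace ℂ (Fin n)) :
    inner ℂ (trial k c hΘ) (A f) =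
      ∫ t, inner ℂ (trialFun Θ k c t) (act G (f : LV (Fin n) 2) t) ∂μT := by
  have : CompleteSpace (modelSpace Θ) := (isClosed_modelSpace hΘ).completeSpace_coe
  have hγ : MemLp (act (adj G) (trialFun Θ k c)) 2 μT :=
    memLp_act (memLp_adj fun i j => (hG i j).mono_exponent hp.le) (memLp_trialFun k c hΘ ∞)
  have hγf : ∀ f : LV (Fin n) 2, inner ℂ (hγ.toLp _) f =
      ∫ t, inner ℂ (trialFun Θ k c t) (act G f t) ∂μT := fun f => by
    rw [L2.inner_def]
    refine integral_congr_ae ?_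
    filter_upwards [hγ.coeFn_toLp] with t ht
    rw [ht, inner_act, adj_adj]
  have hdense : Dense (Submodule.span ℂ {g : modelSpace Θ |
      ∃ (j : ℕ) (d : EuclideanSpace ℂ (Fin n)), g = trial j d hΘ} : Set (modelSpace Θ)) := by
    rw [Submodule.dense_iff_topologicalClosure_eq_top, Submodule.topologicalClosure_eq_top_iff,
      Submodule.eq_bot_iff]
    intro f hf
    exact eq_zero_of_inner_trial hΘ f fun j d => by
      refine Submodule.inner_right_of_mem_orthogonal ?_ hf
      exact Submodule.subset_span ⟨j, d, rfl⟩
  have heq : (innerSL ℂ (trial k c hΘ)).comp A =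
      (innerSL ℂ (hγ.toLp _)).comp (modelSpace Θ).subtypeL := by
    refine ContinuousLinearMap.ext_on hdense ?_
    rintro _ ⟨j, d, rfl⟩
    obtain ⟨v, hv, -, hvA⟩ := hA (trial j d hΘ)
      ((memLp_congr_ae (coeFn_trial j d hΘ)).2 (memLp_trialFun j d hΘ ∞))
    have h1 := Submodule.inner_right_of_mem_orthogonal (trial k c hΘ).2 hvA
    rw [inner_sub_right, sub_eq_zero] at h1
    simp only [ContinuousLinearMap.comp_apply, innerSL_apply_apply, Submodule.subtypeL_apply]
    rw [Submodule.coe_inner, ← h1, hγf, inner_trial]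
    refine integral_congr_ae ?_
    filter_upwards [hv] with t ht
    rw [ht]
  have := congrArg (fun B : modelSpace Θ →L[ℂ] ℂ => B f) heq
  simp only [ContinuousLinearMap.comp_apply, innerSL_apply_apply, Submodule.subtypeL_apply] at this
  rw [this, hγf]

theorem one_lt_of_inv_eq (hp : 2 < p) (hq : q⁻¹ = 2⁻¹ + p⁻¹) : 1 < q := by
  rw [← ENNReal.inv_lt_inv, hq, inv_one]
  calc (2⁻¹ + p⁻¹ : ℝ≥0∞) < 2⁻¹ + 2⁻¹ :=
        ENNReal.add_lt_add_left (by simp) (ENNReal.inv_lt_inv.2 hp)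
    _ = 1 := ENNReal.inv_two_add_inv_two

theorem le_two_of_inv_eq (hq : q⁻¹ = 2⁻¹ + p⁻¹) : q ≤ 2 := by
  rw [← ENNReal.inv_le_inv, hq]
  exact le_self_add

theorem isRieszProj_zero_iff {h : LV (Fin n) q} : IsRieszProj h 0 ↔ IsCoanalyticZero h := by
  rw [IsRieszProj, sub_zero, and_iff_right_iff_imp]
  intro _ k _
  rw [fourierCoeff_congr (Lp.coeFn_zero _ _ _)]
  simp [fourierCoeff]

theorem mem_kerT_iff (hΘ : IsInner Θ) (hq : q⁻¹ = 2⁻¹ + p⁻¹)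
    (hG : ∀ i j, MemLp (fun t => G t i j) p μT) {f : LV (Fin n) 2 × LV (Fin n) q} :
    f ∈ kerT Θ G q ↔ IsAnalytic f.1 ∧ IsAnalytic f.2 ∧ IsCoanalyticZero (act (adj Θ) f.1) ∧
      IsCoanalyticZero (act G f.1 + act Θ f.2) := by
  have : ENNReal.HolderTriple p 2 q := ⟨by rw [hq, add_comm]⟩
  have h1 : MemLp (act (adj Θ) f.1) 2 μT := hΘ.memLp_act_adj (Lp.memLp _)
  have h2 : MemLp (act G f.1 + act Θ f.2) q μT :=
    (memLp_act hG (Lp.memLp f.1)).add (hΘ.memLp_act (Lp.memLp f.2))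
  refine and_congr_right fun _ => and_congr_right fun _ => and_congr ?_ ?_
  · constructor
    · rintro ⟨h, hh, hr⟩
      exact (isCoanalyticZero_congr hh).1 (isRieszProj_zero_iff.1 hr)
    · exact fun h => ⟨h1.toLp _, h1.coeFn_toLp,
        isRieszProj_zero_iff.2 ((isCoanalyticZero_congr h1.coeFn_toLp).2 h)⟩
  · constructor
    · rintro ⟨h, hh, hr⟩
      exact (isCoanalyticZero_congr hh).1 (isRieszProj_zero_iff.1 hr)
    · exact fun h => ⟨h2.toLp _, h2.coeFn_toLp,
        isRieszProj_zero_iff.2 ((isCoanalyticZero_congr h2.coeFn_toLp).2 h)⟩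

theorem mem_kerIn_iff {x : LV (Fin n) 2} :
    x ∈ kerIn A ↔ ∃ hx : x ∈ modelSpace Θ, A ⟨x, hx⟩ = 0 := by
  simp only [kerIn, Submodule.mem_map, LinearMap.mem_ker, Subtype.exists, Submodule.subtype_apply,
    exists_and_right, exists_eq_right, ContinuousLinearMap.coe_coe]

/-- The kernel of `A_G^Θ` consists of the first components of the kernel of the Toeplitz
operator. -/
theorem mem_kerIn_iff_exists (hΘ : IsInner Θ) (hp : 2 < p) (hq : q⁻¹ = 2⁻¹ + p⁻¹)
    (hG : ∀ i j, MemLp (fun t => G t i j) p μT) (hA : IsMTTO Θ G A) {x : LV (Fin n) 2} :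
    x ∈ kerIn A ↔ ∃ y : LV (Fin n) q, (x, y) ∈ kerT Θ G q := by
  have h1 := one_lt_of_inv_eq hp hq
  have h2 := le_two_of_inv_eq hq
  have : ENNReal.HolderTriple p 2 q := ⟨by rw [hq, add_comm]⟩
  have hh : MemLp (act G x) q μT := memLp_act hG (Lp.memLp x)
  have hΘh := hΘ.memLp_act_adj hh
  rw [mem_kerIn_iff]
  constructor
  · rintro ⟨hx, hAx⟩
    -- w is the Riesz projection of Θ^* G x; the second component sought is -w.
    obtain ⟨w, H, hw, hH, hHw⟩ := exists_riesz h1 h2 hΘh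
    have hcoef := fourierCoeff_riesz h1.le h2 hΘh hw hH hHw
    have hwa : IsAnalytic w := fun k hk => by rw [hcoef, if_neg (not_le.2 hk)]
    have hneg : (⇑(-hw.toLp w)) =ᵐ[μT] -w :=
      (Lp.coeFn_neg _).trans hw.coeFn_toLp.neg
    refine ⟨-hw.toLp w, (mem_kerT_iff hΘ hq hG).2 ⟨?_, ?_, ?_, ?_⟩⟩
    · exact ((mem_modelSpace_iff hΘ).1 hx).1
    · refine (isAnalytic_congr hneg).2 fun k hk => ?_
      rw [← neg_one_smul ℂ w, fourierCoeff.const_smul, hwa k hk, smul_zero]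
    · exact ((mem_modelSpace_iff hΘ).1 hx).2
    · have hsum : act G x + act Θ (-hw.toLp w : LV (Fin n) q) =ᵐ[μT] act G x - act Θ w := by
        rw [sub_eq_add_neg, ← act_neg]
        exact (EventuallyEq.refl _ _).add (act_congr _ hneg)
      refine (isCoanalyticZero_congr hsum).2 fun k hk => ?_
      lift k to ℕ using hk
      -- Taking c to be the coefficient that should vanish turns the pairing into its squared norm.
      have h3 := inner_trial_apply hΘ hp hG hA ⟨x, hx⟩ k (fourierCoeff (act G x - act Θ w) k)
      rw [hAx, inner_zero_right, integral_inner_trialFun k _ hΘ h1 h2 hh hw hwa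
        fun j hj => by rw [hcoef, if_pos hj]] at h3
      exact inner_self_eq_zero.1 h3.symm
  · rintro ⟨y, hy⟩
    obtain ⟨hx, hya, hΘx, hco⟩ := (mem_kerT_iff hΘ hq hG).1 hy
    refine ⟨(mem_modelSpace_iff hΘ).2 ⟨hx, hΘx⟩, eq_zero_of_inner_trial hΘ _ fun k c => ?_⟩
    have hym := Lp.memLp y
    have hΘy := hΘ.memLp_act hym
    rw [inner_trial_apply hΘ hp hG hA, integral_inner_trialFun k c hΘ h1 h2 hh (w := -y) hym.neg]
    · rw [act_neg, sub_neg_eq_add, hco k (by omega), inner_zero_right]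
    · intro j hj
      rw [← neg_one_smul ℂ (⇑y), fourierCoeff.const_smul, hya j hj, smul_zero]
    · intro j hj
      -- Applying Θ^* to the coanalytic G x + Θ y leaves Θ^* G x + y coanalytic, so -y has the
      -- coefficients of the analytic part of Θ^* G x.
      have h3 := hΘ.isCoanalyticZero_act_adj h1 h2 (hh.add hΘy) hco j hj
      have h4 : act (adj Θ) (act G x + act Θ y) =ᵐ[μT] act (adj Θ) (act G x) - (-⇑y) := by
        rw [sub_neg_eq_add]
        filter_upwards [hΘ.adj_act y] with t ht
        rw [act_add, Pi.add_apply, ht]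
      rw [fourierCoeff_congr h4, fourierCoeff_sub' (hΘh.integrable h1.le)
        (hym.integrable h1.le).neg, sub_eq_zero] at h3
      exact h3

end Kernel

end

/-! ### Division by z, near invariance and dimension bounds. -/

section

section Shift

variable {E : Type*} [NormedAddCommGroup E] [NormedSpace ℂ E] {q : ℝ≥0∞}

theorem memLp_fourier_smul' {f : Circ → E} (hf : MemLp f q μT) (k : ℤ) :
    MemLp (fun t => (fourier k t : ℂ) • f t) q μT := by
  refine hf.of_le ?_ (Eventually.of_forall fun t => ?_)
  · exact (map_continuous (fourier k)).aestronglyMeasurable.smul hf.1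
  · rw [norm_smul, norm_fourier_eq_one, one_mul]

/-- Multiplication by `z ^ k`. -/
def shiftLp (k : ℤ) (f : Lp E q μT) : Lp E q μT := (memLp_fourier_smul' (Lp.memLp f) k).toLp _

theorem coeFn_shiftLp (k : ℤ) (f : Lp E q μT) :
    shiftLp k f =ᵐ[μT] fun t => (fourier k t : ℂ) • f t :=
  MemLp.coeFn_toLp _

theorem fourierCoeff_shiftLp (k : ℤ) (f : Lp E q μT) (j : ℤ) :
    fourierCoeff (shiftLp k f) j = fourierCoeff f (j - k) := by
  rw [fourierCoeff_congr (coeFn_shiftLp k f), fourierCoeff_fourier_smul]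

theorem shiftLp_shiftLp (j k : ℤ) (f : Lp E q μT) : shiftLp j (shiftLp k f) = shiftLp (j + k) f := by
  refine Lp.ext ?_
  filter_upwards [coeFn_shiftLp j (shiftLp k f), coeFn_shiftLp k f, coeFn_shiftLp (j + k) f]
    with t h1 h2 h3
  rw [h1, h2, h3, smul_smul, fourier_add]

theorem shiftLp_zero (f : Lp E q μT) : shiftLp 0 f = f := by
  refine Lp.ext ?_
  filter_upwards [coeFn_shiftLp 0 f] with t h1
  rw [h1, fourier_zero, one_smul]

theorem shiftLp_add (k : ℤ) (f g : Lp E q μT) :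
    shiftLp k (f + g) = shiftLp k f + shiftLp k g := by
  refine Lp.ext ?_
  filter_upwards [coeFn_shiftLp k (f + g), coeFn_shiftLp k f, coeFn_shiftLp k g, Lp.coeFn_add f g,
    Lp.coeFn_add (shiftLp k f) (shiftLp k g)] with t h1 h2 h3 h4 h5
  rw [h1, h4, h5, Pi.add_apply, Pi.add_apply, h2, h3, smul_add]

theorem shiftLp_smul (k : ℤ) (c : ℂ) (f : Lp E q μT) :
    shiftLp k (c • f) = c • shiftLp k f := by
  refine Lp.ext ?_
  filter_upwards [coeFn_shiftLp k (c • f), coeFn_shiftLp k f, Lp.coeFn_smul c f,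
    Lp.coeFn_smul c (shiftLp k f)] with t h1 h2 h3 h4
  rw [h1, h3, h4, Pi.smul_apply, Pi.smul_apply, h2, smul_comm]

theorem norm_shiftLp (k : ℤ) (f : Lp E q μT) : ‖shiftLp k f‖ = ‖f‖ := by
  rw [Lp.norm_def, Lp.norm_def]
  congr 1
  refine eLpNorm_congr_norm_ae ?_
  filter_upwards [coeFn_shiftLp k f] with t ht
  rw [ht, norm_smul, norm_fourier_eq_one, one_mul]

variable {ι : Type} [Fintype ι]

theorem mulZ_eq_shiftLp (f : LV ι 2) : mulZ ι f = shiftLp 1 f := rfl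

theorem backwardShift_eq_shiftLp {f : LV ι 2} (hf : atZero f = 0) :
    backwardShift f = shiftLp (-1) f := by
  refine MemLp.toLp_congr _ _ (Eventually.of_forall fun t => ?_)
  simp [hf]

end Shift

variable {n : ℕ} {Θ G : Circ → Matrix (Fin n) (Fin n) ℂ} {p q : ℝ≥0∞}
  {A : modelSpace Θ →L[ℂ] modelSpace Θ}

theorem fourierCoeff_Lp_add (hq : 1 ≤ q) (f g : LV (Fin n) q) (k : ℤ) :
    fourierCoeff (f + g : LV (Fin n) q) k = fourierCoeff f k + fourierCoeff g k := by
  rw [fourierCoeff_congr (Lp.coeFn_add f g),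
    fourierCoeff_add' ((Lp.memLp f).integrable hq) ((Lp.memLp g).integrable hq)]

theorem fourierCoeff_Lp_smul (c : ℂ) (f : LV (Fin n) q) (k : ℤ) :
    fourierCoeff (c • f : LV (Fin n) q) k = c • fourierCoeff f k := by
  rw [fourierCoeff_congr (Lp.coeFn_smul c f), fourierCoeff.const_smul]

theorem fourierCoeff_Lp_zero (k : ℤ) : fourierCoeff (0 : LV (Fin n) q) k = 0 := by
  rw [fourierCoeff_congr (Lp.coeFn_zero _ _ _)]
  simp [fourierCoeff]

theorem isClosed_kerIn (hΘ : IsInner Θ) : IsClosed (kerIn A : Set (LV (Fin n) 2)) := by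
  have h1 : IsClosed (LinearMap.ker (A : modelSpace Θ →ₗ[ℂ] modelSpace Θ) :
      Set (modelSpace Θ)) := A.isClosed_ker
  exact (isClosed_modelSpace hΘ).isClosedEmbedding_subtypeVal.isClosedMap _ h1

theorem kerIn_le_hardy : kerIn A ≤ hardy (Fin n) := by
  rintro x hx
  obtain ⟨hx, -⟩ := mem_kerIn_iff.1 hx
  exact hx.1

/-- The kernel of the Toeplitz operator as a submodule. -/
def kerTSubmodule (hΘ : IsInner Θ) (h1 : 1 ≤ q) (hq : q⁻¹ = 2⁻¹ + p⁻¹)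
    (hG : ∀ i j, MemLp (fun t => G t i j) p μT) :
    Submodule ℂ (LV (Fin n) 2 × LV (Fin n) q) where
  carrier := kerT Θ G q
  zero_mem' := by
    have h0 : ∀ (M : Circ → Matrix (Fin n) (Fin n) ℂ) (r : ℝ≥0∞),
        act M ((0 : LV (Fin n) r) : Circ → EuclideanSpace ℂ (Fin n)) =ᵐ[μT] 0 := fun M r =>
      Eventually.of_forall fun t => by simp [act]
    rw [mem_kerT_iff hΘ hq hG]
    refine ⟨fun k _ => fourierCoeff_Lp_zero k, fun k _ => fourierCoeff_Lp_zero k, fun k _ => ?_,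
      fun k _ => ?_⟩
    · refine (fourierCoeff_congr (h0 _ _) k).trans ?_
      simp [fourierCoeff]
    · refine (fourierCoeff_congr ((h0 _ _).add (h0 _ _)) k).trans ?_
      simp [fourierCoeff]
  add_mem' := by
    rintro ⟨f1, f2⟩ ⟨g1, g2⟩ hf hg
    have : ENNReal.HolderTriple p 2 q := ⟨by rw [hq, add_comm]⟩
    rw [mem_kerT_iff hΘ hq hG] at *
    obtain ⟨a1, a2, a3, a4⟩ := hf
    obtain ⟨b1, b2, b3, b4⟩ := hg
    have hadd : ∀ (M : Circ → Matrix (Fin n) (Fin n) ℂ) {r : ℝ≥0∞} (f g : LV (Fin n) r),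
        act M (f + g : LV (Fin n) r) =ᵐ[μT] act M f + act M g := fun M r f g => by
      filter_upwards [act_congr M (Lp.coeFn_add f g)] with t ht
      rw [ht, act_add, Pi.add_apply]
    refine ⟨(hardy (Fin n)).add_mem a1 b1, fun k hk => ?_, fun k hk => ?_, fun k hk => ?_⟩
    · exact (fourierCoeff_Lp_add h1 _ _ _).trans (by rw [a2 k hk, b2 k hk, add_zero])
    · refine (fourierCoeff_congr (hadd _ f1 g1) k).trans ?_
      rw [fourierCoeff_add'
        ((hΘ.memLp_act_adj (Lp.memLp f1)).integrable (by norm_num))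
        ((hΘ.memLp_act_adj (Lp.memLp g1)).integrable (by norm_num)), a3 k hk, b3 k hk, add_zero]
    · have hi : ∀ (f1 : LV (Fin n) 2) (f2 : LV (Fin n) q),
          Integrable (act G f1 + act Θ f2) μT := fun f1 f2 =>
        ((memLp_act (q := q) hG (Lp.memLp f1)).add (hΘ.memLp_act (Lp.memLp f2))).integrable h1
      have e : act G (f1 + g1 : LV (Fin n) 2) + act Θ (f2 + g2 : LV (Fin n) q) =ᵐ[μT]
          (act G f1 + act Θ f2) + (act G g1 + act Θ g2) := by
        filter_upwards [hadd G f1 g1, hadd Θ f2 g2] with t h3 h4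
        simp only [Pi.add_apply, h3, h4]
        abel
      refine (fourierCoeff_congr e k).trans ?_
      rw [fourierCoeff_add' (hi _ _) (hi _ _), a4 k hk, b4 k hk, add_zero]
  smul_mem' := by
    rintro c ⟨f1, f2⟩ hf
    rw [mem_kerT_iff hΘ hq hG] at *
    obtain ⟨a1, a2, a3, a4⟩ := hf
    have hsm : ∀ (M : Circ → Matrix (Fin n) (Fin n) ℂ) {r : ℝ≥0∞} (f : LV (Fin n) r),
        act M (c • f : LV (Fin n) r) =ᵐ[μT] c • act M f := fun M r f => by
      filter_upwards [act_congr M (Lp.coeFn_smul c f)] with t ht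
      rw [ht, act_smul, Pi.smul_apply]
    refine ⟨(hardy (Fin n)).smul_mem c a1, fun k hk => ?_, fun k hk => ?_, fun k hk => ?_⟩
    · exact (fourierCoeff_Lp_smul _ _ _).trans (by rw [a2 k hk, smul_zero])
    · refine (fourierCoeff_congr (hsm _ f1) k).trans ?_
      rw [fourierCoeff.const_smul, a3 k hk, smul_zero]
    · have e : act G (c • f1 : LV (Fin n) 2) + act Θ (c • f2 : LV (Fin n) q) =ᵐ[μT]
          c • (act G f1 + act Θ f2) := by
        filter_upwards [hsm G f1, hsm Θ f2] with t h3 h4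
        simp only [Pi.add_apply, Pi.smul_apply, h3, h4, smul_add]
      refine (fourierCoeff_congr e k).trans ?_
      rw [fourierCoeff.const_smul, a4 k hk, smul_zero]

/-- Division by z lowers all indices by one. This preserves the two coanalyticity conditions, and it
preserves analyticity because the coefficients at 0 vanish. -/
theorem shift_mem_kerT (hΘ : IsInner Θ) (hq : q⁻¹ = 2⁻¹ + p⁻¹)
    (hG : ∀ i j, MemLp (fun t => G t i j) p μT) {f : LV (Fin n) 2 × LV (Fin n) q}
    (hf : f ∈ kerT Θ G q) (h0 : pairAtZero f = 0) :
    (shiftLp (-1) f.1, shiftLp (-1) f.2) ∈ kerT Θ G q := by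
  obtain ⟨f1, f2⟩ := f
  rw [mem_kerT_iff hΘ hq hG] at *
  obtain ⟨a1, a2, a3, a4⟩ := hf
  have z1 : fourierCoeff f1 0 = 0 := congrArg Prod.fst h0
  have z2 : fourierCoeff f2 0 = 0 := congrArg Prod.snd h0
  have hact : ∀ (M : Circ → Matrix (Fin n) (Fin n) ℂ) {r : ℝ≥0∞} (f : LV (Fin n) r),
      act M (shiftLp (-1) f : LV (Fin n) r) =ᵐ[μT] fun t => (fourier (-1) t : ℂ) • act M f t :=
    fun M r f => by
      rw [← act_fourier_smul]
      exact act_congr M (coeFn_shiftLp _ _)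
  refine ⟨fun k hk => ?_, fun k hk => ?_, fun k hk => ?_, fun k hk => ?_⟩
  · refine (fourierCoeff_shiftLp _ _ _).trans ?_
    rcases (show k - -1 ≤ 0 by omega).eq_or_lt with h | h
    · rw [h, z1]
    · exact a1 _ h
  · refine (fourierCoeff_shiftLp _ _ _).trans ?_
    rcases (show k - -1 ≤ 0 by omega).eq_or_lt with h | h
    · rw [h, z2]
    · exact a2 _ h
  · rw [fourierCoeff_congr (hact _ f1), fourierCoeff_fourier_smul]
    exact a3 _ (by omega)
  · have e : act G (shiftLp (-1) f1 : LV (Fin n) 2) + act Θ (shiftLp (-1) f2 : LV (Fin n) q) =ᵐ[μT]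
        fun t => (fourier (-1) t : ℂ) • (act G f1 + act Θ f2) t := by
      filter_upwards [hact G f1, hact Θ f2] with t h3 h4
      simp only [Pi.add_apply, h3, h4, smul_add]
    refine (fourierCoeff_congr e k).trans ?_
    rw [fourierCoeff_fourier_smul]
    exact a4 _ (by omega)

theorem mem_kerTSubmodule {hΘ : IsInner Θ} {h1 : 1 ≤ q} {hq : q⁻¹ = 2⁻¹ + p⁻¹}
    {hG : ∀ i j, MemLp (fun t => G t i j) p μT} {f : LV (Fin n) 2 × LV (Fin n) q} :
    f ∈ kerTSubmodule hΘ h1 hq hG ↔ f ∈ kerT Θ G q := Iff.rfl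

/-- The value at the origin of a pair, as a linear map. -/
def pairAtZeroₗ (n : ℕ) {q : ℝ≥0∞} (h1 : 1 ≤ q) : (LV (Fin n) 2 × LV (Fin n) q) →ₗ[ℂ]
    (EuclideanSpace ℂ (Fin n) × EuclideanSpace ℂ (Fin n)) where
  toFun := pairAtZero
  map_add' f g := Prod.ext (fourierCoeff_Lp_add (by norm_num) f.1 g.1 0)
    (fourierCoeff_Lp_add h1 f.2 g.2 0)
  map_smul' a f := Prod.ext (fourierCoeff_Lp_smul a f.1 0) (fourierCoeff_Lp_smul a f.2 0)

theorem pairAtZeroₗ_apply (h1 : 1 ≤ q) (f : LV (Fin n) 2 × LV (Fin n) q) :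
    pairAtZeroₗ n h1 f = pairAtZero f := rfl

theorem fourierCoeff_fst_eq_of_pairAtZero_eq {f g : LV (Fin n) 2 × LV (Fin n) q}
    (h : pairAtZero f = pairAtZero g) : fourierCoeff f.1 0 = fourierCoeff g.1 0 :=
  congrArg Prod.fst h

theorem isAnalytic_shiftLp_neg_one {ι : Type} [Fintype ι] {f : LV ι 2} (hf : IsAnalytic f)
    (h0 : fourierCoeff f 0 = 0) : IsAnalytic (shiftLp (-1) f) := fun k hk => by
  rw [fourierCoeff_shiftLp]
  rcases (show k - -1 ≤ 0 by omega).eq_or_lt with h | h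
  · rw [h, h0]
  · exact hf _ h

theorem mulZ_shiftLp_neg_one {ι : Type} [Fintype ι] (f : LV ι 2) :
    mulZ ι (shiftLp (-1) f) = f := by
  rw [mulZ_eq_shiftLp, shiftLp_shiftLp, show (1 : ℤ) + -1 = 0 by norm_num, shiftLp_zero]

theorem shiftLp_neg_one_mulZ {ι : Type} [Fintype ι] (f : LV ι 2) :
    shiftLp (-1) (mulZ ι f) = f := by
  rw [mulZ_eq_shiftLp, shiftLp_shiftLp, show (-1 : ℤ) + 1 = 0 by norm_num, shiftLp_zero]

/-- The kernel of `A_G^Θ` is nearly `S^*`-invariant. -/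
theorem shift_mem_kerIn_sup_defectSpace (hΘ : IsInner Θ) (hp : 2 < p) (hq : q⁻¹ = 2⁻¹ + p⁻¹)
    (hG : ∀ i j, MemLp (fun t => G t i j) p μT) (hA : IsMTTO Θ G A) {s : ℕ}
    {W : Fin s → LV (Fin n) 2 × LV (Fin n) q} (hW : IsValueBasis Θ G q W) {f : LV (Fin n) 2}
    (hf : f ∈ kerIn A) (h0 : atZero f = 0) :
    shiftLp (-1) f ∈ kerIn A ⊔ defectSpace W := by
  have h1 := (one_lt_of_inv_eq hp hq).le
  obtain ⟨f₂, hff⟩ := (mem_kerIn_iff_exists hΘ hp hq hG hA).1 hf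
  obtain ⟨c, hc⟩ := (Submodule.mem_span_range_iff_exists_fun ℂ).1 (hW.spans _ hff)
  -- w agrees with (f, f₂) at the origin in both components, so the difference may be divided by z
  -- inside the Toeplitz kernel. In particular the first component of w vanishes at 0, as f does,
  -- and w.1 / z is in the defect space.
  obtain ⟨w, hw⟩ : ∃ w : LV (Fin n) 2 × LV (Fin n) q, w = ∑ i, c i • W i := ⟨_, rfl⟩
  have hpair : pairAtZero w = pairAtZero (f, f₂) := by
    rw [← pairAtZeroₗ_apply h1, hw, map_sum, ← hc]
    exact Finset.sum_congr rfl fun i _ => by rw [map_smul, pairAtZeroₗ_apply]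
  have hwT : w ∈ kerTSubmodule hΘ h1 hq hG := by
    rw [hw]
    exact Submodule.sum_mem _ fun i _ =>
      Submodule.smul_mem _ _ (mem_kerTSubmodule.2 (hW.mem i))
  have hsub : (f, f₂) - w ∈ kerTSubmodule hΘ h1 hq hG :=
    Submodule.sub_mem _ (mem_kerTSubmodule.2 hff) hwT
  have hz : pairAtZero ((f, f₂) - w) = 0 := by
    rw [← pairAtZeroₗ_apply h1, map_sub, sub_eq_zero, pairAtZeroₗ_apply, pairAtZeroₗ_apply, hpair]
  have hmem := (mem_kerIn_iff_exists hΘ hp hq hG hA).2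
    ⟨_, shift_mem_kerT hΘ hq hG (mem_kerTSubmodule.1 hsub) hz⟩
  have hdec : shiftLp (-1) f = shiftLp (-1) ((f, f₂) - w).1 + shiftLp (-1) w.1 := by
    rw [← shiftLp_add, Prod.fst_sub, sub_add_cancel]
  rw [hdec]
  refine Submodule.add_mem_sup hmem ⟨?_, ?_⟩
  · rw [SetLike.mem_coe, Submodule.mem_comap, mulZ_shiftLp_neg_one, hw, Prod.fst_sum]
    exact Submodule.sum_mem _ fun i _ => Submodule.smul_mem _ _ (Submodule.subset_span ⟨i, rfl⟩)
  · have hwa : IsAnalytic w.1 := ((mem_kerT_iff hΘ hq hG).1 (mem_kerTSubmodule.1 hwT)).1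
    exact isAnalytic_shiftLp_neg_one hwa
      ((fourierCoeff_fst_eq_of_pairAtZero_eq hpair).trans h0)

theorem kerIn_sup_orthDefect (hΘ : IsInner Θ) (D : Submodule ℂ (LV (Fin n) 2)) :
    kerIn A ⊔ orthDefect (kerIn A) D = kerIn A ⊔ D := by
  have : CompleteSpace (kerIn A) := (isClosed_kerIn hΘ).completeSpace_coe
  rw [orthDefect, inf_comm]
  exact Submodule.sup_orthogonal_inf_of_hasOrthogonalProjection le_sup_left

/-- The quotient map by M is injective on a space orthogonal to M, and it sends M + D to the image
of D. -/
theorem rank_orthDefect_le (M D : Submodule ℂ (LV (Fin n) 2)) :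
    Module.rank ℂ (orthDefect M D) ≤ Module.rank ℂ D := by
  let L : orthDefect M D →ₗ[ℂ] LV (Fin n) 2 ⧸ M := M.mkQ.comp (orthDefect M D).subtype
  have hL : Function.Injective L := by
    rw [← LinearMap.ker_eq_bot, LinearMap.ker_eq_bot']
    rintro ⟨x, hx⟩ h
    have hxM : x ∈ M := by simpa [L] using h
    have := Submodule.inner_right_of_mem_orthogonal hxM hx.2
    exact Subtype.ext (inner_self_eq_zero.1 this)
  have hrange : LinearMap.range L ≤ D.map M.mkQ := by
    rintro _ ⟨⟨x, hx⟩, rfl⟩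
    obtain ⟨y, hy, z, hz, rfl⟩ := Submodule.mem_sup.1 hx.1
    refine ⟨z, hz, ?_⟩
    simp [L, hy]
  calc Module.rank ℂ (orthDefect M D) = Module.rank ℂ (LinearMap.range L) :=
        (rank_range_of_injective L hL).symm
    _ ≤ Module.rank ℂ (D.map M.mkQ) := Submodule.rank_mono hrange
    _ ≤ Module.rank ℂ D := rank_map_le _ _

/-- z times an element of the defect space is a combination ∑ c_i P_n W_i with ∑ c_i W_i(0) zero in
the first component (`V₁ c = 0`). By independence of the values W_i(0), such a c is determined by
the second component `V₂ c`, a vector of ℂ^n. -/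
theorem rank_defectSpace_le {s : ℕ} {W : Fin s → LV (Fin n) 2 × LV (Fin n) q}
    (hW : IsValueBasis Θ G q W) : Module.rank ℂ (defectSpace W) ≤ n := by
  let V₁ : (Fin s → ℂ) →ₗ[ℂ] EuclideanSpace ℂ (Fin n) :=
    Fintype.linearCombination ℂ fun i => atZero (W i).1
  let V₂ : (Fin s → ℂ) →ₗ[ℂ] EuclideanSpace ℂ (Fin n) :=
    Fintype.linearCombination ℂ fun i => atZero (W i).2
  let L : (Fin s → ℂ) →ₗ[ℂ] LV (Fin n) 2 := Fintype.linearCombination ℂ fun i => (W i).1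
  have hV₂ : Function.Injective (V₂.comp (LinearMap.ker V₁).subtype) := by
    rw [← LinearMap.ker_eq_bot, LinearMap.ker_eq_bot']
    rintro ⟨c, hc⟩ h
    have hli := Fintype.linearIndependent_iff.1 hW.linearIndependent c (by
      refine Prod.ext ?_ ?_
      · rw [Prod.fst_sum]
        exact hc
      · rw [Prod.snd_sum]
        exact h)
    exact Subtype.ext (funext hli)
  have hker : Module.rank ℂ (LinearMap.ker V₁) ≤ n := by
    calc Module.rank ℂ (LinearMap.ker V₁) ≤ Module.rank ℂ (EuclideanSpace ℂ (Fin n)) :=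
          LinearMap.rank_le_of_injective _ hV₂
      _ = n := by rw [rank_eq_card_basis (EuclideanSpace.basisFun (Fin n) ℂ).toBasis]; simp
  have hinj : Function.Injective ((mulZ (Fin n)).comp (defectSpace W).subtype) := by
    rintro ⟨x, _⟩ ⟨y, _⟩ h
    have h' : mulZ (Fin n) x = mulZ (Fin n) y := h
    have h'' := congrArg (shiftLp (-1)) h'
    rw [shiftLp_neg_one_mulZ, shiftLp_neg_one_mulZ] at h''
    exact Subtype.ext h''
  have hrange : LinearMap.range ((mulZ (Fin n)).comp (defectSpace W).subtype) ≤
      (LinearMap.ker V₁).map L := by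
    rintro _ ⟨⟨x, hx1, hx2⟩, rfl⟩
    obtain ⟨c, hc⟩ := (Submodule.mem_span_range_iff_exists_fun ℂ).1 hx1
    refine ⟨c, ?_, hc⟩
    change V₁ c = 0
    have h1 : fourierCoeff (mulZ (Fin n) x) 0 = 0 := by
      rw [mulZ_eq_shiftLp, fourierCoeff_shiftLp]
      exact hx2 _ (by norm_num)
    let ev : LV (Fin n) 2 →ₗ[ℂ] EuclideanSpace ℂ (Fin n) :=
      { toFun := fun f => fourierCoeff f 0
        map_add' := fun f g => fourierCoeff_lp_add _ _ _
        map_smul' := fun a f => fourierCoeff_lp_smul _ _ _ }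
    rw [← hc] at h1
    refine Eq.trans ?_ h1
    change ∑ i, c i • atZero (W i).1 = ev _
    rw [map_sum]
    exact Finset.sum_congr rfl fun i _ => (map_smul ev _ _).symm
  calc Module.rank ℂ (defectSpace W)
      = Module.rank ℂ (LinearMap.range ((mulZ (Fin n)).comp (defectSpace W).subtype)) :=
        (rank_range_of_injective _ hinj).symm
    _ ≤ Module.rank ℂ ((LinearMap.ker V₁).map L) := Submodule.rank_mono hrange
    _ ≤ Module.rank ℂ (LinearMap.ker V₁) := rank_map_le _ _
    _ ≤ n := hker

/-- Evaluation at 0 is injective there: an element vanishing at 0 is divisible by z, hence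
orthogonal to itself. -/
theorem finite_wandering {M : Submodule ℂ (LV (Fin n) 2)} (hM : M ≤ hardy (Fin n)) :
    Module.Finite ℂ (wandering M) := by
  let ev : wandering M →ₗ[ℂ] EuclideanSpace ℂ (Fin n) :=
    { toFun := fun f => fourierCoeff (f : LV (Fin n) 2) 0
      map_add' := fun f g => fourierCoeff_lp_add _ _ _
      map_smul' := fun a f => fourierCoeff_lp_smul _ _ _ }
  refine Module.Finite.of_injective ev ?_
  rw [← LinearMap.ker_eq_bot, LinearMap.ker_eq_bot']
  rintro ⟨x, hx1, hx2⟩ h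
  have h' : fourierCoeff x 0 = 0 := h
  have hx : x ∈ M ⊓ (hardy (Fin n)).map (mulZ (Fin n)) := by
    exact ⟨hx1, shiftLp (-1) x, isAnalytic_shiftLp_neg_one (hM hx1) h', mulZ_shiftLp_neg_one x⟩
  have := Submodule.inner_right_of_mem_orthogonal hx hx2
  exact Subtype.ext (inner_self_eq_zero.1 this)

end

/-! ### Operators with ‖f‖² = ‖C f‖² + ‖T f‖²: orbit estimate and isometry criterion. -/

section

section Contraction

open ContinuousLinearMap

theorem sum_norm_sq_iterate {H E : Type*} [NormedAddCommGroup H] [InnerProductSpace ℂ H]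
    [NormedAddCommGroup E] [InnerProductSpace ℂ E] {T : H →L[ℂ] H} {C : H →L[ℂ] E}
    (hn : ∀ f, ‖f‖ ^ 2 = ‖C f‖ ^ 2 + ‖T f‖ ^ 2)
    (f : H) (N : ℕ) :
    ∑ j ∈ Finset.range N, ‖C ((T^[j]) f)‖ ^ 2 = ‖f‖ ^ 2 - ‖(T^[N]) f‖ ^ 2 := by
  induction N with
  | zero => simp
  | succ N ih =>
    rw [Finset.sum_range_succ, ih, Function.iterate_succ_apply', hn ((T^[N]) f)]
    ring

variable {H E K : Type*} [NormedAddCommGroup H] [InnerProductSpace ℂ H] [CompleteSpace H]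
  [NormedAddCommGroup E] [InnerProductSpace ℂ E]
  [NormedAddCommGroup K] [InnerProductSpace ℂ K] [CompleteSpace K]
  {T : H →L[ℂ] H} {C : H →L[ℂ] E}

/-- After translation by a fixed vector a, the numbers ‖C(x_j - a)‖² telescope up to the constant
‖g‖² - ‖T^* g‖² per step. The translation costs 2‖C a‖² ≤ 2‖T^* g‖² per term. The bound is linear in
N and the same for all ζ on the circle. -/
theorem sum_norm_sq_orbit_le (hn : ∀ f, ‖f‖ ^ 2 = ‖C f‖ ^ 2 + ‖T f‖ ^ 2) {ζ : ℂ} (hζ : ‖ζ‖ = 1)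
    (g : H) (x : ℕ → H) (h0 : x 0 = 0)
    (hx : ∀ j, x (j + 1) = ζ • T (x j) + (g - T (adjoint T g))) (N : ℕ) :
    ∑ j ∈ Finset.range N, ‖C (x j)‖ ^ 2 ≤ 2 * N * ‖g‖ ^ 2 := by
  -- This choice gives ζ T(x_j - a) = x_{j+1} - g, because ζ T a = T T^* g.
  set a : H := (starRingEnd ℂ ζ) • adjoint T g with ha
  have hζ' : ζ * starRingEnd ℂ ζ = 1 := by
    rw [Complex.mul_conj, Complex.normSq_eq_norm_sq, hζ]; simp
  have hna : ‖a‖ = ‖adjoint T g‖ := by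
    rw [ha, norm_smul, RCLike.norm_conj, hζ, one_mul]
  have hstep : ∀ j, ‖C (x j - a)‖ ^ 2 =
      ‖x j‖ ^ 2 - ‖x (j + 1)‖ ^ 2 + ‖g‖ ^ 2 - ‖adjoint T g‖ ^ 2 := fun j => by
    have e1 : ζ • T (x j - a) = x (j + 1) - g := by
      rw [map_sub, ha, map_smul, smul_sub, smul_smul, hζ', one_smul, hx]
      abel
    have e2 : ‖T (x j - a)‖ = ‖x (j + 1) - g‖ := by
      rw [← e1, norm_smul, hζ, one_mul]
    have e3 := hn (x j - a)
    rw [e2, @norm_sub_sq ℂ, @norm_sub_sq ℂ] at e3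
    have e0 : (inner ℂ (T (adjoint T g)) g : ℂ) = (‖adjoint T g‖ : ℂ) ^ 2 := by
      rw [← adjoint_inner_right, inner_self_eq_norm_sq_to_K]
      rfl
    have e4 : (inner ℂ (x (j + 1)) g : ℂ) =
        inner ℂ (x j) a + ((‖g‖ : ℂ) ^ 2 - (‖adjoint T g‖ : ℂ) ^ 2) := by
      rw [hx, inner_add_left, inner_sub_left, inner_smul_left, ha, inner_smul_right,
        adjoint_inner_right, inner_self_eq_norm_sq_to_K, e0]
      rfl
    have e5 := congrArg Complex.re e4
    simp only [Complex.add_re, Complex.sub_re, ← Complex.ofReal_pow, Complex.ofReal_re] at e5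
    simp only [RCLike.re_to_complex] at e3
    rw [hna] at e3
    linarith
  have hsum : ∀ N : ℕ, ∑ j ∈ Finset.range N, ‖C (x j - a)‖ ^ 2 =
      N * (‖g‖ ^ 2 - ‖adjoint T g‖ ^ 2) - ‖x N‖ ^ 2 := fun N => by
    induction N with
    | zero => simp [h0]
    | succ N ih => rw [Finset.sum_range_succ, ih, hstep]; push_cast; ring
  have hpt : ∀ j, ‖C (x j)‖ ^ 2 ≤ 2 * ‖C (x j - a)‖ ^ 2 + 2 * ‖adjoint T g‖ ^ 2 := fun j => by
    have h1 : ‖C (x j)‖ ≤ ‖C (x j - a)‖ + ‖C a‖ := by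
      have := norm_add_le (C (x j - a)) (C a)
      rwa [← map_add, sub_add_cancel] at this
    have h2 := hn a
    rw [hna] at h2
    nlinarith [norm_nonneg (C (x j)), sq_nonneg (‖C (x j - a)‖ - ‖C a‖), sq_nonneg ‖T a‖,
      norm_nonneg (C (x j - a)), norm_nonneg (C a)]
  calc ∑ j ∈ Finset.range N, ‖C (x j)‖ ^ 2
      ≤ ∑ j ∈ Finset.range N, (2 * ‖C (x j - a)‖ ^ 2 + 2 * ‖adjoint T g‖ ^ 2) :=
        Finset.sum_le_sum fun j _ => hpt j
    _ = 2 * (N * (‖g‖ ^ 2 - ‖adjoint T g‖ ^ 2) - ‖x N‖ ^ 2) + N * (2 * ‖adjoint T g‖ ^ 2) := by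
        rw [Finset.sum_add_distrib, ← Finset.mul_sum, hsum]
        simp
    _ ≤ 2 * N * ‖g‖ ^ 2 := by nlinarith [sq_nonneg ‖x N‖]

/-- Let Q = I - J^* J. The two norm identities give T^* Q T = Q. As J is a contraction, Q kills
every vector whose norm J preserves, so Q T T^* = Q by `hd`. Together T^* Q = T^* Q T T^* = Q T^*,
and Q commutes with T by taking adjoints. Then T^* T Q = Q, so T preserves the norm on the range of
Q and C Q = 0. Hence C T^N Q = C Q T^N = 0 for all N, and `h0` yields Q = 0. -/
theorem norm_map_of_norm_map_defect (hn : ∀ f, ‖f‖ ^ 2 = ‖C f‖ ^ 2 + ‖T f‖ ^ 2) {J : H →L[ℂ] K}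
    (hJ : ∀ f, ‖J f‖ ^ 2 = ‖C f‖ ^ 2 + ‖J (T f)‖ ^ 2) (hle : ∀ f, ‖J f‖ ≤ ‖f‖)
    (h0 : ∀ f, (∀ N, C ((T^[N]) f) = 0) → f = 0)
    (hd : ∀ g, ‖J (g - T (adjoint T g))‖ = ‖g - T (adjoint T g)‖) (f : H) : ‖J f‖ = ‖f‖ := by
  set B : H →L[ℂ] H := adjoint J ∘L J with hB
  set Q : H →L[ℂ] H := ContinuousLinearMap.id ℂ H - B with hQ
  have hQa : ∀ f, Q f = f - adjoint J (J f) := fun f => rfl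
  have hform : ∀ f, (inner ℂ (Q f) f : ℂ) = ((‖f‖ ^ 2 - ‖J f‖ ^ 2 : ℝ) : ℂ) := fun f => by
    rw [hQa, inner_sub_left, adjoint_inner_left, inner_self_eq_norm_sq_to_K,
      inner_self_eq_norm_sq_to_K]
    push_cast
    rfl
  have hsym : ∀ f g, (inner ℂ (Q f) g : ℂ) = inner ℂ f (Q g) := fun f g => by
    rw [hQa, hQa, inner_sub_left, inner_sub_right, adjoint_inner_left, adjoint_inner_right]
  have hJa : ∀ y, ‖adjoint J y‖ ≤ ‖y‖ := fun y => by
    refine (le_opNorm _ _).trans ?_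
    rw [LinearIsometryEquiv.norm_map]
    exact mul_le_of_le_one_left (norm_nonneg _) (J.opNorm_le_bound zero_le_one fun f => by
      rw [one_mul]; exact hle f)
  have hker : ∀ h, ‖J h‖ = ‖h‖ → Q h = 0 := fun h hh => by
    have e1 : ‖Q h‖ ^ 2 = ‖h‖ ^ 2 - 2 * ‖J h‖ ^ 2 + ‖adjoint J (J h)‖ ^ 2 := by
      rw [hQa, @norm_sub_sq ℂ, adjoint_inner_right, inner_self_eq_norm_sq]
    have e2 : ‖adjoint J (J h)‖ ^ 2 ≤ ‖J h‖ ^ 2 := by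
      gcongr
      exact hJa _
    rw [← norm_eq_zero, ← sq_eq_zero_iff]
    rw [hh] at e1 e2
    nlinarith [sq_nonneg ‖Q h‖]
  have hQD : ∀ g, Q (T (adjoint T g)) = Q g := fun g => by
    have := hker _ (hd g)
    rw [map_sub, sub_eq_zero] at this
    exact this.symm
  have hTQT : ∀ f, adjoint T (Q (T f)) = Q f := fun f => by
    have : adjoint T ∘L Q ∘L T = Q := by
      refine ContinuousLinearMap.coe_injective ((ext_inner_map _ _).1 fun x => ?_)
      change inner ℂ (adjoint T (Q (T x))) x = inner ℂ (Q x) x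
      rw [adjoint_inner_left, hform, hform]
      congr 1
      linarith [hn x, hJ x]
    exact congrArg (fun S : H →L[ℂ] H => S f) this
  have hcomm' : ∀ f, adjoint T (Q f) = Q (adjoint T f) := fun f => by
    rw [← hQD f, hTQT]
  have hcomm : ∀ f, Q (T f) = T (Q f) := fun f => by
    refine ext_inner_right ℂ fun v => ?_
    rw [hsym, ← adjoint_inner_right, hcomm', ← hsym, adjoint_inner_right]
  have hcommN : ∀ N f, (T^[N]) (Q f) = Q ((T^[N]) f) := fun N => by
    induction N with
    | zero => intro f; rfl
    | succ N ih => intro f; rw [Function.iterate_succ_apply, ← hcomm, ih]; rfl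
  have hCQ : ∀ f, C (Q f) = 0 := fun f => by
    have e1 : ‖T (Q f)‖ ^ 2 = ‖Q f‖ ^ 2 := by
      have : (inner ℂ (T (Q f)) (T (Q f)) : ℂ) = inner ℂ (Q f) (Q f) := by
        rw [← adjoint_inner_left, ← hcomm, hTQT]
      rw [inner_self_eq_norm_sq_to_K, inner_self_eq_norm_sq_to_K] at this
      exact_mod_cast this
    have e2 := hn (Q f)
    rw [← norm_eq_zero, ← sq_eq_zero_iff]
    linarith
  have hQ0 : Q f = 0 := h0 _ fun N => by rw [hcommN, hCQ]
  have := hform f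
  rw [hQ0, inner_zero_left] at this
  have h3 : ‖f‖ ^ 2 - ‖J f‖ ^ 2 = 0 := by exact_mod_cast this.symm
  exact (sq_eq_sq₀ (norm_nonneg _) (norm_nonneg _)).1 (by linarith)

end Contraction

end

/-! ### Square summable power series and the symbol map. -/

section

section PowerSeries

variable {E : Type*} [NormedAddCommGroup E] [InnerProductSpace ℂ E]

theorem norm_sq_eq_integral (f : Lp E 2 μT) : ‖f‖ ^ 2 = ∫ t, ‖f t‖ ^ 2 ∂μT := by
  have h := congrArg Complex.re (L2.inner_def (𝕜 := ℂ) f f)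
  rw [inner_self_eq_norm_sq_to_K] at h
  have h2 : (∫ t, (inner ℂ (f t) (f t) : ℂ) ∂μT) = ((∫ t, ‖f t‖ ^ 2 ∂μT : ℝ) : ℂ) := by
    rw [← integral_complex_ofReal]
    congr 1
    ext t
    rw [inner_self_eq_norm_sq_to_K]
    push_cast
    rfl
  rw [h2, Complex.ofReal_re] at h
  rw [← h]
  exact (Complex.ofReal_re _).symm.trans (by push_cast; rfl)

/-- The polynomial `∑ j < N, z ^ j c_j`. -/
def partialSeries (c : ℕ → E) (N : ℕ) : Lp E 2 μT := ∑ j ∈ Finset.range N, mono (j : ℤ) (c j)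

theorem coeFn_partialSeries (c : ℕ → E) (N : ℕ) :
    partialSeries c N =ᵐ[μT] fun t => ∑ j ∈ Finset.range N, (fourier (j : ℤ) t : ℂ) • c j := by
  induction N with
  | zero => exact Eventually.of_forall fun t => by simp [partialSeries]
  | succ N ih =>
    have e : partialSeries c (N + 1) = partialSeries c N + mono (N : ℤ) (c N) :=
      Finset.sum_range_succ _ _
    rw [e]
    filter_upwards [ih, Lp.coeFn_add (partialSeries c N) (mono (N : ℤ) (c N)),
      coeFn_mono (N : ℤ) (c N)] with t h1 h2 h3
    rw [h2, Pi.add_apply, h1, h3, Finset.sum_range_succ]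

variable [CompleteSpace E]

theorem norm_fourierCoeff_le (f : Lp E 2 μT) (k : ℤ) : ‖fourierCoeff f k‖ ≤ ‖f‖ := by
  have h : ∀ c : E, ‖mono k c‖ = ‖c‖ := fun c => by
    have := inner_mono k c (mono k c)
    rw [fourierCoeff_mono, if_pos rfl, inner_self_eq_norm_sq_to_K, inner_self_eq_norm_sq_to_K]
      at this
    have h2 : ‖mono k c‖ ^ 2 = ‖c‖ ^ 2 := by exact_mod_cast this
    exact (sq_eq_sq₀ (norm_nonneg _) (norm_nonneg _)).1 h2
  have h1 := inner_mono k (fourierCoeff f k) f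
  rw [inner_self_eq_norm_sq_to_K] at h1
  have h2 := norm_inner_le_norm (𝕜 := ℂ) (mono k (fourierCoeff f k)) f
  rw [h1, h, norm_pow, RCLike.norm_ofReal, abs_norm, sq] at h2
  by_cases h0 : ‖fourierCoeff f k‖ = 0
  · rw [h0]; exact norm_nonneg _
  · exact le_of_mul_le_mul_left h2 (lt_of_le_of_ne (norm_nonneg _) (Ne.symm h0))

theorem continuous_fourierCoeff (k : ℤ) : Continuous fun f : Lp E 2 μT => fourierCoeff f k := by
  refine (LipschitzWith.of_dist_le_mul (K := 1) fun f g => ?_).continuous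
  rw [dist_eq_norm, dist_eq_norm, ← fourierCoeff_Lp_sub, NNReal.coe_one, one_mul]
  exact norm_fourierCoeff_le _ _

theorem inner_mono_mono (j k : ℤ) (c d : E) :
    inner ℂ (mono j c) (mono k d) = if j = k then inner ℂ c d else 0 := by
  rw [inner_mono, fourierCoeff_mono]
  split_ifs <;> simp

theorem norm_sq_sum_mono (c : ℕ → E) (s : Finset ℕ) :
    ‖∑ j ∈ s, mono (j : ℤ) (c j)‖ ^ 2 = ∑ j ∈ s, ‖c j‖ ^ 2 := by
  have h : (inner ℂ (∑ j ∈ s, mono (j : ℤ) (c j)) (∑ j ∈ s, mono (j : ℤ) (c j)) : ℂ) =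
      ∑ j ∈ s, (‖c j‖ : ℂ) ^ 2 := by
    rw [sum_inner]
    refine Finset.sum_congr rfl fun j hj => ?_
    rw [inner_sum, Finset.sum_eq_single j]
    · rw [inner_mono_mono, if_pos rfl, inner_self_eq_norm_sq_to_K]
      rfl
    · intro k _ hk
      rw [inner_mono_mono, if_neg]
      exact_mod_cast hk.symm
    · exact fun h => absurd hj h
  rw [inner_self_eq_norm_sq_to_K] at h
  refine Complex.ofReal_injective ?_
  push_cast
  exact h

theorem norm_sq_partialSeries (c : ℕ → E) (N : ℕ) :
    ‖partialSeries c N‖ ^ 2 = ∑ j ∈ Finset.range N, ‖c j‖ ^ 2 := norm_sq_sum_mono c _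

theorem fourierCoeff_partialSeries (c : ℕ → E) (N : ℕ) (k : ℤ) :
    fourierCoeff (partialSeries c N) k =
      ∑ j ∈ Finset.range N, if k = (j : ℤ) then c j else 0 := by
  induction N with
  | zero =>
    rw [fourierCoeff_congr (coeFn_partialSeries c 0)]
    simp [fourierCoeff]
  | succ N ih =>
    have e : partialSeries c (N + 1) = partialSeries c N + mono (N : ℤ) (c N) :=
      Finset.sum_range_succ _ _
    rw [e, fourierCoeff_congr (Lp.coeFn_add _ _),
      fourierCoeff_add' (integrable_Lp_two _) (integrable_Lp_two _), ih, fourierCoeff_mono,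
      Finset.sum_range_succ]

theorem exists_tendsto_partialSeries {c : ℕ → E} {B : ℝ}
    (h : ∀ N, ∑ j ∈ Finset.range N, ‖c j‖ ^ 2 ≤ B) :
    ∃ u : Lp E 2 μT, Tendsto (partialSeries c) atTop (𝓝 u) := by
  have hs : Summable fun j => ‖c j‖ ^ 2 :=
    summable_of_sum_range_le (fun j => sq_nonneg _) h
  have hs2 : Summable fun j : ℕ => (mono (j : ℤ) (c j) : Lp E 2 μT) := by
    rw [summable_iff_vanishing_norm]
    intro ε hε
    obtain ⟨s, hs⟩ := summable_iff_vanishing_norm.1 hs (ε ^ 2) (by positivity)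
    refine ⟨s, fun t ht => ?_⟩
    have := hs t ht
    rw [Real.norm_of_nonneg (Finset.sum_nonneg fun _ _ => sq_nonneg _), ← norm_sq_sum_mono] at this
    exact lt_of_pow_lt_pow_left₀ 2 hε.le this
  exact ⟨_, hs2.hasSum.tendsto_sum_nat⟩

variable {c : ℕ → E} {u : Lp E 2 μT}

theorem fourierCoeff_of_tendsto (h : Tendsto (partialSeries c) atTop (𝓝 u)) (k : ℕ) :
    fourierCoeff u k = c k := by
  refine tendsto_nhds_unique ((continuous_fourierCoeff (k : ℤ)).continuousAt.tendsto.comp h) ?_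
  refine tendsto_const_nhds.congr' ?_
  filter_upwards [eventually_gt_atTop k] with N hN
  rw [Function.comp_apply, fourierCoeff_partialSeries, Finset.sum_eq_single k]
  · rw [if_pos rfl]
  · intro j _ hj
    rw [if_neg]
    exact_mod_cast hj.symm
  · intro hk
    exact absurd (Finset.mem_range.2 hN) hk

theorem isAnalytic_of_tendsto_partialSeries (h : Tendsto (partialSeries c) atTop (𝓝 u)) : IsAnalytic u := by
  intro k hk
  refine tendsto_nhds_unique ((continuous_fourierCoeff k).continuousAt.tendsto.comp h) ?_
  refine tendsto_const_nhds.congr fun N => ?_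
  rw [Function.comp_apply, fourierCoeff_partialSeries]
  exact (Finset.sum_eq_zero fun j _ => if_neg (by omega)).symm

theorem tendsto_sum_norm_sq (h : Tendsto (partialSeries c) atTop (𝓝 u)) :
    Tendsto (fun N => ∑ j ∈ Finset.range N, ‖c j‖ ^ 2) atTop (𝓝 (‖u‖ ^ 2)) :=
  (h.norm.pow 2).congr fun N => norm_sq_partialSeries c N

theorem sum_norm_sq_le_of_tendsto (h : Tendsto (partialSeries c) atTop (𝓝 u)) (N : ℕ) :
    ∑ j ∈ Finset.range N, ‖c j‖ ^ 2 ≤ ‖u‖ ^ 2 :=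
  (monotone_nat_of_le_succ fun N => by
    rw [Finset.sum_range_succ]; exact le_add_of_nonneg_right (sq_nonneg _)).ge_of_tendsto
    (tendsto_sum_norm_sq h) N

theorem Lp_ext_of_analytic {f g : Lp E 2 μT} (hf : IsAnalytic f) (hg : IsAnalytic g)
    (h : ∀ k : ℕ, fourierCoeff f k = fourierCoeff g k) : f = g := by
  rw [← sub_eq_zero]
  refine Lp_eq_zero_of_fourierCoeff fun k => ?_
  rw [fourierCoeff_Lp_sub]
  rcases lt_or_ge k 0 with hk | hk
  · rw [hf k hk, hg k hk, sub_zero]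
  · lift k to ℕ using hk
    rw [h, sub_self]

end PowerSeries

section Symbol

variable {H E : Type*} [NormedAddCommGroup H] [InnerProductSpace ℂ H]
  [NormedAddCommGroup E] [InnerProductSpace ℂ E] [CompleteSpace E]
  {T : H →L[ℂ] H} {C : H →L[ℂ] E}

/-- The map `f ↦ ∑ j, z ^ j C (T ^ j f)`. -/
theorem exists_symbolMap (hn : ∀ f, ‖f‖ ^ 2 = ‖C f‖ ^ 2 + ‖T f‖ ^ 2) :
    ∃ J : H →L[ℂ] Lp E 2 μT, (∀ f, ‖J f‖ ≤ ‖f‖) ∧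
      ∀ f, Tendsto (partialSeries fun j => C ((T^[j]) f)) atTop (𝓝 (J f)) := by
  have hex : ∀ f : H, ∃ u : Lp E 2 μT,
      Tendsto (partialSeries fun j => C ((T^[j]) f)) atTop (𝓝 u) := fun f =>
    exists_tendsto_partialSeries (B := ‖f‖ ^ 2) fun N => by
      rw [sum_norm_sq_iterate hn]
      linarith [sq_nonneg ‖(T^[N]) f‖]
  choose u hu using hex
  have hpow : ∀ (j : ℕ) (f : H), (T^[j]) f = (T ^ j) f := fun j f => by
    rw [FunLike.coe_pow_eq_iterate]
  have hle : ∀ f, ‖u f‖ ≤ 1 * ‖f‖ := fun f => by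
    rw [one_mul]
    refine le_of_sq_le_sq ?_ (norm_nonneg _)
    refine le_of_tendsto (tendsto_sum_norm_sq (hu f)) (Eventually.of_forall fun N => ?_)
    rw [sum_norm_sq_iterate hn]
    linarith [sq_nonneg ‖(T^[N]) f‖]
  let L : H →ₗ[ℂ] Lp E 2 μT :=
    { toFun := u
      map_add' := fun f g => by
        refine Lp_ext_of_analytic (isAnalytic_of_tendsto_partialSeries (hu _))
          ((analyticL2 E).add_mem (isAnalytic_of_tendsto_partialSeries (hu f)) (isAnalytic_of_tendsto_partialSeries (hu g)))
          fun k => ?_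
        rw [fourierCoeff_congr (Lp.coeFn_add (u f) (u g)),
          fourierCoeff_add' (integrable_Lp_two _) (integrable_Lp_two _),
          fourierCoeff_of_tendsto (hu _), fourierCoeff_of_tendsto (hu _),
          fourierCoeff_of_tendsto (hu _), hpow, hpow, hpow, map_add, map_add]
      map_smul' := fun a f => by
        refine Lp_ext_of_analytic (isAnalytic_of_tendsto_partialSeries (hu _))
          ((analyticL2 E).smul_mem a (isAnalytic_of_tendsto_partialSeries (hu f))) fun k => ?_
        rw [RingHom.id_apply, fourierCoeff_congr (Lp.coeFn_smul a (u f)), fourierCoeff.const_smul,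
          fourierCoeff_of_tendsto (hu _), fourierCoeff_of_tendsto (hu _), hpow, hpow, map_smul,
          map_smul] }
  exact ⟨L.mkContinuous 1 hle, fun f => (hle f).trans_eq (one_mul _), hu⟩

theorem norm_sq_symbolMap {J : H →L[ℂ] Lp E 2 μT}
    (hJ : ∀ f, Tendsto (partialSeries fun j => C ((T^[j]) f)) atTop (𝓝 (J f))) (f : H) :
    ‖J f‖ ^ 2 = ‖C f‖ ^ 2 + ‖J (T f)‖ ^ 2 := by
  have h1 := (tendsto_sum_norm_sq (hJ f)).comp (tendsto_add_atTop_nat 1)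
  refine tendsto_nhds_unique h1 ?_
  refine ((tendsto_sum_norm_sq (hJ (T f))).const_add (‖C f‖ ^ 2)).congr fun N => ?_
  rw [Function.comp_apply, Finset.sum_range_succ', add_comm]
  rfl

end Symbol

end

/-! ### Pointwise synthesis f = ψ · J f. -/

section

section Synthesis

variable {n : ℕ} {ι : Type} [Fintype ι] (ψ : ι → LV (Fin n) 2)

/-- The pointwise linear combination `∑ i, w i ψ_i(t)`. -/
def synth (t : Circ) (w : EuclideanSpace ℂ ι) : EuclideanSpace ℂ (Fin n) := ∑ i, w i • ψ i t

/-- The function `t ↦ ∑ i, ‖ψ_i(t)‖`. -/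
def normSum (t : Circ) : ℝ := ∑ i, ‖ψ i t‖

theorem synth_add (t : Circ) (v w : EuclideanSpace ℂ ι) :
    synth ψ t (v + w) = synth ψ t v + synth ψ t w := by
  simp [synth, add_smul, Finset.sum_add_distrib]

theorem synth_sub (t : Circ) (v w : EuclideanSpace ℂ ι) :
    synth ψ t (v - w) = synth ψ t v - synth ψ t w := by
  simp [synth, sub_smul, Finset.sum_sub_distrib]

theorem synth_smul (t : Circ) (c : ℂ) (w : EuclideanSpace ℂ ι) :
    synth ψ t (c • w) = c • synth ψ t w := by
  simp [synth, Finset.smul_sum, mul_smul]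

theorem norm_synth_le (t : Circ) (w : EuclideanSpace ℂ ι) :
    ‖synth ψ t w‖ ≤ normSum ψ t * ‖w‖ := by
  rw [normSum, Finset.sum_mul]
  refine (norm_sum_le _ _).trans (Finset.sum_le_sum fun i _ => ?_)
  rw [norm_smul, mul_comm]
  gcongr
  exact PiLp.norm_apply_le w i

theorem normSum_nonneg (t : Circ) : 0 ≤ normSum ψ t := Finset.sum_nonneg fun _ _ => norm_nonneg _

theorem memLp_normSum : MemLp (normSum ψ) 2 μT :=
  memLp_finsetSum (f := fun i t => ‖ψ i t‖) _ fun i _ => (Lp.memLp (ψ i)).norm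

theorem measurable_normSum : Measurable (normSum ψ) :=
  Finset.measurable_fun_sum _ fun i _ => (Lp.stronglyMeasurable (ψ i)).norm.measurable

theorem aestronglyMeasurable_synth {u : Circ → EuclideanSpace ℂ ι}
    (hu : AEStronglyMeasurable u μT) : AEStronglyMeasurable (fun t => synth ψ t (u t)) μT := by
  have h : ∀ i, AEStronglyMeasurable (fun t => u t i • ψ i t) μT := fun i => by
    have h1 : AEStronglyMeasurable (fun t => u t i) μT :=
      (EuclideanSpace.proj i :
        EuclideanSpace ℂ ι →L[ℂ] ℂ).continuous.comp_aestronglyMeasurable hu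
    exact h1.smul (Lp.aestronglyMeasurable (ψ i))
  exact Finset.aestronglyMeasurable_fun_sum _ fun i _ => h i

theorem eLpNorm_synth_le {u : Circ → EuclideanSpace ℂ ι} (hu : AEStronglyMeasurable u μT) :
    eLpNorm (fun t => synth ψ t (u t)) 1 μT ≤ eLpNorm (normSum ψ) 2 μT * eLpNorm u 2 μT := by
  refine le_trans (eLpNorm_mono_ae (g := normSum ψ • u) (Eventually.of_forall fun t => ?_))
    (eLpNorm_smul_le_mul_eLpNorm hu (measurable_normSum ψ).aestronglyMeasurable)
  rw [Pi.smul_apply', norm_smul, Real.norm_of_nonneg (normSum_nonneg ψ t)]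
  exact norm_synth_le ψ t (u t)

theorem memLp_synth {u : Circ → EuclideanSpace ℂ ι} (hu : MemLp u 2 μT) :
    MemLp (fun t => synth ψ t (u t)) 1 μT :=
  ⟨aestronglyMeasurable_synth ψ hu.1, (eLpNorm_synth_le ψ hu.1).trans_lt
    (ENNReal.mul_lt_top (memLp_normSum ψ).2 hu.2)⟩

variable {ψ} {M : Submodule ℂ (LV (Fin n) 2)} {T : M →L[ℂ] M} {C : M →L[ℂ] EuclideanSpace ℂ ι}

theorem ae_eq_synth_partialSeries_add
    (hd : ∀ f : M, (f : LV (Fin n) 2) =ᵐ[μT] fun t =>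
      synth ψ t (C f) + (fourier 1 t : ℂ) • (T f : LV (Fin n) 2) t) (f : M) (N : ℕ) :
    (f : LV (Fin n) 2) =ᵐ[μT] fun t =>
      synth ψ t (∑ j ∈ Finset.range N, (fourier (j : ℤ) t : ℂ) • C ((T^[j]) f)) +
        (fourier (N : ℤ) t : ℂ) • ((T^[N]) f : LV (Fin n) 2) t := by
  induction N with
  | zero => exact Eventually.of_forall fun t => by simp [synth]
  | succ N ih =>
    filter_upwards [ih, hd ((T^[N]) f)] with t h1 h2
    rw [h1, h2, Finset.sum_range_succ, synth_add, synth_smul, Function.iterate_succ_apply',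
      smul_add, smul_smul, ← fourier_add, add_assoc]
    push_cast
    rfl

/-- The products ψ s_N = f - z^N T^N f converge to ψ u in L¹, as ψ and u are square integrable.
Fourier coefficients pass to the limit and identify the two functions, with no information on the
size of T^N f. -/
theorem ae_eq_synth_symbolMap (hM : M ≤ hardy (Fin n))
    (hd : ∀ f : M, (f : LV (Fin n) 2) =ᵐ[μT] fun t =>
      synth ψ t (C f) + (fourier 1 t : ℂ) • (T f : LV (Fin n) 2) t) (f : M) {u : LV ι 2}
    (hu : Tendsto (partialSeries fun j => C ((T^[j]) f)) atTop (𝓝 u)) :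
    (f : LV (Fin n) 2) =ᵐ[μT] fun t => synth ψ t (u t) := by
  set S : ℕ → LV ι 2 := partialSeries fun j => C ((T^[j]) f) with hS
  have hf1 : ∀ N, (fun t => synth ψ t (S N t)) =ᵐ[μT]
      ((f : LV (Fin n) 2) : Circ → EuclideanSpace ℂ (Fin n)) -
        (shiftLp (N : ℤ) ((T^[N]) f : LV (Fin n) 2) : LV (Fin n) 2) := fun N => by
    filter_upwards [ae_eq_synth_partialSeries_add hd f N,
      coeFn_partialSeries (fun j => C ((T^[j]) f)) N,
      coeFn_shiftLp (N : ℤ) ((T^[N]) f : LV (Fin n) 2)] with t h1 h2 h3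
    rw [Pi.sub_apply, h1, h3, hS, h2]
    abel
  have hlim : Tendsto (fun N => eLpNorm ((fun t => synth ψ t (S N t)) - fun t => synth ψ t (u t))
      1 μT) atTop (𝓝 0) := by
    have h1 := (Lp.tendsto_Lp_iff_tendsto_eLpNorm' _ _).1 hu
    have h2 := ENNReal.Tendsto.const_mul (a := eLpNorm (normSum ψ) 2 μT) h1
      (Or.inr (memLp_normSum ψ).2.ne)
    rw [mul_zero] at h2
    refine tendsto_of_tendsto_of_tendsto_of_le_of_le tendsto_const_nhds h2 (fun _ => bot_le)
      fun N => ?_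
    refine le_trans (le_of_eq ?_) (eLpNorm_synth_le ψ
      ((Lp.aestronglyMeasurable (S N)).sub (Lp.aestronglyMeasurable u)))
    congr 1
    ext1 t
    rw [Pi.sub_apply, Pi.sub_apply, synth_sub]
  refine ae_eq_of_fourierCoeff_eq (integrable_Lp_two _)
    ((memLp_synth ψ (Lp.memLp u)).integrable le_rfl) fun k => ?_
  refine tendsto_nhds_unique (tendsto_const_nhds.congr' ?_)
    (tendsto_fourierCoeff le_rfl (fun N => memLp_synth ψ (Lp.memLp (S N)))
      (memLp_synth ψ (Lp.memLp u)) hlim k)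
  -- T^N f is analytic, so the remainder z^N T^N f has no coefficient at k once N > k.
  filter_upwards [eventually_gt_atTop k.toNat] with N hN
  rw [fourierCoeff_congr (hf1 N), fourierCoeff_sub' (integrable_Lp_two _) (integrable_Lp_two _),
    fourierCoeff_shiftLp, hM ((T^[N]) f).2 (k - N) (by omega), sub_zero]

/-- `normSum ψ` is finite at every point, so the sets decrease to the empty set. -/
theorem tendsto_setIntegral_normSum {g : Circ → ℝ} (hg : Integrable g μT) :
    Tendsto (fun K : ℕ => ∫ t in {t | (K : ℝ) < normSum ψ t}, g t ∂μT) atTop (𝓝 0) := by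
  have hms : ∀ K : ℕ, MeasurableSet {t | (K : ℝ) < normSum ψ t} := fun K =>
    measurableSet_lt measurable_const (measurable_normSum ψ)
  have h := tendsto_setIntegral_of_antitone (f := g) (μ := μT)
    (s := fun K : ℕ => {t | (K : ℝ) < normSum ψ t}) hms
    (fun a b hab t ht => lt_of_le_of_lt (by exact_mod_cast hab) (show (b : ℝ) < _ from ht))
    ⟨0, hg.integrableOn⟩
  have h0 : ⋂ K : ℕ, {t | (K : ℝ) < normSum ψ t} = ∅ := by
    refine Set.eq_empty_of_forall_notMem fun t ht => ?_
    obtain ⟨K, hK⟩ := exists_nat_gt (normSum ψ t)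
    exact absurd (Set.mem_iInter.1 ht K) (not_lt.2 hK.le)
  rwa [h0, setIntegral_empty] at h

end Synthesis

end

/-! ### The symbol map is isometric. -/

section

/-- The orbit estimate at ζ = z for the sums ∑_{j<N} z^j T^j f with f = g - T T^* g. It holds at
each point t with a bound that does not depend on t. -/
theorem sum_norm_sq_partialSeries_defect_le {H E : Type*} [NormedAddCommGroup H]
    [InnerProductSpace ℂ H] [CompleteSpace H] [NormedAddCommGroup E] [InnerProductSpace ℂ E]
    {T : H →L[ℂ] H} {C : H →L[ℂ] E} (hn : ∀ f, ‖f‖ ^ 2 = ‖C f‖ ^ 2 + ‖T f‖ ^ 2) (g : H)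
    (t : Circ) (m : ℕ) :
    ∑ N ∈ Finset.range m, ‖∑ j ∈ Finset.range N, (fourier (j : ℤ) t : ℂ) •
      C ((T^[j]) (g - T (ContinuousLinearMap.adjoint T g)))‖ ^ 2 ≤ 2 * m * ‖g‖ ^ 2 := by
  set f := g - T (ContinuousLinearMap.adjoint T g)
  have h := sum_norm_sq_orbit_le hn (norm_fourier_eq_one 1 t) g
    (fun N => ∑ j ∈ Finset.range N, (fourier (j : ℤ) t : ℂ) • (T^[j]) f) (by simp) (fun N => by
      rw [Finset.sum_range_succ', map_sum, Finset.smul_sum]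
      congr 1
      · refine Finset.sum_congr rfl fun j _ => ?_
        rw [map_smul, smul_smul, ← fourier_add, Function.iterate_succ_apply', add_comm]
        push_cast
        rfl
      · simp [f]) m
  simpa only [map_sum, map_smul] using h

variable {n : ℕ} {ι : Type} [Fintype ι] {ψ : ι → LV (Fin n) 2} {M : Submodule ℂ (LV (Fin n) 2)}
  {T : M →L[ℂ] M} {C : M →L[ℂ] EuclideanSpace ℂ ι}

/-- For every N the deficit ‖f‖² - ‖u‖² is at most ‖T^N f‖², the squared norm of f - ψ s_N. Where R
≤ K, f = ψ u bounds this by K‖s_N - u‖, which tends to zero in L². Where R > K, s_N is controlled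
only on average over N, by a constant independent of the point. Averaging over N < m, then m → ∞,
then K → ∞ shows that the deficit is not positive. -/
theorem norm_symbol_eq_of_defect [CompleteSpace M] (hn : ∀ f, ‖f‖ ^ 2 = ‖C f‖ ^ 2 + ‖T f‖ ^ 2)
    (hd : ∀ f : M, (f : LV (Fin n) 2) =ᵐ[μT] fun t =>
      synth ψ t (C f) + (fourier 1 t : ℂ) • (T f : LV (Fin n) 2) t) {f g : M}
    (hfg : f = g - T (ContinuousLinearMap.adjoint T g)) {u : LV ι 2}
    (hu : Tendsto (partialSeries fun j => C ((T^[j]) f)) atTop (𝓝 u))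
    (hid : (f : LV (Fin n) 2) =ᵐ[μT] fun t => synth ψ t (u t)) (hle : ‖u‖ ≤ ‖f‖) :
    ‖u‖ = ‖f‖ := by
  set s : ℕ → Circ → EuclideanSpace ℂ ι := fun N t =>
    ∑ j ∈ Finset.range N, (fourier (j : ℤ) t : ℂ) • C ((T^[j]) f) with hs
  set S : ℕ → LV ι 2 := partialSeries fun j => C ((T^[j]) f) with hS
  set R := normSum ψ with hR
  have hRm : Measurable R := measurable_normSum ψ
  have hR2 : Integrable (fun t => R t ^ 2) μT := (memLp_normSum ψ).integrable_sq
  have hF2 : Integrable (fun t => ‖(f : LV (Fin n) 2) t‖ ^ 2) μT :=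
    (Lp.memLp (f : LV (Fin n) 2)).integrable_norm_pow two_ne_zero
  have hms : ∀ K : ℕ, MeasurableSet {t | (K : ℝ) < R t} := fun K =>
    measurableSet_lt measurable_const hRm
  have hscont : ∀ N, Continuous (s N) := fun N => by
    refine continuous_finsetSum _ fun j _ => ?_
    exact (map_continuous (fourier (j : ℤ))).smul continuous_const
  have hsb : ∀ N, ∃ B, ∀ t, ‖s N t‖ ^ 2 ≤ B := fun N => by
    obtain ⟨B, hB⟩ := isCompact_univ.exists_bound_of_continuousOn
      (((hscont N).norm.pow 2).continuousOn (s := Set.univ))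
    exact ⟨B, fun t => (le_abs_self _).trans (hB t (Set.mem_univ t))⟩
  have hRs : ∀ N, Integrable (fun t => R t ^ 2 * ‖s N t‖ ^ 2) μT := fun N => by
    obtain ⟨B, hB⟩ := hsb N
    exact hR2.mul_bdd (c := B) ((hscont N).norm.pow 2).aestronglyMeasurable
      (Eventually.of_forall fun t => by
        rw [Real.norm_of_nonneg (sq_nonneg _)]; exact hB t)
  have hpart : ∀ N, ‖(f : LV (Fin n) 2)‖ ^ 2 - ‖u‖ ^ 2 ≤ ‖((T^[N]) f : LV (Fin n) 2)‖ ^ 2 :=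
    fun N => by
      have h1 := sum_norm_sq_iterate hn f N
      have h2 := sum_norm_sq_le_of_tendsto hu N
      simp only [Submodule.coe_norm] at h1 ⊢
      linarith
  have hint2 : ∀ N, Integrable (fun t => 2 * ‖(f : LV (Fin n) 2) t‖ ^ 2 +
      2 * (R t ^ 2 * ‖s N t‖ ^ 2)) μT := fun N => (hF2.const_mul 2).add ((hRs N).const_mul 2)
  -- the estimate for a fixed index
  have hest : ∀ K N : ℕ, ‖(f : LV (Fin n) 2)‖ ^ 2 - ‖u‖ ^ 2 ≤ (K : ℝ) ^ 2 * ‖S N - u‖ ^ 2 +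
      ∫ t in {t | (K : ℝ) < R t}, (2 * ‖(f : LV (Fin n) 2) t‖ ^ 2 +
        2 * (R t ^ 2 * ‖s N t‖ ^ 2)) ∂μT := fun K N => by
    have hint1 : Integrable (fun t => (K : ℝ) ^ 2 * ‖(S N - u : LV ι 2) t‖ ^ 2) μT :=
      ((Lp.memLp (S N - u)).integrable_norm_pow two_ne_zero).const_mul _
    refine (hpart N).trans ?_
    rw [norm_sq_eq_integral, norm_sq_eq_integral (S N - u), ← integral_const_mul,
      ← integral_indicator (hms K), ← integral_add hint1 ((hint2 N).indicator (hms K))]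
    refine integral_mono_ae ((Lp.memLp _).integrable_norm_pow two_ne_zero)
      (hint1.add ((hint2 N).indicator (hms K))) ?_
    filter_upwards [ae_eq_synth_partialSeries_add hd f N,
      coeFn_partialSeries (fun j => C ((T^[j]) f)) N, Lp.coeFn_sub (S N) u, hid] with t h1 h2 h3 h4
    have h5 : ‖((T^[N]) f : LV (Fin n) 2) t‖ = ‖(f : LV (Fin n) 2) t - synth ψ t (s N t)‖ := by
      rw [h1, add_sub_cancel_left, norm_smul, norm_fourier_eq_one, one_mul]
    have h6 : (S N - u : LV ι 2) t = s N t - u t := by rw [h3, Pi.sub_apply, hS, h2]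
    simp only [h5, h6]
    have hR0 : 0 ≤ R t := normSum_nonneg ψ t
    -- Where R is large the crude bound (a + b)² ≤ 2a² + 2b² is used; elsewhere f = ψ u turns the
    -- remainder into ψ (u - s_N).
    by_cases ht : (K : ℝ) < R t
    · rw [Set.indicator_of_mem (show t ∈ {t | (K : ℝ) < R t} from ht)]
      have e1 := norm_sub_le ((f : LV (Fin n) 2) t) (synth ψ t (s N t))
      have e2 := norm_synth_le ψ t (s N t)
      have e3 : ‖(f : LV (Fin n) 2) t - synth ψ t (s N t)‖ ^ 2 ≤
          (‖(f : LV (Fin n) 2) t‖ + R t * ‖s N t‖) ^ 2 := by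
        gcongr
        exact e1.trans (by gcongr)
      nlinarith [sq_nonneg (‖(f : LV (Fin n) 2) t‖ - R t * ‖s N t‖), mul_nonneg
        (sq_nonneg (K : ℝ)) (sq_nonneg ‖s N t - u t‖)]
    · rw [Set.indicator_of_notMem (show t ∉ {t | (K : ℝ) < R t} from ht), add_zero, ← mul_pow]
      gcongr
      rw [h4, ← synth_sub, norm_sub_rev]
      exact (norm_synth_le ψ t _).trans (by gcongr; exact not_lt.1 ht)
  -- the averaged estimate
  have havg : ∀ K m : ℕ, m * (‖(f : LV (Fin n) 2)‖ ^ 2 - ‖u‖ ^ 2) ≤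
      (K : ℝ) ^ 2 * ∑ N ∈ Finset.range m, ‖S N - u‖ ^ 2 +
        m * ∫ t in {t | (K : ℝ) < R t}, (2 * ‖(f : LV (Fin n) 2) t‖ ^ 2 +
          4 * ‖g‖ ^ 2 * R t ^ 2) ∂μT := fun K m => by
    have h1 := Finset.sum_le_sum fun N (_ : N ∈ Finset.range m) => hest K N
    rw [Finset.sum_const, Finset.card_range, nsmul_eq_mul, Finset.sum_add_distrib,
      ← Finset.mul_sum, ← integral_finsetSum _ fun N _ =>
        (hint2 N).integrableOn] at h1
    refine h1.trans ?_
    rw [← integral_const_mul]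
    gcongr 1
    refine setIntegral_mono (integrable_finsetSum _ fun N _ =>
        (hint2 N).integrableOn)
      (((hF2.const_mul 2).add (hR2.const_mul _)).const_mul _).integrableOn fun t => ?_
    have h2 := sum_norm_sq_partialSeries_defect_le hn g t m
    rw [← hfg] at h2
    simp only [Finset.sum_add_distrib, Finset.sum_const, Finset.card_range, nsmul_eq_mul,
      ← Finset.mul_sum]
    have h3 := mul_le_mul_of_nonneg_left h2 (sq_nonneg (R t))
    nlinarith [h3]
  have hces : Tendsto (fun m : ℕ => (m : ℝ)⁻¹ * ∑ N ∈ Finset.range m, ‖S N - u‖ ^ 2) atTop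
      (𝓝 0) := by
    have h1 : Tendsto (fun N => ‖S N - u‖ ^ 2) atTop (𝓝 0) := by
      have := ((tendsto_sub_nhds_zero_iff.2 hu).norm.pow 2)
      simpa using this
    exact h1.cesaro
  -- After division by m the first term is K² times a Cesàro mean of a null sequence, while the
  -- second does not depend on m.
  have hK : ∀ K : ℕ, ‖(f : LV (Fin n) 2)‖ ^ 2 - ‖u‖ ^ 2 ≤
      ∫ t in {t | (K : ℝ) < R t}, (2 * ‖(f : LV (Fin n) 2) t‖ ^ 2 +
          4 * ‖g‖ ^ 2 * R t ^ 2) ∂μT := fun K => by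
    have h1 := (hces.const_mul ((K : ℝ) ^ 2)).add_const
      (∫ t in {t | (K : ℝ) < R t}, (2 * ‖(f : LV (Fin n) 2) t‖ ^ 2 +
          4 * ‖g‖ ^ 2 * R t ^ 2) ∂μT)
    rw [mul_zero, zero_add] at h1
    refine ge_of_tendsto h1 ?_
    filter_upwards [eventually_gt_atTop 0] with m hm
    have hm' : (0 : ℝ) < m := by exact_mod_cast hm
    have h2 := mul_le_mul_of_nonneg_left (havg K m) (inv_nonneg.2 hm'.le)
    rw [mul_add, inv_mul_cancel_left₀ hm'.ne', inv_mul_cancel_left₀ hm'.ne'] at h2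
    linarith [mul_left_comm ((m : ℝ)⁻¹) ((K : ℝ) ^ 2) (∑ N ∈ Finset.range m, ‖S N - u‖ ^ 2)]
  have hfin := ge_of_tendsto (tendsto_setIntegral_normSum (ψ := ψ)
    ((hF2.const_mul 2).add (hR2.const_mul (4 * ‖g‖ ^ 2)))) (Eventually.of_forall hK)
  refine le_antisymm hle (le_of_sq_le_sq ?_ (norm_nonneg _))
  rw [Submodule.coe_norm]
  linarith

theorem norm_sq_eq_sum_coord (k : LV ι 2) : ‖k‖ ^ 2 = ∑ i, ‖coord i k‖ ^ 2 := by
  rw [norm_sq_eq_integral]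
  simp_rw [norm_sq_eq_integral (coord _ k)]
  rw [← integral_finsetSum _ fun i _ => (Lp.memLp (coord i k)).integrable_norm_pow two_ne_zero]
  refine integral_congr_ae ?_
  filter_upwards [ae_all_iff.2 fun i => coeFn_coord k i] with t ht
  simp only [ht]
  exact EuclideanSpace.norm_sq_eq _

theorem fourierCoeff_backwardShift (f : LV ι 2) (k : ℤ) :
    fourierCoeff (backwardShift f) k = if k + 1 = 0 then 0 else fourierCoeff f (k + 1) := by
  have h := fourierCoeff_const_smul_fourier (atZero f) 0 (k + 1)
  simp only [fourier_zero, one_smul] at h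
  rw [backwardShift, fourierCoeff_congr (MemLp.coeFn_toLp _), fourierCoeff_fourier_smul,
    sub_neg_eq_add]
  refine (fourierCoeff_sub' (integrable_Lp_two f) (integrable_const _) (k + 1)).trans ?_
  rw [h]
  split_ifs with h1
  · rw [h1]; exact sub_self _
  · exact sub_zero _

/-- A nearly invariant decomposition gives an isometric representation by an `S^*`-invariant
subspace of a vector valued Hardy space. -/
theorem exists_isIsometricImage (hMc : IsClosed (M : Set (LV (Fin n) 2))) (hM : M ≤ hardy (Fin n))
    (hn : ∀ f, ‖f‖ ^ 2 = ‖C f‖ ^ 2 + ‖T f‖ ^ 2)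
    (hd : ∀ f : M, (f : LV (Fin n) 2) =ᵐ[μT] fun t =>
      synth ψ t (C f) + (fourier 1 t : ℂ) • (T f : LV (Fin n) 2) t) :
    ∃ K : Submodule ℂ (LV ι 2), IsClosedInvariant K ∧
      IsIsometricImage M K fun k t => synth ψ t (k t) := by
  have : CompleteSpace M := hMc.completeSpace_coe
  obtain ⟨J, hle, hJ⟩ := exists_symbolMap hn
  have hid : ∀ f : M, (f : LV (Fin n) 2) =ᵐ[μT] fun t => synth ψ t (J f t) := fun f =>
    ae_eq_synth_symbolMap hM hd f (hJ f)
  have hiso : ∀ f, ‖J f‖ = ‖f‖ := by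
    refine norm_map_of_norm_map_defect hn (norm_sq_symbolMap hJ) hle (fun f hf => ?_) fun g =>
      norm_symbol_eq_of_defect hn hd rfl (hJ _) (hid _) (hle _)
    -- If C T^N f = 0 for all N, the series J f vanishes, and so does f = ψ · J f.
    have h0 : J f = 0 := by
      refine tendsto_nhds_unique (hJ f) ?_
      simp only [hf]
      refine tendsto_const_nhds.congr fun N => ?_
      rw [eq_comm, ← norm_eq_zero, ← sq_eq_zero_iff, norm_sq_partialSeries]
      simp
    refine Subtype.ext (Lp.ext ?_)
    filter_upwards [hid f, Lp.coeFn_zero (EuclideanSpace ℂ ι) 2 μT,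
      Lp.coeFn_zero (EuclideanSpace ℂ (Fin n)) 2 μT] with t h1 h2 h3
    rw [h1, h0, h2, Submodule.coe_zero, h3]
    simp [synth]
  have hanti : Isometry J := AddMonoidHomClass.isometry_of_norm J hiso
  refine ⟨LinearMap.range (J : M →ₗ[ℂ] LV ι 2), ⟨?_, ?_, ?_⟩, ⟨?_, ?_⟩⟩
  · rintro _ ⟨f, rfl⟩
    exact isAnalytic_of_tendsto_partialSeries (hJ f)
  · exact hanti.isClosedEmbedding.isClosed_range
  · rintro _ ⟨f, rfl⟩
    -- S^* J = J T: dropping the zeroth coefficient of J f leaves the sequence C T^j (T f).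
    refine ⟨T f, ?_⟩
    refine Lp_ext_of_analytic (isAnalytic_of_tendsto_partialSeries (hJ _)) (fun k hk => ?_)
      fun k => ?_
    · rw [ContinuousLinearMap.coe_coe, fourierCoeff_backwardShift]
      split_ifs with h
      · rfl
      · exact isAnalytic_of_tendsto_partialSeries (hJ f) _ (by omega)
    · rw [ContinuousLinearMap.coe_coe, fourierCoeff_backwardShift, if_neg (by omega),
        fourierCoeff_of_tendsto (hJ _)]
      exact (fourierCoeff_of_tendsto (hJ f) (k + 1)).symm
  · rintro _ ⟨f, rfl⟩
    refine ⟨f, f.2, hid f, ?_⟩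
    rw [← norm_sq_eq_sum_coord]
    exact congrArg (· ^ 2) (hiso f).symm
  · exact fun F hF => ⟨J ⟨F, hF⟩, ⟨_, rfl⟩, hid ⟨F, hF⟩⟩

end

/-! ### Construction of T and C from near invariance. -/

section

theorem sum_inner_smul_eq {H ι : Type*} [NormedAddCommGroup H] [InnerProductSpace ℂ H] [Fintype ι]
    {U : Submodule ℂ H} (b : OrthonormalBasis ι ℂ U) {v x : H} (hx : x ∈ U) (hv : v - x ∈ Uᗮ) :
    ∑ i, (inner ℂ (b i : H) v : ℂ) • (b i : H) = x ∧
      ∑ i, ‖(inner ℂ (b i : H) v : ℂ)‖ ^ 2 = ‖x‖ ^ 2 := by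
  have h : ∀ i, (inner ℂ (b i : H) v : ℂ) = inner ℂ (b i) (⟨x, hx⟩ : U) := fun i => by
    have := Submodule.inner_right_of_mem_orthogonal (b i).2 hv
    rw [inner_sub_right, sub_eq_zero] at this
    rw [this, Submodule.coe_inner]
  simp_rw [h]
  refine ⟨?_, b.sum_sq_norm_inner_right ⟨x, hx⟩⟩
  have := congrArg U.subtype (b.sum_repr' ⟨x, hx⟩)
  rw [map_sum] at this
  simpa only [map_smul, Submodule.subtype_apply] using this

theorem coeFn_sum_smul {n : ℕ} {ι : Type} [Fintype ι] (ψ : ι → LV (Fin n) 2)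
    (w : EuclideanSpace ℂ ι) :
    (∑ i, w i • ψ i : LV (Fin n) 2) =ᵐ[μT] fun t => synth ψ t w := by
  have h : ∀ s : Finset ι, (∑ i ∈ s, w i • ψ i : LV (Fin n) 2) =ᵐ[μT]
      fun t => ∑ i ∈ s, w i • ψ i t := fun s => by
    classical
    induction s using Finset.induction_on with
    | empty => exact Eventually.of_forall fun t => by simp
    | insert a s ha ih =>
      rw [Finset.sum_insert ha]
      filter_upwards [Lp.coeFn_add (w a • ψ a) (∑ i ∈ s, w i • ψ i), Lp.coeFn_smul (w a) (ψ a), ih]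
        with t h1 h2 h3
      rw [h1, Pi.add_apply, h2, Pi.smul_apply, h3, Finset.sum_insert ha]
  exact h Finset.univ

variable {n : ℕ}

/-- The inverse of the multiplication by `z`, as an isometry of `L²`. -/
def shiftInv (n : ℕ) : LV (Fin n) 2 →ₗᵢ[ℂ] LV (Fin n) 2 where
  toFun := shiftLp (-1)
  map_add' := shiftLp_add _
  map_smul' := shiftLp_smul _
  norm_map' := norm_shiftLp _

theorem mulZ_shiftInv (f : LV (Fin n) 2) : shiftLp 1 (shiftInv n f) = f :=
  mulZ_shiftLp_neg_one f

/-- The elements of `M` that are divisible by `z`. -/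
def divisible (M : Submodule ℂ (LV (Fin n) 2)) : Submodule ℂ (LV (Fin n) 2) :=
  M ⊓ (hardy (Fin n)).map (mulZ (Fin n))

variable {M D : Submodule ℂ (LV (Fin n) 2)}

theorem mem_divisible_iff (hM : M ≤ hardy (Fin n)) {f : LV (Fin n) 2} :
    f ∈ divisible M ↔ f ∈ M ∧ atZero f = 0 := by
  refine and_congr_right fun hf => ⟨?_, fun h => ?_⟩
  · rintro ⟨g, hg, rfl⟩
    rw [atZero, mulZ_eq_shiftLp, fourierCoeff_shiftLp]
    exact hg _ (by norm_num)
  · exact ⟨shiftLp (-1) f, isAnalytic_shiftLp_neg_one (hM hf) h, mulZ_shiftLp_neg_one f⟩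

theorem isClosed_divisible (hMc : IsClosed (M : Set (LV (Fin n) 2))) (hM : M ≤ hardy (Fin n)) :
    IsClosed (divisible M : Set (LV (Fin n) 2)) := by
  have : (divisible M : Set (LV (Fin n) 2)) =
      (M : Set (LV (Fin n) 2)) ∩ (fun f : LV (Fin n) 2 => fourierCoeff f 0) ⁻¹' {0} := by
    ext f
    exact mem_divisible_iff hM
  rw [this]
  exact hMc.inter (isClosed_singleton.preimage (continuous_fourierCoeff 0))

theorem IsIsometricImage.congr {ι : Type} [Fintype ι] {K : Submodule ℂ (LV ι 2)}
    {Φ Φ' : LV ι 2 → Circ → EuclideanSpace ℂ (Fin n)} (h : IsIsometricImage M K Φ)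
    (hΦ : ∀ k, Φ k =ᵐ[μT] Φ' k) : IsIsometricImage M K Φ' where
  maps_to k hk := by
    obtain ⟨F, hF, h1, h2⟩ := h.maps_to k hk
    exact ⟨F, hF, h1.trans (hΦ k), h2⟩
  onto F hF := by
    obtain ⟨k, hk, h1⟩ := h.onto F hF
    exact ⟨k, hk, h1.trans (hΦ k)⟩

theorem shiftLp_one_sum {m : ℕ} (c : Fin m → ℂ) (x : Fin m → LV (Fin n) 2) :
    shiftLp 1 (∑ j, c j • x j) = ∑ j, c j • shiftLp 1 (x j) := by
  change mulZ (Fin n) _ = _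
  rw [map_sum]
  exact Finset.sum_congr rfl fun j _ => map_smul _ _ _

variable [M.HasOrthogonalProjection] [D.HasOrthogonalProjection]

theorem starProjection_add_starProjection (hD : D ≤ Mᗮ) {v : LV (Fin n) 2} (hv : v ∈ M ⊔ D) :
    D.starProjection v + M.starProjection v = v ∧
      ‖v‖ ^ 2 = ‖D.starProjection v‖ ^ 2 + ‖M.starProjection v‖ ^ 2 := by
  obtain ⟨x, hx, y, hy, rfl⟩ := Submodule.mem_sup.1 hv
  have h1 : M.starProjection (x + y) = x := by
    rw [map_add, Submodule.starProjection_eq_self_iff.2 hx,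
      (Submodule.starProjection_apply_eq_zero_iff M).2 (hD hy), add_zero]
  have hx' : x ∈ Dᗮ := by
    rw [Submodule.mem_orthogonal']
    exact fun u hu => Submodule.inner_right_of_mem_orthogonal hx (hD hu)
  have h2 : D.starProjection (x + y) = y := by
    rw [map_add, Submodule.starProjection_eq_self_iff.2 hy,
      (Submodule.starProjection_apply_eq_zero_iff D).2 hx', zero_add]
  rw [h1, h2]
  refine ⟨add_comm _ _, ?_⟩
  have := norm_add_sq_eq_norm_sq_add_norm_sq_of_inner_eq_zero (𝕜 := ℂ) x y
    (Submodule.inner_right_of_mem_orthogonal hx (hD hy))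
  rw [sq, sq, sq, add_comm (‖y‖ * ‖y‖)]
  exact this

/-- With P the projection to the divisible elements, near invariance puts z⁻¹ P f in M ⊕ D. Its part
in M is T f; its part in D and f - P f are what C has to record isometrically. Both identities
required of T and C are then Pythagoras. -/
theorem exists_isIsometricImage_of_frame {ι : Type} [Fintype ι] {ψ : ι → LV (Fin n) 2}
    [(divisible M).HasOrthogonalProjection] (hMc : IsClosed (M : Set (LV (Fin n) 2)))
    (hM : M ≤ hardy (Fin n)) (hD : D ≤ Mᗮ)
    (hnear : ∀ f ∈ M, atZero f = 0 → shiftLp (-1) f ∈ M ⊔ D) {C : M →L[ℂ] EuclideanSpace ℂ ι}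
    (hC : ∀ f : M, ∑ i, C f i • ψ i = (f - (divisible M).starProjection f) +
      shiftLp 1 (D.starProjection (shiftInv n ((divisible M).starProjection f))))
    (hCn : ∀ f : M, ‖C f‖ ^ 2 = ‖(f : LV (Fin n) 2) - (divisible M).starProjection f‖ ^ 2 +
      ‖D.starProjection (shiftInv n ((divisible M).starProjection f))‖ ^ 2) :
    ∃ K : Submodule ℂ (LV ι 2), IsClosedInvariant K ∧
      IsIsometricImage M K fun k t => synth ψ t (k t) := by
  let T : M →L[ℂ] M := M.orthogonalProjectionOnto ∘L (shiftInv n).toContinuousLinearMap ∘L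
    (divisible M).starProjection ∘L M.subtypeL
  have hT : ∀ f : M, (T f : LV (Fin n) 2) =
      M.starProjection (shiftInv n ((divisible M).starProjection f)) := fun f => rfl
  have hmem : ∀ f : M, shiftInv n ((divisible M).starProjection f) ∈ M ⊔ D := fun f => by
    obtain ⟨h1, h2⟩ := (mem_divisible_iff hM).1 ((divisible M).starProjection_apply_mem f)
    exact hnear _ h1 h2
  refine exists_isIsometricImage (T := T) (C := C) hMc hM (fun f => ?_) fun f => ?_
  · have h1 := (starProjection_add_starProjection hD (hmem f)).2
    have h2 := norm_add_sq_eq_norm_sq_add_norm_sq_of_inner_eq_zero (𝕜 := ℂ)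
      ((divisible M).starProjection f) ((f : LV (Fin n) 2) - (divisible M).starProjection f)
      (Submodule.inner_right_of_mem_orthogonal ((divisible M).starProjection_apply_mem f)
        ((divisible M).sub_starProjection_mem_orthogonal f))
    rw [add_sub_cancel] at h2
    rw [LinearIsometry.norm_map] at h1
    rw [hCn, Submodule.coe_norm, Submodule.coe_norm, hT]
    linarith
  · have h1 := (starProjection_add_starProjection hD (hmem f)).1
    have h3 : (f : LV (Fin n) 2) = (∑ i, C f i • ψ i) + shiftLp 1 (T f : LV (Fin n) 2) := by
      rw [hC, hT, add_assoc, ← shiftLp_add, h1, mulZ_shiftInv, sub_add_cancel]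
    filter_upwards [Lp.coeFn_add (∑ i, C f i • ψ i) (shiftLp 1 (T f : LV (Fin n) 2)),
      coeFn_sum_smul ψ (C f), coeFn_shiftLp 1 (T f : LV (Fin n) 2)] with t h4 h5 h6
    rw [← h3] at h4
    rw [h4, Pi.add_apply, h5, h6]

theorem exists_isIsometricImage_wandering {r m : ℕ} (hMc : IsClosed (M : Set (LV (Fin n) 2)))
    (hM : M ≤ hardy (Fin n)) (hD : D ≤ Mᗮ)
    (hnear : ∀ f ∈ M, atZero f = 0 → shiftLp (-1) f ∈ M ⊔ D)
    (F₀ : OrthonormalBasis (Fin r) ℂ (wandering M)) (e : OrthonormalBasis (Fin m) ℂ D) :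
    ∃ K : Submodule ℂ (LV (Fin r ⊕ Fin m) 2), IsClosedInvariant K ∧
      IsIsometricImage M K (fun k t => (∑ i, k t (Sum.inl i) • (F₀ i : LV (Fin n) 2) t) +
        fourier 1 t • ∑ j, k t (Sum.inr j) • (e j : LV (Fin n) 2) t) := by
  have : CompleteSpace (divisible M) := (isClosed_divisible hMc hM).completeSpace_coe
  let Z : M →L[ℂ] LV (Fin n) 2 := (shiftInv n).toContinuousLinearMap ∘L
    (divisible M).starProjection ∘L M.subtypeL
  have hZ : ∀ f : M, Z f = shiftInv n ((divisible M).starProjection f) := fun f => rfl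
  let C : M →L[ℂ] EuclideanSpace ℂ (Fin r ⊕ Fin m) :=
    (PiLp.continuousLinearEquiv 2 ℂ fun _ : Fin r ⊕ Fin m => ℂ).symm.toContinuousLinearMap ∘L
      ContinuousLinearMap.pi (Sum.elim (fun i => innerSL ℂ (F₀ i : LV (Fin n) 2) ∘L M.subtypeL)
        fun j => innerSL ℂ (e j : LV (Fin n) 2) ∘L Z)
  have hCl : ∀ f i, C f (Sum.inl i) = inner ℂ (F₀ i : LV (Fin n) 2) (f : LV (Fin n) 2) :=
    fun f i => rfl
  have hCr : ∀ f j, C f (Sum.inr j) = inner ℂ (e j : LV (Fin n) 2) (Z f) := fun f j => rfl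
  -- The basis F₀ is orthogonal to the divisible elements, so the coordinates of f are those of f -
  -- P f.
  have hF : ∀ f : M, _ := fun f => sum_inner_smul_eq F₀ (v := (f : LV (Fin n) 2))
    (x := f - (divisible M).starProjection f)
    ⟨M.sub_mem f.2 ((divisible M).starProjection_apply_mem f).1,
      (divisible M).sub_starProjection_mem_orthogonal f⟩ (by
        rw [sub_sub_cancel, Submodule.mem_orthogonal']
        exact fun u hu => Submodule.inner_right_of_mem_orthogonal
          ((divisible M).starProjection_apply_mem f) hu.2)
  have he : ∀ f : M, _ := fun f => sum_inner_smul_eq e (v := Z f)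
    (D.starProjection_apply_mem (Z f)) (D.sub_starProjection_mem_orthogonal (Z f))
  obtain ⟨K, hK, hKM⟩ := exists_isIsometricImage_of_frame (D := D) (C := C)
    (ψ := Sum.elim (fun i => (F₀ i : LV (Fin n) 2)) fun j => shiftLp 1 (e j : LV (Fin n) 2))
    hMc hM hD hnear (fun f => by
      rw [Fintype.sum_sum_type]
      simp only [hCl, hCr, Sum.elim_inl, Sum.elim_inr]
      rw [← shiftLp_one_sum, (hF f).1, (he f).1, hZ]) fun f => by
      rw [EuclideanSpace.norm_sq_eq, Fintype.sum_sum_type]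
      simp only [hCl, hCr]
      rw [(hF f).2, (he f).2, hZ]
  refine ⟨K, hK, hKM.congr fun k => ?_⟩
  filter_upwards [ae_all_iff.2 fun j => coeFn_shiftLp 1 (e j : LV (Fin n) 2)] with t ht
  simp only [synth, Fintype.sum_sum_type, Sum.elim_inl, Sum.elim_inr, ht, Finset.smul_sum]
  congr 1
  exact Finset.sum_congr rfl fun j _ => smul_comm _ _ _

theorem exists_isIsometricImage_of_atZero {m : ℕ} (hMc : IsClosed (M : Set (LV (Fin n) 2)))
    (hM : M ≤ hardy (Fin n)) (hD : D ≤ Mᗮ)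
    (hnear : ∀ f ∈ M, atZero f = 0 → shiftLp (-1) f ∈ M ⊔ D) (h0 : ∀ f ∈ M, atZero f = 0)
    (e : OrthonormalBasis (Fin m) ℂ D) :
    ∃ K : Submodule ℂ (LV (Fin m) 2), IsClosedInvariant K ∧
      IsIsometricImage M K (fun k t => fourier 1 t • ∑ j, k t j • (e j : LV (Fin n) 2) t) := by
  have : CompleteSpace (divisible M) := (isClosed_divisible hMc hM).completeSpace_coe
  let Z : M →L[ℂ] LV (Fin n) 2 := (shiftInv n).toContinuousLinearMap ∘L
    (divisible M).starProjection ∘L M.subtypeL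
  have hZ : ∀ f : M, Z f = shiftInv n ((divisible M).starProjection f) := fun f => rfl
  let C : M →L[ℂ] EuclideanSpace ℂ (Fin m) :=
    (PiLp.continuousLinearEquiv 2 ℂ fun _ : Fin m => ℂ).symm.toContinuousLinearMap ∘L
      ContinuousLinearMap.pi fun j => innerSL ℂ (e j : LV (Fin n) 2) ∘L Z
  have hCr : ∀ f j, C f j = inner ℂ (e j : LV (Fin n) 2) (Z f) := fun f j => rfl
  -- Every f is divisible by z, so f - P f = 0 and the coordinates along `e` suffice.
  have hself : ∀ f : M, (f : LV (Fin n) 2) - (divisible M).starProjection f = 0 := fun f => by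
    rw [Submodule.starProjection_eq_self_iff.2 ((mem_divisible_iff hM).2 ⟨f.2, h0 f f.2⟩), sub_self]
  have he : ∀ f : M, _ := fun f => sum_inner_smul_eq e (v := Z f)
    (D.starProjection_apply_mem (Z f)) (D.sub_starProjection_mem_orthogonal (Z f))
  obtain ⟨K, hK, hKM⟩ := exists_isIsometricImage_of_frame (D := D) (C := C)
    (ψ := fun j => shiftLp 1 (e j : LV (Fin n) 2)) hMc hM hD hnear (fun f => by
      simp only [hCr]
      rw [← shiftLp_one_sum, hself, (he f).1, hZ, zero_add]) fun f => by
      rw [EuclideanSpace.norm_sq_eq, hself, norm_zero, ← hZ, ← (he f).2]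
      simp only [hCr]
      ring
  refine ⟨K, hK, hKM.congr fun k => ?_⟩
  filter_upwards [ae_all_iff.2 fun j => coeFn_shiftLp 1 (e j : LV (Fin n) 2)] with t ht
  simp only [synth, ht, Finset.smul_sum]
  exact Finset.sum_congr rfl fun j _ => smul_comm _ _ _

end

end MTTO

end

/-! ### The main theorem. -/

theorem mainTheorem1 {n : ℕ}
    (Θ : MTTO.Circ → Matrix (Fin n) (Fin n) ℂ) (hΘ : MTTO.IsInner Θ)
    (p q : ℝ≥0∞) (hp : 2 < p) (hq : q⁻¹ = 2⁻¹ + p⁻¹)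
    (G : MTTO.Circ → Matrix (Fin n) (Fin n) ℂ)
    (hG : ∀ i j, MemLp (fun t => G t i j) p haarAddCircle)
    (A : MTTO.modelSpace Θ →L[ℂ] MTTO.modelSpace Θ) (hA : MTTO.IsMTTO Θ G A)
    {s : ℕ} (W : Fin s → MTTO.LV (Fin n) 2 × MTTO.LV (Fin n) q)
    (hW : MTTO.IsValueBasis Θ G q W) :
    -- the defect space and its orthogonal version have dimension at most `n`
    Module.rank ℂ (MTTO.defectSpace W) ≤ n ∧
    Module.rank ℂ (MTTO.orthDefect (MTTO.kerIn A) (MTTO.defectSpace W)) ≤ n ∧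
    -- the kernel is nearly `S^*`-invariant with that defect space
    (∀ f ∈ MTTO.kerIn A, MTTO.atZero f = 0 →
      MTTO.backwardShift f ∈
        MTTO.kerIn A ⊔ MTTO.orthDefect (MTTO.kerIn A) (MTTO.defectSpace W)) ∧
    Module.Finite ℂ (MTTO.wandering (MTTO.kerIn A)) ∧
    -- the decomposition, for all orthonormal bases
    ∀ (r m : ℕ) (F₀ : OrthonormalBasis (Fin r) ℂ (MTTO.wandering (MTTO.kerIn A)))
      (e : OrthonormalBasis (Fin m) ℂ
        (MTTO.orthDefect (MTTO.kerIn A) (MTTO.defectSpace W))),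
      ((∃ f ∈ MTTO.kerIn A, MTTO.atZero f ≠ 0) →
        ∃ K : Submodule ℂ (MTTO.LV (Fin r ⊕ Fin m) 2), MTTO.IsClosedInvariant K ∧
          MTTO.IsIsometricImage (MTTO.kerIn A) K (fun k t =>
            (∑ i, k t (Sum.inl i) • (F₀ i : MTTO.LV (Fin n) 2) t) +
              fourier 1 t • ∑ j, k t (Sum.inr j) • (e j : MTTO.LV (Fin n) 2) t)) ∧
      ((∀ f ∈ MTTO.kerIn A, MTTO.atZero f = 0) →
        ∃ K : Submodule ℂ (MTTO.LV (Fin m) 2), MTTO.IsClosedInvariant K ∧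
          MTTO.IsIsometricImage (MTTO.kerIn A) K (fun k t =>
            fourier 1 t • ∑ j, k t j • (e j : MTTO.LV (Fin n) 2) t)) := by
  have hMc := MTTO.isClosed_kerIn (A := A) hΘ
  have hM := MTTO.kerIn_le_hardy (A := A)
  have : CompleteSpace (MTTO.kerIn A) := hMc.completeSpace_coe
  have hD : Module.rank ℂ (MTTO.defectSpace W) ≤ n := MTTO.rank_defectSpace_le hW
  have hD' := (MTTO.rank_orthDefect_le (MTTO.kerIn A) (MTTO.defectSpace W)).trans hD
  have : FiniteDimensional ℂ (MTTO.orthDefect (MTTO.kerIn A) (MTTO.defectSpace W)) :=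
    Module.rank_lt_aleph0_iff.1 (hD'.trans_lt (Cardinal.natCast_lt_aleph0))
  have hle : MTTO.orthDefect (MTTO.kerIn A) (MTTO.defectSpace W) ≤ (MTTO.kerIn A)ᗮ := inf_le_right
  have hnear : ∀ f ∈ MTTO.kerIn A, MTTO.atZero f = 0 → MTTO.shiftLp (-1) f ∈
      MTTO.kerIn A ⊔ MTTO.orthDefect (MTTO.kerIn A) (MTTO.defectSpace W) := fun f hf h0 => by
    rw [MTTO.kerIn_sup_orthDefect hΘ]
    exact MTTO.shift_mem_kerIn_sup_defectSpace hΘ hp hq hG hA hW hf h0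
  refine ⟨hD, hD', fun f hf h0 => ?_, MTTO.finite_wandering hM, fun r m F₀ e =>
    ⟨fun _ => MTTO.exists_isIsometricImage_wandering hMc hM hle hnear F₀ e,
      fun h0 => MTTO.exists_isIsometricImage_of_atZero hMc hM hle hnear h0 e⟩⟩
  rw [MTTO.backwardShift_eq_shiftLp h0]
  exact hnear f hf h0
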